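/- Let $\mathfrak g$ be a finite-dimensional complex semisimple Lie algebra of type $D_n$ ($n\ge 2$; here $D_2=A_1\times A_1$ and $D_3=A_3$), with a Cartan subalgebra $\mathfrak h$, a choice of positive roots $\Delta^+$, and the corresponding Borel subalgebra $\mathfrak b=\mathfrak h\oplus\bigoplus_{\alpha\in\Delta^+}\mathfrak g_\alpha$. Let $\mathcal I^n$ be the set of ad-nilpotent ideals of $\mathfrak b$, that is, of the ideals $\mathfrak i$ of $\mathfrak b$ all of whose elements $x$ have $\operatorname{ad}x$ nilpotent. The class of nilpotence of $\mathfrak i\in\mathcal I^n$ is the least $m\ge 0$ such that the $m$-th term of the lower central series $C^0=\mathfrak i$, $C^{m+1}=[\mathfrak i,C^m]$ is zero. (So the zero ideal has class $0$, and the Abelian ideals are those of class at most $1$.) For $n\ge2$ let $\delta^{\le}_n(h)$ be the number of ideals in $\mathcal I^n$ with class of nilpotence at most $h$. For the degenerate ranks put $\delta^{\le}_0(h)=0$ and $\delta^{\le}_1(h)=1$ (for $D_1$ the root system is empty, and only the zero ideal is counted). Let $U_k$ be the Chebyshev polynomial of the second kind, $U_k(\cos t)=\sin((k+1)t)/\sin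 t$, and write $\tilde U_k=U_k\bigl(1/(2\sqrt x)\bigr)$. Then, as formal Laurent series in $\sqrt x$, the generating function $\sum_{n\ge0}\delta^{\le}_n(h)x^n$ equals $$\frac{x}{1-x}\quad\text{if } h=0,\qquad\qquad \frac{x(1+2x)}{1-2x}\quad\text{if } h=1,$$ and, for $h\ge 2$, it equals $$\frac{x\Bigl(6\tilde U_1+\sum_{i=1}^{(h-2)/2}(6i+8)\,\tilde U_{2i+1}+(3h+4)\,\tilde U_{h+1}+\sum_{i=0}^{(h-2)/2}(6i+5)\,\tilde U_{2h+1-2i}+\tilde U_{2h+3}\Bigr)}{\tilde U_{h+1}\,\tilde U_{h+2}}$$ if $h$ is even, and $$\frac{x\Bigl(6\tilde U_1+\sum_{i=1}^{(h-3)/2}(6i+8)\,\tilde U_{2i+1}+(3h+4)\,\tilde U_{h}+\sum_{i=0}^{(h-1)/2}(6i+5)\,\tilde U_{2h+1-2i}+\tilde U_{2h+3}\Bigr)}{\tilde U_{h+1}\,\tilde U_{h+2}}$$ if $h$ is odd. -/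

import Mathlib

/-! ## Borel subalgebras and their ad-nilpotent ideals -/

namespace AdNilp

open LieAlgebra LieAlgebra.IsKilling

noncomputable section

section Borel

variable {L : Type*} [LieRing L] [LieAlgebra ℂ L] [FiniteDimensional ℂ L]
  [LieAlgebra.IsKilling ℂ L] {H : LieSubalgebra ℂ L} [H.IsCartanSubalgebra]

/-- The subspace `𝔫`, the sum of the root spaces of the positive roots, where a base of the
root system of `L` relative to the Cartan subalgebra `H` fixes which roots are positive. -/
def posPart (b : (rootSystem H).Base) : Submodule ℂ L :=
  ⨆ α : {α : H.root // b.IsPos α}, (rootSpace H (α.1.1 : H → ℂ)).toSubmodule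

theorem lie_mem_posPart_of_mem_cartan (b : (rootSystem H).Base) {x y : L} (hx : x ∈ H)
    (hy : y ∈ posPart b) : ⁅x, y⁆ ∈ posPart b := by
  unfold posPart at hy
  induction hy using Submodule.iSup_induction' with
  | mem α y hy =>
    exact Submodule.mem_iSup_of_mem α
      ((rootSpace H (α.1.1 : H → ℂ)).lie_mem (x := (⟨x, hx⟩ : H)) hy)
  | zero => simp
  | add y z _ _ h₁ h₂ => rw [lie_add]; exact add_mem h₁ h₂

theorem lie_mem_posPart (b : (rootSystem H).Base) {x y : L} (hx : x ∈ posPart b)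
    (hy : y ∈ posPart b) : ⁅x, y⁆ ∈ posPart b := by
  unfold posPart at hx
  induction hx using Submodule.iSup_induction' with
  | zero => simp
  | add x z _ _ h₁ h₂ => rw [add_lie]; exact add_mem h₁ h₂
  | mem α x hx =>
    unfold posPart at hy
    induction hy using Submodule.iSup_induction' with
    | zero => simp
    | add y z _ _ h₁ h₂ => rw [lie_add]; exact add_mem h₁ h₂
    | mem β y hy =>
      have hxy : ⁅x, y⁆ ∈ rootSpace H ((α.1.1 : H → ℂ) + (β.1.1 : H → ℂ)) :=
        lie_mem_genWeightSpace_of_mem_genWeightSpace hx hy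
      by_cases hbot : rootSpace H ((α.1.1 : H → ℂ) + (β.1.1 : H → ℂ)) = ⊥
      · rw [hbot, LieSubmodule.mem_bot] at hxy
        rw [hxy]; exact zero_mem _
      · let γ : LieModule.Weight ℂ H L := ⟨(α.1.1 : H → ℂ) + (β.1.1 : H → ℂ), hbot⟩
        have hγ : γ.IsNonZero := by
          intro h0
          have hsum : (α.1.1 : H → ℂ) + (β.1.1 : H → ℂ) = 0 := h0
          have hroot : (rootSystem H).root α.1 = -(rootSystem H).root β.1 := by
            ext t
            have := congrFun hsum t
            simp only [Pi.add_apply, Pi.zero_apply] at this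
            simpa using eq_neg_of_add_eq_zero_left this
          have hα := α.2
          have hβ := β.2
          let _ := (rootSystem H).indexNeg
          have h1 : α.1 = -β.1 := by
            apply (rootSystem H).root.injective
            rw [hroot]
            change _ = (rootSystem H).root ((rootSystem H).reflectionPerm β.1 β.1)
            rw [RootPairing.root_reflectionPerm, RootPairing.reflection_apply_self]
          rw [h1, RootPairing.Base.IsPos.neg_iff_not] at hα
          exact hα hβ
        let g : H.root := ⟨γ, by simpa using hγ⟩
        have hg : b.IsPos g := by
          refine α.2.add β.2 ?_
          ext t
          simp [g, γ]
        exact Submodule.mem_iSup_of_mem (⟨g, hg⟩ : {α : H.root // b.IsPos α}) hxy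

/-- The Borel subalgebra `𝔟 = 𝔥 ⊕ 𝔫` attached to the Cartan subalgebra `𝔥 = H` and the positive
roots of the base `b`. -/
def borel (b : (rootSystem H).Base) : LieSubalgebra ℂ L where
  toSubmodule := H.toSubmodule ⊔ posPart b
  lie_mem' := by
    intro x y hx hy
    obtain ⟨h₁, hh₁, n₁, hn₁, rfl⟩ := Submodule.mem_sup.mp hx
    obtain ⟨h₂, hh₂, n₂, hn₂, rfl⟩ := Submodule.mem_sup.mp hy
    have e : ⁅h₁ + n₁, h₂ + n₂⁆ = ⁅h₁, h₂⁆ + (⁅h₁, n₂⁆ + (-⁅h₂, n₁⁆ + ⁅n₁, n₂⁆)) := by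
      rw [lie_skew]; simp only [add_lie, lie_add]; abel
    change ⁅h₁ + n₁, h₂ + n₂⁆ ∈ H.toSubmodule ⊔ posPart b
    rw [e]
    exact Submodule.add_mem_sup (H.lie_mem hh₁ hh₂)
      (add_mem (lie_mem_posPart_of_mem_cartan b hh₁ hn₂)
        (add_mem (neg_mem (lie_mem_posPart_of_mem_cartan b hh₂ hn₁)) (lie_mem_posPart b hn₁ hn₂)))

/-- An ideal of the Borel subalgebra is ad-nilpotent if `ad x`, acting on the whole Lie algebra,
is nilpotent for each of its elements `x`. -/
def IsAdNilpotentIdeal (b : (rootSystem H).Base) (I : LieIdeal ℂ (borel b)) : Prop :=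
  ∀ x ∈ I, IsNilpotent (LieAlgebra.ad ℂ L (x : L))

/-- The class of nilpotence of an ideal `I` of the Borel subalgebra: the least `m` for which the
`m`-th term of the lower central series `I, [I, I], [I, [I, I]], …` (numbered from `0`) vanishes.
Thus the zero ideal has class `0`, and the Abelian ideals are those of class at most `1`. -/
def nilpotenceClass (b : (rootSystem H).Base) (I : LieIdeal ℂ (borel b)) : ℕ :=
  LieModule.nilpotencyLength I I

/-- The number of ad-nilpotent ideals with class of nilpotence at most `h`. -/
def idealCount (b : (rootSystem H).Base) (h : ℕ) : ℕ :=
  {I : LieIdeal ℂ (borel b) | IsAdNilpotentIdeal b I ∧ nilpotenceClass b I ≤ h}.ncard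

/-- The root system is of type `D_n`: after a numbering of the simple roots, the Cartan matrix is
the one of type `D_n`. For `n = 2` this is `A₁ × A₁`, and for `n = 3` it is `A₃`. -/
def IsTypeD (n : ℕ) (b : (rootSystem H).Base) : Prop :=
  ∃ e : b.support ≃ Fin n, ∀ i j, b.cartanMatrix i j = CartanMatrix.D n (e i) (e j)

end Borel

/-! ## Generating functions in `x = t²`, inside the field of Laurent series in `t = √x` -/

/-- `√x`, the variable of the field of Laurent series. -/
def sqrtX : LaurentSeries ℚ := HahnSeries.single 1 1

/-- `x = (√x)²`. -/
def X : LaurentSeries ℚ := sqrtX ^ 2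

/-- `Ũ_k = U_k(1 / (2√x))`, with `U_k` the Chebyshev polynomial of the second kind. -/
def Utilde (k : ℤ) : LaurentSeries ℚ :=
  Polynomial.aeval (1 / (2 * sqrtX)) (Polynomial.Chebyshev.U ℚ k)

/-- The generating function `∑_{n ≥ 0} a_n x^n = ∑_{n ≥ 0} a_n (√x)^(2n)`. -/
def genFun (a : ℕ → ℕ) : LaurentSeries ℚ :=
  HahnSeries.ofPowerSeries ℤ ℚ
    (PowerSeries.expand 2 two_ne_zero (PowerSeries.mk fun n => (a n : ℚ)))

/-- The number `δ_n^≤(h)` for a Lie algebra of type `D_n` with Borel subalgebra given by `b`,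
including the conventions for the degenerate ranks: it is `0` for `n = 0`, and it is `1` for
`n = 1`, where there are no roots and the zero ideal is the only one. -/
def deltaLE {L : ℕ → Type*} [∀ n, LieRing (L n)] [∀ n, LieAlgebra ℂ (L n)]
    [∀ n, FiniteDimensional ℂ (L n)] [∀ n, LieAlgebra.IsKilling ℂ (L n)]
    {H : ∀ n, LieSubalgebra ℂ (L n)} [∀ n, (H n).IsCartanSubalgebra]
    (b : ∀ n, (rootSystem (H n)).Base) (h n : ℕ) : ℕ :=
  if n = 0 then 0 else if n = 1 then 1 else idealCount (b n) h

end

end AdNilp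

/-! An ad-nilpotent ideal is a sum of root spaces, and `[𝔤_α, 𝔤_β] = 𝔤_{α+β}` whenever `α + β` is a
root. So ideals become sets of positive roots closed under adding positive roots, and the lower
central series becomes iterated addition of roots (`idealCount_eq`). In type `D_n` write `e_0, …,
e_{n-1}, -e_{n-1}, …, -e_0` as vertices `0, …, M` with `M = 2n - 1`. A positive root is a pair `a <
b` with `a + b ≠ M`, identified with its mirror image `(M - b, M - a)`, and an ideal is a symmetric
filter of pairs (`idealCount_eq_ncard_boundedFilters`).

The vertices behave like a linear order except that the middle pair `(n - 1, n)` is not a root. Each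
filter either contains `e_i + e_{n-1}` along with every `e_i - e_{n-1}`, or conversely. The diagram
automorphism exchanges the two kinds, and a filter of both kinds does not separate the middle
vertices, so it lives on `2n - 1` vertices. With `ℓ(K)` for the count `linCount h K` on `K` linearly
ordered vertices, inclusion-exclusion gives `2 ℓ(2n) - ℓ(2n - 1)` (`ncard_boundedFilters`).

A filter on a linear order is a sequence of row lengths, strictly decreasing until zero. Its class
exceeds `h` exactly when vertex `M - 1` is reached from `0` in `h + 1` steps (`exists_iterSum_iff`).
Taking the longest first step, reflecting, and deleting `c` outer vertices on each side leaves a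
problem of the same shape: this is the recursion `Reach` (`reach_iff_chain`). Weighted by the number
of vertices, it sends a contribution `a^c b^d` to `(X² / (1 - b))^c a^d` (`two_mul_reachGen`). Two
such steps iterate the Möbius map `z ↦ X² / (1 - z)`, which the Chebyshev recursion with parameter
`1 / X` linearizes (`map_orbit_eq_div`).

With `t = √x`, the combination `2 ℓ(2n) - ℓ(2n - 1)` is extracted by the substitutions `X ↦ t` and
`X ↦ -t` (`genFun_eq`). The stated formula then follows from a rational identity in two consecutive
Chebyshev values, after the sums in the numerator have been telescoped (`ratio_identity_even`,
`ratio_identity_odd`). -/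

namespace IdealCount

/-! ## Strictly decreasing rows -/

/-- A sequence that decreases strictly until it reaches zero. -/
def IsStrict (s : ℕ → ℕ) : Prop := ∀ i, s (i + 1) < s i ∨ s (i + 1) = 0

/-- The recursive reachability condition on row sequences. For a symmetric filter on
`1 + c + d + s 0` linearly ordered vertices with row lengths `s`, it says that the mirror image of
the vertex number `c` is reached from the vertex number `0` in `k + 1` steps. -/
def Reach : ℕ → ℕ → ℕ → (ℕ → ℕ) → Prop
  | 0, c, _, s => 1 ≤ s 0 ∧ c ≤ s 0
  | k + 1, c, d, s => Reach k d (s 0 - c - s c) fun i => s (i + c)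

theorem IsStrict.shift {s : ℕ → ℕ} (hs : IsStrict s) (c : ℕ) : IsStrict fun i => s (i + c) := by
  intro i
  have := hs (i + c)
  rwa [show i + c + 1 = i + 1 + c by ring] at this

theorem IsStrict.add_le {s : ℕ → ℕ} (hs : IsStrict s) (c : ℕ) : s c = 0 ∨ s c + c ≤ s 0 := by
  induction c with
  | zero => right; simp
  | succ c ih => rcases hs c with h | h <;> omega

theorem IsStrict.eq_zero {s : ℕ → ℕ} (hs : IsStrict s) {c : ℕ} (hc : s 0 ≤ c) : s c = 0 := by
  rcases hs.add_le c with h | h <;> omega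

theorem IsStrict.antitone {s : ℕ → ℕ} (hs : IsStrict s) : Antitone s :=
  antitone_nat_of_succ_le fun i => by rcases hs i with h | h <;> omega

theorem Reach.one_le {k c d : ℕ} {s : ℕ → ℕ} (hs : IsStrict s) (h : Reach k c d s) : 1 ≤ s 0 := by
  induction k generalizing c d s with
  | zero => exact h.1
  | succ k ih =>
    have := ih (hs.shift c) h
    have h2 := hs.antitone (Nat.zero_le c)
    simp only [zero_add] at this
    omega

/-- A strict sequence starting at `m` vanishes from index `m` on, so finitely many bounded values
determine it. -/
theorem finite_isStrict (m : ℕ) (Q : (ℕ → ℕ) → Prop) :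
    {s : ℕ → ℕ | IsStrict s ∧ s 0 = m ∧ Q s}.Finite := by
  let f : (ℕ → ℕ) → (Fin (m + 1) → ℕ) := fun s i => s i
  refine Set.Finite.of_finite_image (f := f) ?_ ?_
  · refine (Set.Finite.pi' (ι := Fin (m + 1)) (t := fun _ => Set.Iic m)
      fun _ => Set.finite_Iic m).subset ?_
    rintro _ ⟨s, ⟨hs, h0, -⟩, rfl⟩ i
    simpa [h0] using hs.antitone (Nat.zero_le i)
  · rintro s ⟨hs, h0, -⟩ s' ⟨hs', h0', -⟩ hf
    ext i
    by_cases hi : i < m + 1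
    · exact congrFun hf ⟨i, hi⟩
    · rw [hs.eq_zero (by omega), hs'.eq_zero (by omega)]

/-- Prepending a value to a sequence. -/
def consSeq (m : ℕ) (s : ℕ → ℕ) : ℕ → ℕ
  | 0 => m
  | i + 1 => s i

theorem consSeq_shift (s : ℕ → ℕ) : consSeq (s 0) (fun i => s (i + 1)) = s := by
  funext i; cases i <;> rfl

/-- Delete the first row. The hypothesis `hQ` rules out a zero second row, so strictness really
forces the new first row below `m`, also when `m = 0`. -/
theorem ncard_strict_succ (m : ℕ) (Q : (ℕ → ℕ) → Prop)
    (hQ : ∀ s, IsStrict s → Q s → 1 ≤ s 0) :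
    {s : ℕ → ℕ | IsStrict s ∧ s 0 = m ∧ Q fun i => s (i + 1)}.ncard =
      ∑ m' ∈ Finset.range m, {s : ℕ → ℕ | IsStrict s ∧ s 0 = m' ∧ Q s}.ncard := by
  have key : {s : ℕ → ℕ | IsStrict s ∧ s 0 = m ∧ Q fun i => s (i + 1)} =
      consSeq m '' ⋃ m' ∈ Finset.range m, {s : ℕ → ℕ | IsStrict s ∧ s 0 = m' ∧ Q s} := by
    ext s
    simp only [Set.mem_ofPred_eq, Set.mem_image, Set.mem_iUnion, Finset.mem_range]
    constructor
    · rintro ⟨hs, h0, hq⟩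
      have h1 := hQ _ (hs.shift 1) hq
      refine ⟨fun i => s (i + 1), ⟨s 1, ?_, hs.shift 1, rfl, hq⟩, h0 ▸ consSeq_shift s⟩
      have := hs 0
      simp only [zero_add] at h1 this
      omega
    · rintro ⟨s, ⟨m', hm', hs, h0, hq⟩, rfl⟩
      refine ⟨?_, rfl, hq⟩
      rintro (_ | i)
      · left; simp only [consSeq]; omega
      · exact hs i
  have inj : Function.Injective (consSeq m) := by
    intro s s' h
    funext i
    exact congrFun h (i + 1)
  rw [key, Set.ncard_image_of_injective _ inj]
  clear key
  induction m with
  | zero => simp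
  | succ m ih => 
    have inj' : Function.Injective (consSeq m) := by
      intro s s' h
      funext i
      exact congrFun h (i + 1)
    rw [Finset.sum_range_succ, ← ih inj', Finset.range_add_one, Finset.set_biUnion_insert,
      Set.union_comm, Set.ncard_union_eq ?_ ?_ (finite_isStrict m Q)]
    · rw [Set.disjoint_left]
      intro s hs hs'
      simp only [Set.mem_iUnion, Finset.mem_range, Set.mem_ofPred_eq] at hs hs'
      obtain ⟨m', hm', -, h, -⟩ := hs
      omega
    · exact Set.Finite.biUnion (Finset.finite_toSet _) fun m' _ => finite_isStrict m' Q

/-- The number of ways to interpolate `c` strictly decreasing rows above a row of length `m'`, the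
first of length `m`. -/
def stepWays (c m m' : ℕ) : ℕ := if m' + c ≤ m then Nat.multichoose c (m - c - m') else 0

/-- Stars and bars: each drop between rows is at least 1, and the excess `m - c - m'` is distributed
over the `c` drops. Adding one drop is Pascal's rule for `Nat.multichoose`. -/
theorem sum_stepWays (c m m' : ℕ) :
    ∑ m₁ ∈ Finset.range m, stepWays c m₁ m' = stepWays (c + 1) m m' := by
  induction m with
  | zero => simp [stepWays]
  | succ m ih =>
    rw [Finset.sum_range_succ, ih]
    simp only [stepWays]
    rcases Nat.lt_trichotomy m (m' + c) with h | h | h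
    · rw [if_neg (by omega), if_neg (by omega), if_neg (by omega)]
    · rw [if_neg (by omega), if_pos (by omega), if_pos (by omega),
        show m - c - m' = 0 by omega, show m + 1 - (c + 1) - m' = 0 by omega]
      simp
    · rw [if_pos (by omega), if_pos (by omega), if_pos (by omega),
        show m + 1 - (c + 1) - m' = (m - (c + 1) - m') + 1 by omega,
        Nat.multichoose_succ_succ, show m - c - m' = (m - (c + 1) - m') + 1 by omega, add_comm]

theorem ncard_strict_shift (c m : ℕ) (Q : (ℕ → ℕ) → Prop)
    (hQ : ∀ s, IsStrict s → Q s → 1 ≤ s 0) :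
    {s : ℕ → ℕ | IsStrict s ∧ s 0 = m ∧ Q fun i => s (i + c)}.ncard =
      ∑ m' ∈ Finset.range (m + 1),
        stepWays c m m' * {s : ℕ → ℕ | IsStrict s ∧ s 0 = m' ∧ Q s}.ncard := by
  induction c generalizing m with
  | zero =>
    rw [Finset.sum_eq_single_of_mem m (by simp)]
    · simp [stepWays]
    · intro m' hm' hne
      have : m' < m := by simp at hm'; omega
      obtain ⟨j, hj⟩ : ∃ j, m - m' = j + 1 := ⟨m - m' - 1, by omega⟩
      simp [stepWays, hj, this.le]
  | succ c ih =>
    have h1 := ncard_strict_succ m (fun s => Q fun i => s (i + c)) (by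
      intro s hs hq
      have := hQ _ (hs.shift c) hq
      have h2 := hs.antitone (Nat.zero_le c)
      simp only [zero_add] at this
      omega)
    have e : ∀ s : ℕ → ℕ, (fun i => s (i + c + 1)) = fun i => s (i + (c + 1)) := fun s => by
      funext i; rw [add_assoc]
    simp only [e] at h1
    rw [h1]
    simp only [ih]
    have h2 : ∀ m₁ ∈ Finset.range m, ∑ m' ∈ Finset.range (m₁ + 1),
        stepWays c m₁ m' * {s : ℕ → ℕ | IsStrict s ∧ s 0 = m' ∧ Q s}.ncard =
        ∑ m' ∈ Finset.range (m + 1),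
        stepWays c m₁ m' * {s : ℕ → ℕ | IsStrict s ∧ s 0 = m' ∧ Q s}.ncard := by
      intro m₁ hm₁
      apply Finset.sum_subset
      · intro a; simp at hm₁ ⊢; omega
      · intro a _ ha
        rw [stepWays, if_neg (by simp at ha; omega), zero_mul]
    rw [Finset.sum_congr rfl h2, Finset.sum_comm]
    refine Finset.sum_congr rfl fun m' _ => ?_
    rw [← Finset.sum_mul, sum_stepWays]

/-- The number of strict sequences with first value `m` satisfying the reachability condition. -/
noncomputable def reachCount (k c d m : ℕ) : ℕ :=
  {s : ℕ → ℕ | IsStrict s ∧ s 0 = m ∧ Reach k c d s}.ncard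

/-- Such a sequence is the decreasing list of a subset of `{1, …, m}` preceded by `m + 1`. -/
theorem ncard_strict (m : ℕ) : {s : ℕ → ℕ | IsStrict s ∧ s 0 = m + 1 ∧ True}.ncard = 2 ^ m := by
  have step : ∀ m, {s : ℕ → ℕ | IsStrict s ∧ s 0 = m + 1 ∧ True}.ncard =
      1 + ∑ j ∈ Finset.range m, {s : ℕ → ℕ | IsStrict s ∧ s 0 = j + 1 ∧ True}.ncard := by
    intro m
    have h := ncard_strict_succ (m + 1) (fun s => 1 ≤ s 0) (fun _ _ h => h)
    have e : {s : ℕ → ℕ | IsStrict s ∧ s 0 = m + 1 ∧ True} =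
        insert (consSeq (m + 1) fun _ => 0)
          {s : ℕ → ℕ | IsStrict s ∧ s 0 = m + 1 ∧ 1 ≤ s (0 + 1)} := by
      ext s
      simp only [Set.mem_ofPred_eq, Set.mem_insert_iff, and_true, zero_add]
      constructor
      · rintro ⟨hs, h0⟩
        rcases Nat.eq_zero_or_pos (s 1) with h1 | h1
        · left
          funext i
          rcases i with _ | i
          · exact h0
          · have := hs.antitone (show 1 ≤ i + 1 by omega)
            simp only [consSeq]; omega
        · exact Or.inr ⟨hs, h0, h1⟩
      · rintro (rfl | ⟨hs, h0, -⟩)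
        · refine ⟨fun i => Or.inr rfl, rfl⟩
        · exact ⟨hs, h0⟩
    rw [e, Set.ncard_insert_of_notMem _ (finite_isStrict (m + 1) fun s => 1 ≤ s (0 + 1)), h,
      Finset.sum_range_succ', add_comm]
    · congr 1
      have z : {s : ℕ → ℕ | IsStrict s ∧ s 0 = 0 ∧ 1 ≤ s 0} = ∅ := by
        ext s; simp
      rw [z, Set.ncard_empty, add_zero]
      refine Finset.sum_congr rfl fun j _ => ?_
      congr 1
      ext s
      simp only [Set.mem_ofPred_eq]
      constructor
      · rintro ⟨a, b, -⟩; exact ⟨a, b, trivial⟩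
      · rintro ⟨a, b, -⟩; exact ⟨a, b, by omega⟩
    · simp [consSeq]
  induction m using Nat.strong_induction_on with
  | _ m ih =>
    rw [step, Finset.sum_congr rfl fun j hj => ih j (Finset.mem_range.mp hj), add_comm]
    have := Nat.geomSum_eq (le_refl 2) m
    have h2 : 0 < 2 ^ m := by positivity
    rw [this]; simp
    omega

theorem reachCount_zero (c d m : ℕ) :
    reachCount 0 c d m = if 1 ≤ m ∧ c ≤ m then 2 ^ (m - 1) else 0 := by
  unfold reachCount
  split_ifs with h
  · obtain ⟨m, rfl⟩ : ∃ j, m = j + 1 := ⟨m - 1, by omega⟩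
    rw [Nat.add_sub_cancel, ← ncard_strict m]
    congr 1
    ext s
    simp only [Set.mem_ofPred_eq, Reach]
    constructor
    · rintro ⟨a, b, -⟩; exact ⟨a, b, trivial⟩
    · rintro ⟨a, b, -⟩; exact ⟨a, b, by omega⟩
  · convert Set.ncard_empty (ℕ → ℕ)
    ext s
    simp only [Set.mem_ofPred_eq, Reach, Set.mem_empty_iff_false, iff_false]
    rintro ⟨-, rfl, h'⟩
    exact h h'

/-- `Reach (k + 1) c d` looks only at the rows `0` and `c, c + 1, …`. The rows strictly between are
free and contribute `stepWays`. -/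
theorem reachCount_succ (k c d m : ℕ) :
    reachCount (k + 1) c d m =
      ∑ m' ∈ Finset.range (m + 1), stepWays c m m' * reachCount k d (m - c - m') m' := by
  have h := ncard_strict_shift c m (fun s => Reach k d (m - c - s 0) s)
    (fun s hs h => h.one_le hs)
  have e : {s : ℕ → ℕ | IsStrict s ∧ s 0 = m ∧ Reach (k + 1) c d s} =
    {s : ℕ → ℕ | IsStrict s ∧ s 0 = m ∧ Reach k d (m - c - s (0 + c)) fun i => s (i + c)} := by
    ext s
    simp only [Set.mem_ofPred_eq, Reach, zero_add]
    constructor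
    · rintro ⟨a, b, c⟩; exact ⟨a, b, by rwa [b] at c⟩
    · rintro ⟨a, b, c⟩; exact ⟨a, b, by rwa [b]⟩
  rw [reachCount, e, h]
  refine Finset.sum_congr rfl fun m' _ => ?_
  congr 2
  ext s
  simp only [Set.mem_ofPred_eq]
  constructor
  · rintro ⟨a, b, c⟩; exact ⟨a, b, by rwa [b] at c⟩
  · rintro ⟨a, b, c⟩; exact ⟨a, b, by rwa [b]⟩

end IdealCount

/-! ### From the recursion for the counts to quotients of Chebyshev values. -/

namespace IdealCount

open PowerSeries

/-! ## Generating functions of the reachability counts -/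

/-- The orbit of a pair of power series under `(a, b) ↦ (X² / (1 - b), a)`. -/
noncomputable def orbit (u v : ℚ⟦X⟧) : ℕ → ℚ⟦X⟧ × ℚ⟦X⟧
  | 0 => (u, v)
  | k + 1 => ((X : ℚ⟦X⟧) ^ 2 * (1 - (orbit u v k).2)⁻¹, (orbit u v k).1)

/-- Divisibility by `X` keeps `1 - b` invertible and makes the sums of powers of `b` converge
`X`-adically. -/
theorem X_dvd_orbit {u v : ℚ⟦X⟧} (hu : X ∣ u) (hv : X ∣ v) (k : ℕ) :
    X ∣ (orbit u v k).1 ∧ X ∣ (orbit u v k).2 := by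
  induction k with
  | zero => exact ⟨hu, hv⟩
  | succ k ih => exact ⟨Dvd.dvd.mul_right (dvd_pow_self _ two_ne_zero) _, ih.1⟩

theorem one_sub_mul_inv {b : ℚ⟦X⟧} (hb : X ∣ b) : (1 - b) * (1 - b)⁻¹ = 1 := by
  apply PowerSeries.mul_inv_cancel
  rw [X_dvd_iff] at hb
  simp [hb]

/-- The negative binomial series for `(1 - b)⁻ᶜ`, truncated modulo `X ^ N` so that only finite sums
occur. -/
theorem pow_dvd_multichoose_sum {b : ℚ⟦X⟧} (hb : X ∣ b) (c N : ℕ) :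
    X ^ N ∣ (∑ j ∈ Finset.range N, (Nat.multichoose c j : ℚ⟦X⟧) * b ^ j) * (1 - b) ^ c - 1 := by
  have hbN : X ^ N ∣ b ^ N := pow_dvd_pow_of_dvd hb N
  rcases N with _ | N
  · simp
  induction c with
  | zero =>
    rw [Finset.sum_range_succ']
    simp
  | succ c ih =>
    have key : (∑ j ∈ Finset.range (N + 1), (Nat.multichoose (c + 1) j : ℚ⟦X⟧) * b ^ j) * (1 - b) =
        ∑ j ∈ Finset.range (N + 1), (Nat.multichoose c j : ℚ⟦X⟧) * b ^ j -
          Nat.multichoose (c + 1) N * b ^ (N + 1) := by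
      clear ih hbN
      induction N with
      | zero => simp
      | succ N ih =>
        rw [Finset.sum_range_succ, add_mul, ih, Finset.sum_range_succ _ (N + 1),
          Nat.multichoose_succ_succ]
        push_cast
        ring
    rw [pow_succ' (1 - b), ← mul_assoc, key]
    have : (∑ j ∈ Finset.range (N + 1), (Nat.multichoose c j : ℚ⟦X⟧) * b ^ j -
          Nat.multichoose (c + 1) N * b ^ (N + 1)) * (1 - b) ^ c - 1 =
        ((∑ j ∈ Finset.range (N + 1), (Nat.multichoose c j : ℚ⟦X⟧) * b ^ j) * (1 - b) ^ c - 1) -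
        b ^ (N + 1) * (Nat.multichoose (c + 1) N * (1 - b) ^ c) := by ring
    rw [this]
    exact dvd_sub ih (hbN.mul_right _)

theorem eq_of_forall_pow_dvd {f g : ℚ⟦X⟧} (h : ∀ N, X ^ N ∣ f - g) : f = g := by
  rw [← sub_eq_zero]
  ext n
  exact (X_pow_dvd_iff.mp (h (n + 1))) n (by omega)

/-- The generating function of the reachability counts. -/
noncomputable def reachGen (k c d : ℕ) : ℚ⟦X⟧ :=
  X ^ (1 + c + d) * mk fun m => (reachCount k c d m : ℚ)

theorem coeff_reachGen (k c d n : ℕ) :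
    coeff n (reachGen k c d) = if 1 + c + d ≤ n then (reachCount k c d (n - (1 + c + d)) : ℚ)
      else 0 := by
  rw [reachGen, coeff_X_pow_mul']
  simp

/-- The exponent of `X` counts the `1 + c + d + m` vertices. One recursion step deletes `c` of them
at each end, whence `X ^ (2 * c)`, and its new parameter is the excess `j = m - c - m'`. Terms with
`j ≥ N` do not matter modulo `X ^ N`. -/
theorem reachGen_succ (k c d N : ℕ) :
    X ^ N ∣ reachGen (k + 1) c d -
      X ^ (2 * c) * ∑ j ∈ Finset.range N, (Nat.multichoose c j : ℚ⟦X⟧) * reachGen k d j := by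
  rw [X_pow_dvd_iff]
  intro n hn
  rw [map_sub, sub_eq_zero, coeff_X_pow_mul', coeff_reachGen]
  by_cases h : 1 + c + d ≤ n
  · rw [if_pos h, reachCount_succ]
    obtain ⟨m, rfl⟩ : ∃ m, n = 1 + c + d + m := ⟨n - (1 + c + d), by omega⟩
    rw [Nat.add_sub_cancel_left]
    push_cast
    have e : ∀ j, coeff (1 + c + d + m - 2 * c) ((Nat.multichoose c j : ℚ⟦X⟧) * reachGen k d j) =
        Nat.multichoose c j * coeff (1 + c + d + m - 2 * c) (reachGen k d j) := by
      intro j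
      rw [← map_natCast (C (R := ℚ)), coeff_C_mul]
    by_cases hc : c ≤ m
    · rw [if_pos (by omega), map_sum]
      simp only [e, coeff_reachGen]
      rw [← Finset.sum_subset (s₁ := Finset.range (m - c + 1))
        (s₂ := Finset.range (m + 1)) (by intro a; simp; omega)]
      · rw [← Finset.sum_subset (s₁ := Finset.range (m - c + 1)) (s₂ := Finset.range N)
          (by intro a; simp; omega)]
        -- Passing from the row length `m'` to the excess `m - c - m'` reverses the range of
        -- summation.
        · rw [← Finset.sum_range_reflect]
          refine Finset.sum_congr rfl fun j hj => ?_
          simp only [Finset.mem_range] at hj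
          rw [stepWays, if_pos (by omega), if_pos (by omega),
            show m - c - (m - c + 1 - 1 - j) = j by omega,
            show 1 + c + d + m - 2 * c - (1 + d + j) = m - c + 1 - 1 - j by omega]
        · intro j _ hj
          simp only [Finset.mem_range] at hj
          rw [if_neg (by omega), mul_zero]
      · intro j _ hj
        simp only [Finset.mem_range] at hj
        rw [stepWays, if_neg (by omega)]
        simp
    · rw [Finset.sum_eq_zero]
      · split_ifs with h2
        · rw [map_sum, Finset.sum_eq_zero]
          intro j _
          rw [e, coeff_reachGen, if_neg (by omega), mul_zero]
        · rfl
      · intro j _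
        rw [stepWays, if_neg (by omega)]
        simp
  · rw [if_neg h]
    split_ifs with h2
    · rw [map_sum, Finset.sum_eq_zero]
      intro j _
      rw [← map_natCast (C (R := ℚ)), coeff_C_mul, coeff_reachGen, if_neg (by omega), mul_zero]
    · rfl

theorem one_sub_two_X_mul_mk : (1 - 2 * X : ℚ⟦X⟧) * mk (fun m => (2 : ℚ) ^ m) = 1 := by
  ext n
  have e : (2 * X : ℚ⟦X⟧) = C 2 * X := by rw [map_ofNat]
  rcases n with _ | n
  · simp [sub_mul]
  · rw [sub_mul, one_mul, e, mul_assoc, map_sub, coeff_C_mul, coeff_succ_X_mul]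
    simp [coeff_one, pow_succ, mul_comm]

theorem one_sub_two_X_inv : (1 - 2 * X : ℚ⟦X⟧)⁻¹ = mk (fun m => (2 : ℚ) ^ m) := by
  have h1 := one_sub_mul_inv (b := 2 * X) (Dvd.intro_left _ rfl)
  calc _ = (1 - 2 * X : ℚ⟦X⟧)⁻¹ * ((1 - 2 * X : ℚ⟦X⟧) * mk (fun m => (2 : ℚ) ^ m)) := by
          rw [one_sub_two_X_mul_mk, mul_one]
    _ = _ := by rw [← mul_assoc, mul_comm _ (1 - 2 * X : ℚ⟦X⟧), h1, one_mul]

/-- The series of `2 ^ (m - 1)` over `m ≥ c` is geometric. For `c = 0` it would also include `m = 0`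
with weight `1 / 2`; the term with `0 ^ c` removes this, and doubling clears the fraction. -/
theorem two_mul_reachGen_zero (c d : ℕ) :
    2 * reachGen 0 c d =
      X * ((1 - 2 * X)⁻¹ * (2 * X ^ 2) ^ c * X ^ d - 0 ^ c * X ^ d) := by
  have e : (2 : ℚ⟦X⟧) = C 2 := by rw [map_ofNat]
  have h2 := one_sub_two_X_mul_mk
  rw [one_sub_two_X_inv]
  rcases c with _ | c
  · have h : (mk fun m => (reachCount 0 0 d m : ℚ)) = X * mk (fun m => (2 : ℚ) ^ m) := by
      ext n
      rcases n with _ | n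
      · simp [reachCount_zero]
      · rw [coeff_succ_X_mul]
        simp [reachCount_zero]
    rw [reachGen, h]
    linear_combination (-X ^ (1 + d)) * h2
  · have h : (mk fun m => (reachCount 0 (c + 1) d m : ℚ)) =
        X ^ (c + 1) * (C (2 ^ c) * mk (fun m => (2 : ℚ) ^ m)) := by
      ext n
      rw [coeff_X_pow_mul', coeff_C_mul, coeff_mk, coeff_mk, reachCount_zero]
      by_cases hn : c + 1 ≤ n
      · rw [if_pos ⟨by omega, hn⟩, if_pos hn, ← pow_add]
        push_cast
        congr 1
        omega
      · rw [if_neg (by omega), if_neg hn]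
        simp
    rw [reachGen, h, map_pow, ← e]
    ring

/-- The base case is a combination of two products `a ^ c * b ^ d`. By the negative binomial series
the recursion maps each to `(X² (1 - b)⁻¹) ^ c * a ^ d`, so only the pair `(a, b)` moves and the
outer coefficients stay. -/
theorem two_mul_reachGen (k c d : ℕ) :
    2 * reachGen k c d = X * ((1 - 2 * X)⁻¹ * (orbit (2 * X ^ 2) X k).1 ^ c *
      (orbit (2 * X ^ 2) X k).2 ^ d - (orbit 0 X k).1 ^ c * (orbit 0 X k).2 ^ d) := by
  induction k generalizing c d with
  | zero => exact two_mul_reachGen_zero c d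
  | succ k ih =>
    apply eq_of_forall_pow_dvd
    intro N
    have hX2 : (X : ℚ⟦X⟧) ∣ 2 * X ^ 2 := Dvd.dvd.mul_left (dvd_pow_self _ two_ne_zero) _
    have h1 := (X_dvd_orbit hX2 dvd_rfl k).2
    have h2 := (X_dvd_orbit (dvd_zero _) dvd_rfl k : (X : ℚ⟦X⟧) ∣ (orbit 0 X k).1 ∧ _).2
    simp only [orbit]
    set a := (orbit (2 * X ^ 2) X k).1
    set b := (orbit (2 * X ^ 2) X k).2
    set a' := (orbit 0 X k).1
    set b' := (orbit 0 X k).2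
    obtain ⟨r, hr⟩ := reachGen_succ k c d N
    obtain ⟨p, hp⟩ := pow_dvd_multichoose_sum h1 c N
    obtain ⟨q, hq⟩ := pow_dvd_multichoose_sum h2 c N
    have hs : 2 * ∑ j ∈ Finset.range N, (Nat.multichoose c j : ℚ⟦X⟧) * reachGen k d j =
        X * ((1 - 2 * X)⁻¹ * a ^ d * ∑ j ∈ Finset.range N, (Nat.multichoose c j : ℚ⟦X⟧) * b ^ j -
          a' ^ d * ∑ j ∈ Finset.range N, (Nat.multichoose c j : ℚ⟦X⟧) * b' ^ j) := by
      simp only [Finset.mul_sum, ← Finset.sum_sub_distrib]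
      refine Finset.sum_congr rfl fun j _ => ?_
      linear_combination (Nat.multichoose c j : ℚ⟦X⟧) * ih d j
    set S := ∑ j ∈ Finset.range N, (Nat.multichoose c j : ℚ⟦X⟧) * b ^ j
    set S' := ∑ j ∈ Finset.range N, (Nat.multichoose c j : ℚ⟦X⟧) * b' ^ j
    have i1 : (1 - b) ^ c * (1 - b)⁻¹ ^ c = 1 := by
      rw [← mul_pow, one_sub_mul_inv h1, one_pow]
    have i2 : (1 - b') ^ c * (1 - b')⁻¹ ^ c = 1 := by
      rw [← mul_pow, one_sub_mul_inv h2, one_pow]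
    refine ⟨2 * r + X ^ (2 * c) * X * ((1 - 2 * X)⁻¹ * a ^ d * p * (1 - b)⁻¹ ^ c -
      a' ^ d * q * (1 - b')⁻¹ ^ c), ?_⟩
    rw [mul_pow, mul_pow, ← pow_mul]
    linear_combination 2 * hr + X ^ (2 * c) * hs + X ^ (2 * c) * X * ((1 - 2 * X)⁻¹ * a ^ d *
      (1 - b)⁻¹ ^ c * hp - a' ^ d * (1 - b')⁻¹ ^ c * hq) -
      X ^ (2 * c) * X * ((1 - 2 * X)⁻¹ * a ^ d * S * i1 - a' ^ d * S' * i2)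

end IdealCount

namespace IdealCount

open PowerSeries

/-! ## Closed forms of the orbits in a field -/

section Field

variable {F : Type*} [Field F] (ψ : ℚ⟦X⟧ →+* F)

/-- Two steps decouple the coordinates: along each parity a single series is iterated. -/
theorem orbit_add_two_fst (u v : ℚ⟦X⟧) (k : ℕ) :
    (orbit u v (k + 2)).1 = (X : ℚ⟦X⟧) ^ 2 * (1 - (orbit u v k).1)⁻¹ := rfl

/-- Substituting `z = X g_i / g_{i+1}` gives `1 - z = X g_{i+2} / g_{i+1}` by the recursion, so `X²
/ (1 - z)` is the next quotient. The values `g` stay nonzero because `1 - z` is the image of an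
invertible series. -/
theorem map_orbit_eq_div {u v : ℚ⟦X⟧} (hu : X ∣ u) (hv : X ∣ v) (hX : ψ X ≠ 0)
    {g : ℕ → F} (hg : ∀ i, g (i + 2) = (ψ X)⁻¹ * g (i + 1) - g i) {k : ℕ}
    (h1 : g 1 ≠ 0) (h0 : ψ (orbit u v k).1 = ψ X * g 0 / g 1) (i : ℕ) :
    ψ (orbit u v (k + 2 * i)).1 = ψ X * g i / g (i + 1) ∧ g (i + 1) ≠ 0 := by
  induction i with
  | zero => exact ⟨h0, h1⟩
  | succ i ih =>
    obtain ⟨ih1, ih2⟩ := ih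
    have hinv := one_sub_mul_inv (X_dvd_orbit hu hv (k + 2 * i)).1
    have hinv' := congrArg ψ hinv
    rw [map_mul, map_one, map_sub, map_one, ih1] at hinv'
    have e : 1 - ψ X * g i / g (i + 1) = ψ X * g (i + 2) / g (i + 1) := by
      rw [hg]; field_simp
    rw [e] at hinv'
    have h2 : g (i + 2) ≠ 0 := by
      intro h; rw [h] at hinv'; simp at hinv'
    refine ⟨?_, h2⟩
    rw [show k + 2 * (i + 1) = k + 2 * i + 2 by ring, orbit_add_two_fst, map_mul, map_pow]
    rw [eq_div_of_mul_eq (div_ne_zero (mul_ne_zero hX h2) ih2) ((mul_comm _ _).trans hinv')]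
    field_simp

/-- The two ratios in the closed form of the reachability generating function, in terms of a
solution `w` of the Chebyshev recursion with parameter `y`. -/
def oddRatio (w : ℕ → F) (j : ℕ) : F := (w (j + 1) - w j) / (w (j + 2) - w (j + 1))

/-- See `oddRatio`. -/
def evenRatio (y : F) (w : ℕ → F) (j : ℕ) : F :=
  y * (2 * w (j + 1) - y * w j) / ((y - 2) * (2 * w (j + 2) - y * w (j + 1))) - w j / w (j + 1)

/-- The Chebyshev recursion `w (n + 2) = y * w (n + 1) - w n` with initial values `0`, `1`. -/
structure IsCheb (y : F) (w : ℕ → F) : Prop where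
  zero : w 0 = 0
  one : w 1 = 1
  add_two : ∀ n, w (n + 2) = y * w (n + 1) - w n

/-- The odd iterates start from `X² / (1 - X)` whatever `u` is, so both orbits share them. The even
iterates start from `u`: the value `2 X²` belongs to the solution `2 w_{i+1} - y w_i` and the value
`0` to `w` itself, with `y = 1 / X`. -/
theorem map_orbits [CharZero F] {w : ℕ → F} (hX : ψ X ≠ 0) (hw : IsCheb (ψ X)⁻¹ w) (j : ℕ) :
    (ψ (orbit (2 * X ^ 2) X (1 + 2 * j)).1 = ψ X * oddRatio w j ∧
      ψ (orbit 0 X (1 + 2 * j)).1 = ψ X * oddRatio w j ∧ w (j + 2) - w (j + 1) ≠ 0) ∧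
    (ψ (1 - 2 * X)⁻¹ * ψ (orbit (2 * X ^ 2) X (0 + 2 * j)).1 - ψ (orbit 0 X (0 + 2 * j)).1 =
      ψ X * evenRatio (ψ X)⁻¹ w j ∧ w (j + 1) ≠ 0 ∧ 2 * w (j + 2) - (ψ X)⁻¹ * w (j + 1) ≠ 0) ∧
    (ψ X)⁻¹ - 2 ≠ 0 ∧ (ψ X)⁻¹ - 1 ≠ 0 := by
  have hX2 : (X : ℚ⟦X⟧) ∣ 2 * X ^ 2 := Dvd.dvd.mul_left (dvd_pow_self _ two_ne_zero) _
  have h12 := congrArg ψ (one_sub_mul_inv (b := 2 * X) (Dvd.intro_left _ rfl))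
  have h11 := congrArg ψ (one_sub_mul_inv (b := X) dvd_rfl)
  simp only [map_mul, map_sub, map_one, map_ofNat] at h12 h11
  have hw2 : w 2 = (ψ X)⁻¹ := by rw [hw.add_two 0, hw.zero, hw.one]; simp
  have hy2 : (ψ X)⁻¹ - 2 ≠ 0 := by
    intro h
    have : 1 - 2 * ψ X = 0 := by
      rw [← mul_inv_cancel₀ hX, ← sub_eq_zero.mp h]; ring
    rw [this] at h12; simp at h12
  have hy1 : (ψ X)⁻¹ - 1 ≠ 0 := by
    intro h
    have : 1 - ψ X = 0 := by
      rw [← mul_inv_cancel₀ hX, sub_eq_zero.mp h]; simp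
    rw [this] at h11; simp at h11
  have i12 : ψ (1 - 2 * X)⁻¹ = (ψ X)⁻¹ / ((ψ X)⁻¹ - 2) := by
    have : 1 - 2 * ψ X ≠ 0 := left_ne_zero_of_mul_eq_one h12
    rw [eq_inv_of_mul_eq_one_right h12]
    field_simp
  have i11 : ψ (1 - X)⁻¹ = (ψ X)⁻¹ / ((ψ X)⁻¹ - 1) := by
    have : 1 - ψ X ≠ 0 := left_ne_zero_of_mul_eq_one h11
    rw [eq_inv_of_mul_eq_one_right h11]
    field_simp
  have hodd : ∀ u : ℚ⟦X⟧, X ∣ u → ψ (orbit u X (1 + 2 * j)).1 = ψ X * oddRatio w j ∧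
      w (j + 2) - w (j + 1) ≠ 0 := by
    intro u hu
    have := map_orbit_eq_div ψ hu dvd_rfl hX (g := fun i => w (i + 1) - w i)
      (fun i => by simp only [hw.add_two]; ring) (k := 1)
      (by simp only [hw2, hw.one]; exact hy1)
      (by
        simp only [orbit, map_mul, map_pow, i11, zero_add, hw.one, hw.zero, hw2]
        field_simp
        simp) j
    refine ⟨?_, this.2⟩
    rw [this.1, oddRatio, mul_div_assoc]
  have he1 := map_orbit_eq_div ψ hX2 dvd_rfl hX (g := fun i => 2 * w (i + 1) - (ψ X)⁻¹ * w i)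
      (fun i => by simp only [hw.add_two]; ring) (k := 0)
      (by
        simp only [hw2, hw.one]
        intro h
        have : (ψ X)⁻¹ = 0 := by linear_combination h
        exact hX (inv_eq_zero.mp this))
      (by
        simp only [orbit, map_mul, map_pow, zero_add, hw.one, hw.zero, hw2, map_ofNat]
        field_simp
        norm_num) j
  have he2 := map_orbit_eq_div ψ (dvd_zero X) dvd_rfl hX (g := w) hw.add_two (k := 0)
      (by rw [hw.one]; exact one_ne_zero)
      (by simp [orbit, hw.zero]) j
  refine ⟨⟨(hodd _ hX2).1, (hodd _ (dvd_zero X)).1, (hodd _ hX2).2⟩, ⟨?_, he2.2, he1.2⟩, hy2, hy1⟩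
  rw [he1.1, he2.1, i12, evenRatio]
  generalize 2 * w (j + 1) - (ψ X)⁻¹ * w j = A at *
  generalize 2 * w (j + 1 + 1) - (ψ X)⁻¹ * w (j + 1) = B at *
  rw [div_mul_div_comm, mul_sub, mul_div_assoc', mul_div_assoc']
  congr 2
  ring

/-- For `c = d = 1` each product consists of one odd and one even iterate. The odd one is common to
both products, so their difference factors. -/
theorem two_mul_map_reachGen [CharZero F] {w : ℕ → F} (hX : ψ X ≠ 0) (hw : IsCheb (ψ X)⁻¹ w)
    (j : ℕ) :
    2 * ψ (reachGen (2 * j + 1) 1 1) = ψ X ^ 3 * oddRatio w j * evenRatio (ψ X)⁻¹ w j ∧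
    2 * ψ (reachGen (2 * j + 2) 1 1) =
      ψ X ^ 3 * oddRatio w j * evenRatio (ψ X)⁻¹ w (j + 1) := by
  have h := map_orbits ψ hX hw j
  have h' := map_orbits ψ hX hw (j + 1)
  constructor
  · have e := congrArg ψ (two_mul_reachGen (2 * j + 1) 1 1)
    have e1 : ∀ u : ℚ⟦X⟧, (orbit u X (2 * j + 1)).2 = (orbit u X (0 + 2 * j)).1 := by
      intro u; rw [zero_add]; rfl
    simp only [pow_one, map_mul, map_sub, map_ofNat, e1] at e
    rw [e, show 2 * j + 1 = 1 + 2 * j by ring, h.1.1, h.1.2.1]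
    linear_combination ψ X * (ψ X * oddRatio w j) * h.2.1.1
  · have e := congrArg ψ (two_mul_reachGen (2 * j + 2) 1 1)
    have e1 : ∀ u : ℚ⟦X⟧, (orbit u X (2 * j + 2)).2 = (orbit u X (1 + 2 * j)).1 := by
      intro u; rw [add_comm 1]; rfl
    simp only [pow_one, map_mul, map_sub, map_ofNat, e1] at e
    rw [e, show 2 * j + 2 = 0 + 2 * (j + 1) by ring, h.1.1, h.1.2.1]
    linear_combination ψ X * (ψ X * oddRatio w j) * h'.2.1.1

/-- The number of symmetric filters with bounded reachability on `K` linearly ordered vertices. -/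
noncomputable def linCount (h K : ℕ) : ℚ :=
  if K = 0 then 0 else 1 + reachCount 1 1 1 (K - 1) - reachCount (h + 1) 1 1 (K - 1)

theorem X_sq_mul_linGen (h : ℕ) : X ^ 2 * mk (linCount h) =
    X ^ 3 * (1 - X)⁻¹ + reachGen 1 1 1 - reachGen (h + 1) 1 1 := by
  have e : mk (linCount h) = X * (mk 1 + (mk fun m => (reachCount 1 1 1 m : ℚ)) -
      mk fun m => (reachCount (h + 1) 1 1 m : ℚ)) := by
    ext n
    rcases n with _ | n
    · simp [linCount]
    · rw [coeff_succ_X_mul]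
      simp [linCount]
  have e2 : (1 - X : ℚ⟦X⟧)⁻¹ = mk 1 := by
    rw [PowerSeries.inv_eq_iff_mul_eq_one (by simp)]
    exact PowerSeries.mk_one_mul_one_sub_eq_one ℚ
  rw [e, e2, reachGen, reachGen]
  ring

/-- With `y = 1 / X`, the part independent of `h` is `X³ (y / (y - 1) + 1 / ((y - 1) (y - 2))) = X³
(y - 1) / (y - 2)`. -/
theorem map_linGen [CharZero F] {w : ℕ → F} (hX : ψ X ≠ 0) (hw : IsCheb (ψ X)⁻¹ w) {h : ℕ} {E : F}
    (hE : 2 * ψ (reachGen (h + 1) 1 1) = ψ X ^ 3 * E) :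
    ψ (mk (linCount h)) = ψ X * (((ψ X)⁻¹ - 1) / ((ψ X)⁻¹ - 2) - E / 2) := by
  have h0 := map_orbits ψ hX hw 0
  have hy2 := h0.2.2.1
  have hy1 := h0.2.2.2
  have r1 := (two_mul_map_reachGen ψ hX hw 0).1
  have hw2 : w 2 = (ψ X)⁻¹ := by rw [hw.add_two 0, hw.zero, hw.one]; simp
  have e := congrArg ψ (X_sq_mul_linGen h)
  have h11 := congrArg ψ (one_sub_mul_inv (b := X) dvd_rfl)
  simp only [map_mul, map_sub, map_one] at h11
  have i11 : ψ (1 - X)⁻¹ = (ψ X)⁻¹ / ((ψ X)⁻¹ - 1) := by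
    have : 1 - ψ X ≠ 0 := left_ne_zero_of_mul_eq_one h11
    rw [eq_inv_of_mul_eq_one_right h11]
    field_simp
  simp only [map_mul, map_sub, map_add, map_pow, i11] at e
  simp only [mul_zero, zero_add, oddRatio, evenRatio, hw.zero, hw.one, hw2] at r1
  obtain ⟨y, hy⟩ : ∃ y, ψ X = y⁻¹ := ⟨(ψ X)⁻¹, (inv_inv _).symm⟩
  have hy0 : y ≠ 0 := by rintro rfl; simp [hy] at hX
  simp only [hy, inv_inv] at e r1 hE hy1 hy2 ⊢
  have h3 : (y⁻¹ : F) ^ 2 ≠ 0 := pow_ne_zero _ (inv_ne_zero hy0)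
  apply mul_left_cancel₀ h3
  have r1' : ψ (reachGen 1 1 1) = y⁻¹ ^ 3 / ((y - 1) * (y - 2)) := by
    have : 2 * y - y * 1 ≠ 0 := by ring_nf; exact hy0
    apply mul_left_cancel₀ (two_ne_zero (α := F))
    rw [r1]
    field_simp
    ring
  have hE' : ψ (reachGen (h + 1) 1 1) = y⁻¹ ^ 3 * E / 2 := by rw [← hE]; ring
  rw [e, r1', hE']
  field_simp
  ring

end Field

end IdealCount

/-! ### Evaluation of the closed formula. -/

namespace IdealCount

/-! ## Sums of Chebyshev values -/

section Sums

variable {F : Type*} [Field F] {y : F} {u : ℤ → F}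

/-- Multiplication by `y ^ 2 - 4` acts as a second difference with step 2. Hence it telescopes sums
over every second index with coefficients linear in the index. -/
theorem cheb_mul_sq_sub_four (hu : ∀ k, u (k + 1) = y * u k - u (k - 1)) (k : ℤ) :
    (y ^ 2 - 4) * u k = u (k + 2) - 2 * u k + u (k - 2) := by
  have h1 := hu (k + 1)
  have h2 := hu k
  have h3 := hu (k - 1)
  rw [show k + 1 + 1 = k + 2 by ring, show k + 1 - 1 = k by ring] at h1
  rw [show k - 1 + 1 = k by ring, show k - 1 - 1 = k - 2 by ring] at h3
  linear_combination -h1 - y * h2 - h3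

theorem cheb_add (hu : ∀ k, u (k + 1) = y * u k - u (k - 1)) (h0 : u 0 = 1) (h1 : u (-1) = 0)
    (a : ℤ) (b : ℕ) :
    u (a + b) = u a * u b - u (a - 1) * u (b - 1) ∧
      u (a + b - 1) = u a * u (b - 1) - u (a - 1) * u (b - 2) := by
  induction b with
  | zero =>
    have h2 := hu (-1)
    norm_num [h0, h1] at h2
    have h3 : u (-2) = -1 := by linear_combination h2
    simp [h0, h1, h3]
  | succ b ih =>
    obtain ⟨i1, i2⟩ := ih
    have e1 := hu (a + b)
    have e2 := hu b
    have e3 := hu (b - 1)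
    rw [show (b : ℤ) - 1 + 1 = b by ring, show (b : ℤ) - 1 - 1 = b - 2 by ring] at e3
    push_cast
    rw [show a + ((b : ℤ) + 1) = a + b + 1 by ring, show a + (b : ℤ) + 1 - 1 = a + b by ring,
      show (b : ℤ) + 1 - 1 = b by ring, show (b : ℤ) + 1 - 2 = b - 1 by ring]
    refine ⟨?_, i1⟩
    linear_combination e1 + y * i1 - i2 - u a * e2 + u (a - 1) * e3

theorem cheb_sum_up (hu : ∀ k, u (k + 1) = y * u k - u (k - 1)) (n : ℕ) :
    (y ^ 2 - 4) * ∑ i ∈ Finset.Icc 1 n, (6 * (i : F) + 8) * u (2 * (i : ℤ) + 1) =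
      (6 * n + 8) * u (2 * n + 3) - (6 * n + 14) * u (2 * n + 1) + 14 * u 1 - 8 * u 3 := by
  induction n with
  | zero => simp
  | succ n ih =>
    rw [Finset.sum_Icc_succ_top (by omega), mul_add, ih]
    have h := cheb_mul_sq_sub_four hu (2 * n + 3)
    push_cast
    rw [show 2 * ((n : ℤ) + 1) + 1 = 2 * n + 3 by ring,
      show 2 * ((n : ℤ) + 1) + 3 = 2 * n + 3 + 2 by ring]
    rw [show 2 * (n : ℤ) + 3 - 2 = 2 * n + 1 by ring] at h
    linear_combination (6 * (n + 1 : F) + 8) * h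

theorem cheb_sum_down (hu : ∀ k, u (k + 1) = y * u k - u (k - 1)) (M : ℤ) (n : ℕ) :
    (y ^ 2 - 4) * ∑ i ∈ Finset.Icc 0 n, (6 * (i : F) + 5) * u (M - 2 * (i : ℤ)) =
      (6 * n + 5) * u (M - 2 * n - 2) - (6 * n + 11) * u (M - 2 * n) + 5 * u (M + 2) + u M := by
  induction n with
  | zero =>
    have h := cheb_mul_sq_sub_four hu M
    simp
    linear_combination 5 * h
  | succ n ih =>
    rw [Finset.sum_Icc_succ_top (by omega), mul_add, ih]
    have h := cheb_mul_sq_sub_four hu (M - 2 * n - 2)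
    push_cast
    rw [show M - 2 * ((n : ℤ) + 1) = M - 2 * n - 2 by ring]
    rw [show M - 2 * (n : ℤ) - 2 + 2 = M - 2 * n by ring] at h
    linear_combination (6 * (n + 1 : F) + 5) * h

/-- The values of a Chebyshev sequence around `2 j` and `4 j` in terms of those around `j`. -/
theorem cheb_double (hu : ∀ k, u (k + 1) = y * u k - u (k - 1)) (h0 : u 0 = 1) (h1 : u (-1) = 0)
    (j : ℕ) :
    u (2 * j) = u j ^ 2 - u (j - 1) ^ 2 ∧
      u (2 * j - 1) = u (j - 1) * (2 * u j - y * u (j - 1)) := by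
  obtain ⟨h2, h3⟩ := cheb_add hu h0 h1 j j
  have h4 := hu (j - 1)
  rw [show (j : ℤ) - 1 + 1 = j by ring, show (j : ℤ) - 1 - 1 = j - 2 by ring] at h4
  rw [two_mul]
  constructor
  · rw [h2]; ring
  · rw [h3]; linear_combination -u (j - 1) * h4

/-- The recursion preserves this quadratic form in consecutive values. Being equal to 1, it serves
below to homogenize polynomials in them. -/
theorem cheb_norm (hu : ∀ k, u (k + 1) = y * u k - u (k - 1)) (h0 : u 0 = 1) (h1 : u (-1) = 0)
    (j : ℕ) : u j ^ 2 + u (j - 1) ^ 2 - y * u j * u (j - 1) = 1 := by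
  induction j with
  | zero => simp [h0, h1]
  | succ j ih =>
    push_cast
    rw [show (j : ℤ) + 1 - 1 = j by ring, hu]
    linear_combination ih

/-- Here `h = 2 j + 2`. The middle coefficient `3 h + 4 = 6 j + 10` is what makes all multiples of
`j` in the boundary terms of the two telescoped sums cancel. -/
theorem cheb_numerator_even (hu : ∀ k, u (k + 1) = y * u k - u (k - 1)) (j : ℕ) :
    (y ^ 2 - 4) * (6 * u 1 + ∑ i ∈ Finset.Icc 1 j, (6 * (i : F) + 8) * u (2 * (i : ℤ) + 1)
      + (6 * j + 10) * u (2 * j + 3)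
      + ∑ i ∈ Finset.Icc 0 j, (6 * (i : F) + 5) * u (4 * j + 5 - 2 * (i : ℤ))
      + u (4 * j + 7)) =
    6 * (u 3 - 2 * u 1 + u (-1)) + u (4 * j + 9) + 3 * u (4 * j + 7) + 2 * u (4 * j + 5)
      - u (2 * j + 5) - 7 * u (2 * j + 3) - 4 * u (2 * j + 1) + 14 * u 1 - 8 * u 3 := by
  simp only [mul_add, cheb_sum_up hu, cheb_sum_down hu]
  have a1 := cheb_mul_sq_sub_four hu 1
  have a2 := cheb_mul_sq_sub_four hu (2 * j + 3)
  have a3 := cheb_mul_sq_sub_four hu (4 * j + 7)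
  ring_nf at a1 a2 a3 ⊢
  linear_combination 6 * a1 + (6 * j + 10) * a2 + a3

theorem cheb_numerator_odd (hu : ∀ k, u (k + 1) = y * u k - u (k - 1)) (j : ℕ) :
    (y ^ 2 - 4) * (6 * u 1 + ∑ i ∈ Finset.Icc 1 j, (6 * (i : F) + 8) * u (2 * (i : ℤ) + 1)
      + (6 * j + 13) * u (2 * j + 3)
      + ∑ i ∈ Finset.Icc 0 (j + 1), (6 * (i : F) + 5) * u (4 * j + 7 - 2 * (i : ℤ))
      + u (4 * j + 9)) =
    6 * (u 3 - 2 * u 1 + u (-1)) + u (4 * j + 11) + 3 * u (4 * j + 9) + 2 * u (4 * j + 7)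
      - 4 * u (2 * j + 5) - 7 * u (2 * j + 3) - u (2 * j + 1) + 14 * u 1 - 8 * u 3 := by
  have b := cheb_sum_down hu (4 * j + 7) (j + 1)
  simp only [mul_add, cheb_sum_up hu]
  have a1 := cheb_mul_sq_sub_four hu 1
  have a2 := cheb_mul_sq_sub_four hu (2 * j + 3)
  have a3 := cheb_mul_sq_sub_four hu (4 * j + 9)
  push_cast at b
  simp only [mul_add] at b
  rw [b]
  ring_nf at a1 a2 a3 ⊢
  linear_combination 6 * a1 + (6 * j + 13) * a2 + a3

/-- The combination of the closed forms for `y` and `-y` that gives the generating function. -/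
theorem ratio_identity_even [CharZero F] {y p m : F} (hp : p ≠ 0) (hy1 : y - 2 ≠ 0)
    (hy2 : -y - 2 ≠ 0) (h1 : 2 * (y * p - m) - y * p ≠ 0) (h2 : y * p - m - p ≠ 0)
    (h3 : -(y * p - m) - p ≠ 0) {N P M v0 v1 v2 v3 v4 v5 : F}
    (hq : p ^ 2 + m ^ 2 - y * p * m = 1) (hP : P = p ^ 2 - m ^ 2) (hM : M = m * (2 * p - y * m))
    (hv0 : v0 = P ^ 2 - M ^ 2) (hv1 : v1 = y * v0 - M * (2 * P - y * M)) (hv2 : v2 = y * v1 - v0)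
    (hv3 : v3 = y * v2 - v1) (hv4 : v4 = y * v3 - v2) (hv5 : v5 = y * v4 - v3)
    (hN : (y ^ 2 - 4) * N = v5 + 3 * v3 + 2 * v1 - (y * (y * (y * P - M) - P) - (y * P - M))
      - 7 * (y * P - M) - 4 * M + 2 * y - 2 * (y ^ 3 - 2 * y)) :
    (2 * y - 1) * ((y - 1) / (y - 2) - (p - m) / (y * p - m - p) *
        (y * (2 * p - y * m) / ((y - 2) * (2 * (y * p - m) - y * p)) - m / p) / 2) +
      (2 * (-y) - 1) * ((-y - 1) / (-y - 2) - (p + m) / (-(y * p - m) - p) *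
        (-y * (2 * p - y * m) / ((-y - 2) * -(2 * (y * p - m) - y * p)) + m / p) / 2) =
      2 * (N / ((y * P - M) * (y * (y * P - M) - P))) := by
  have hy : y ^ 2 - 4 ≠ 0 := by
    have : y ^ 2 - 4 = -((y - 2) * (-y - 2)) := by ring
    rw [this]; exact neg_ne_zero.mpr (mul_ne_zero hy1 hy2)
  -- For `p = u_j`, `m = u_{j-1}` these are `u_{2j+1} = u_j (u_{j+1} - u_{j-1})` and `u_{2j+2} =
  -- (u_{j+1} - u_j) (u_{j+1} + u_j)`, which match the denominators on the left.
  have f1 : y * P - M = p * (2 * (y * p - m) - y * p) := by rw [hP, hM]; ring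
  have f2 : y * (y * P - M) - P = -((y * p - m - p) * (-(y * p - m) - p)) := by
    rw [hP, hM]; ring
  -- Powers of the norm form, equal to 1, make every term homogeneous of degree 4 in `p, m`. The
  -- claim becomes a formal identity and the norm relation is no longer needed.
  have hN' : N = (v5 + 3 * v3 + 2 * v1 - (p ^ 2 + m ^ 2 - y * p * m) *
      ((y * (y * (y * P - M) - P) - (y * P - M)) + 7 * (y * P - M) + 4 * M) +
      (p ^ 2 + m ^ 2 - y * p * m) ^ 2 * (2 * y - 2 * (y ^ 3 - 2 * y))) / (y ^ 2 - 4) := by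
    rw [eq_div_iff hy, hq]; linear_combination hN
  rw [hN', f2, f1, show y ^ 2 - 4 = -((y - 2) * (-y - 2)) by ring]
  subst hP hM hv0 hv1 hv2 hv3 hv4 hv5
  field_simp
  ring

/-- The odd analogue: the second ratio is advanced by one index, so the denominator becomes
`u_{2j+2} u_{2j+3}` with `u_{2j+3} = u_{j+1} (u_{j+2} - u_j)`. -/
theorem ratio_identity_odd [CharZero F] {y p m : F} (hp : y * p - m ≠ 0) (hy1 : y - 2 ≠ 0)
    (hy2 : -y - 2 ≠ 0) (h1 : 2 * (y * (y * p - m) - p) - y * (y * p - m) ≠ 0) (h2 : y * p - m - p ≠ 0)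
    (h3 : -(y * p - m) - p ≠ 0) {N P M v0 v1 v2 v3 v4 v5 v6 v7 : F}
    (hq : p ^ 2 + m ^ 2 - y * p * m = 1) (hP : P = p ^ 2 - m ^ 2) (hM : M = m * (2 * p - y * m))
    (hv0 : v0 = P ^ 2 - M ^ 2) (hv1 : v1 = y * v0 - M * (2 * P - y * M)) (hv2 : v2 = y * v1 - v0)
    (hv3 : v3 = y * v2 - v1) (hv4 : v4 = y * v3 - v2) (hv5 : v5 = y * v4 - v3)
    (hv6 : v6 = y * v5 - v4) (hv7 : v7 = y * v6 - v5)
    (hN : (y ^ 2 - 4) * N = v7 + 3 * v5 + 2 * v3 - 4 * (y * (y * (y * P - M) - P) - (y * P - M))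
      - 7 * (y * P - M) - M + 2 * y - 2 * (y ^ 3 - 2 * y)) :
    (2 * y - 1) * ((y - 1) / (y - 2) - (p - m) / (y * p - m - p) *
        (y * (2 * (y * p - m) - y * p) / ((y - 2) *
          (2 * (y * (y * p - m) - p) - y * (y * p - m))) - p / (y * p - m)) / 2) +
      (2 * (-y) - 1) * ((-y - 1) / (-y - 2) - (p + m) / (-(y * p - m) - p) *
        (-y * (2 * (y * p - m) - y * p) / ((-y - 2) *
          -(2 * (y * (y * p - m) - p) - y * (y * p - m))) + p / (y * p - m)) / 2) =
      2 * (N / ((y * (y * P - M) - P) * (y * (y * (y * P - M) - P) - (y * P - M)))) := by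
  have hy : y ^ 2 - 4 ≠ 0 := by
    have : y ^ 2 - 4 = -((y - 2) * (-y - 2)) := by ring
    rw [this]; exact neg_ne_zero.mpr (mul_ne_zero hy1 hy2)
  have f1 : y * (y * (y * P - M) - P) - (y * P - M) = (y * p - m) *
      (2 * (y * (y * p - m) - p) - y * (y * p - m)) := by rw [hP, hM]; ring
  have f2 : y * (y * P - M) - P = -((y * p - m - p) * (-(y * p - m) - p)) := by
    rw [hP, hM]; ring
  have hN' : N = (v7 + 3 * v5 + 2 * v3 - (p ^ 2 + m ^ 2 - y * p * m) *
      (4 * (y * (y * (y * P - M) - P) - (y * P - M)) + 7 * (y * P - M) + M) +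
      (p ^ 2 + m ^ 2 - y * p * m) ^ 2 * (2 * y - 2 * (y ^ 3 - 2 * y))) / (y ^ 2 - 4) := by
    rw [eq_div_iff hy, hq]; linear_combination hN
  rw [hN', f1, f2, show y ^ 2 - 4 = -((y - 2) * (-y - 2)) by ring]
  subst hP hM hv0 hv1 hv2 hv3 hv4 hv5 hv6 hv7
  field_simp
  ring

end Sums

end IdealCount

namespace IdealCount

/-! ## The generating functions in a field -/

section Field

variable {F : Type*} [Field F] [CharZero F] {t : F} (ht : t ≠ 0) {φ ψ : PowerSeries ℚ →+* F}
  (hφ : φ PowerSeries.X = t) (hψ : ψ PowerSeries.X = -t) {u : ℤ → F}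
  (hu : ∀ k, u (k + 1) = t⁻¹ * u k - u (k - 1)) (h0 : u 0 = 1) (h1 : u (-1) = 0)

omit [CharZero F] in
include hφ hu h0 h1 in
theorem isCheb_pos : IsCheb (φ PowerSeries.X)⁻¹ fun n : ℕ => u ((n : ℤ) - 1) where
  zero := by simpa using h1
  one := by simpa using h0
  add_two n := by
    rw [hφ]
    have := hu n
    push_cast
    rw [show (n : ℤ) + 2 - 1 = n + 1 by ring, show (n : ℤ) + 1 - 1 = n by ring, this]

-- Alternating signs turn a solution of the recursion with parameter `y` into one with parameter
-- `-y`.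
omit [CharZero F] in
include hψ hu h0 h1 in
theorem isCheb_neg :
    IsCheb (ψ PowerSeries.X)⁻¹ fun n : ℕ => (-1) ^ (n + 1) * u ((n : ℤ) - 1) where
  zero := by simpa using h1
  one := by simpa using h0
  add_two n := by
    rw [hψ]
    have := hu n
    push_cast
    rw [show (n : ℤ) + 2 - 1 = n + 1 by ring, show (n : ℤ) + 1 - 1 = n by ring, this, inv_neg]
    ring

variable {G : F} {h : ℕ} (hG : 2 * G = φ (PowerSeries.mk (linCount h)) * (2 - t) +
    ψ (PowerSeries.mk (linCount h)) * (2 + t))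

include ht hφ hψ hu h0 h1 hG

theorem two_mul_gen {E E' : F}
    (hE : 2 * φ (reachGen (h + 1) 1 1) = t ^ 3 * E)
    (hE' : 2 * ψ (reachGen (h + 1) 1 1) = (-t) ^ 3 * E') :
    2 * G = t ^ 2 * ((2 * t⁻¹ - 1) * ((t⁻¹ - 1) / (t⁻¹ - 2) - E / 2) +
      (2 * -t⁻¹ - 1) * ((-t⁻¹ - 1) / (-t⁻¹ - 2) - E' / 2)) := by
  have a1 := map_linGen φ (by rw [hφ]; exact ht) (isCheb_pos hφ hu h0 h1) (by rwa [hφ])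
  have a2 := map_linGen ψ (by rw [hψ]; exact neg_ne_zero.mpr ht) (isCheb_neg hψ hu h0 h1)
    (by rwa [hψ])
  rw [hG, a1, a2, hφ, hψ, inv_neg]
  generalize (t⁻¹ - 1) / (t⁻¹ - 2) - E / 2 = A
  generalize (-t⁻¹ - 1) / (-t⁻¹ - 2) - E' / 2 = B
  field_simp
  ring

omit hG in
/-- The closed forms for both signs, in terms of consecutive Chebyshev values `p`, `m`. -/
theorem reachGen_closed (j : ℕ) {y p m : F} (hy : y = t⁻¹) (hp : p = u j) (hm : m = u (j - 1)) :
    (2 * φ (reachGen (2 * j + 1) 1 1) = t ^ 3 * ((p - m) / (y * p - m - p) *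
        (y * (2 * p - y * m) / ((y - 2) * (2 * (y * p - m) - y * p)) - m / p)) ∧
      2 * ψ (reachGen (2 * j + 1) 1 1) = (-t) ^ 3 * ((p + m) / (-(y * p - m) - p) *
        (-y * (2 * p - y * m) / ((-y - 2) * -(2 * (y * p - m) - y * p)) + m / p))) ∧
    (2 * φ (reachGen (2 * j + 2) 1 1) = t ^ 3 * ((p - m) / (y * p - m - p) *
        (y * (2 * (y * p - m) - y * p) / ((y - 2) *
          (2 * (y * (y * p - m) - p) - y * (y * p - m))) - p / (y * p - m))) ∧
      2 * ψ (reachGen (2 * j + 2) 1 1) = (-t) ^ 3 * ((p + m) / (-(y * p - m) - p) *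
        (-y * (2 * (y * p - m) - y * p) / ((-y - 2) *
          -(2 * (y * (y * p - m) - p) - y * (y * p - m))) + p / (y * p - m)))) ∧
    p ≠ 0 ∧ 2 * (y * p - m) - y * p ≠ 0 ∧ y * p - m - p ≠ 0 ∧ -(y * p - m) - p ≠ 0 ∧
    y - 2 ≠ 0 ∧ -y - 2 ≠ 0 := by
  have c1 := isCheb_pos hφ hu h0 h1
  have c2 := isCheb_neg hψ hu h0 h1
  have n1 : φ PowerSeries.X ≠ 0 := by rw [hφ]; exact ht
  have n2 : ψ PowerSeries.X ≠ 0 := by rw [hψ]; exact neg_ne_zero.mpr ht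
  obtain ⟨r1, r2⟩ := two_mul_map_reachGen φ n1 c1 j
  obtain ⟨r3, r4⟩ := two_mul_map_reachGen ψ n2 c2 j
  obtain ⟨⟨-, -, q1⟩, ⟨-, q2, q3⟩, q4, -⟩ := map_orbits φ n1 c1 j
  obtain ⟨⟨-, -, q5⟩, -, q6, -⟩ := map_orbits ψ n2 c2 j
  have e1 : u (j + 1) = y * p - m := by rw [hu, hy, hp, hm]
  have e2 : u (j + 1 + 1) = y * (y * p - m) - p := by
    rw [hu, add_sub_cancel_right, e1, ← hp, hy]
  have w0 : u ((j : ℤ) - 1) = m := hm.symm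
  have w1 : u (((j + 1 : ℕ) : ℤ) - 1) = p := by rw [hp]; congr 1; push_cast; ring
  have w2 : u (((j + 2 : ℕ) : ℤ) - 1) = y * p - m := by rw [← e1]; congr 1; push_cast; ring
  have w3 : u (((j + 1 + 2 : ℕ) : ℤ) - 1) = y * (y * p - m) - p := by
    rw [← e2]; congr 1; push_cast; ring
  have s : ((-1 : F) ^ j) ^ 2 = 1 := by rw [← pow_mul, mul_comm, pow_mul]; simp
  have s0 : (-1 : F) ^ j ≠ 0 := by intro h; rw [h] at s; simp at s
  simp only [oddRatio, evenRatio, w0, w1, w2, w3, show j + 1 + 1 = j + 2 by ring, hφ, hψ, inv_neg,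
    ← hy] at r1 r2 r3 r4 q1 q2 q3 q4 q5 q6
  have s1 : (-1 : F) ^ (j + 1) = -(-1) ^ j := by ring
  have s2 : (-1 : F) ^ (j + 2) = (-1) ^ j := by ring
  have s3 : (-1 : F) ^ (j + 2 + 1) = -(-1) ^ j := by ring
  have s4 : (-1 : F) ^ (j + 1 + 2 + 1) = (-1) ^ j := by ring
  simp only [s1, s2, s3, s4] at r3 r4 q5
  generalize (-1 : F) ^ j = ε at *
  refine ⟨⟨?_, ?_⟩, ⟨?_, ?_⟩, q2, q3, q1, ?_, q4, q6⟩
  · rw [r1]; ring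
  · rw [r3, mul_assoc]
    congr 2
    · rw [show ε * p - -ε * m = ε * (p + m) by ring,
        show -ε * (y * p - m) - ε * p = ε * (-(y * p - m) - p) by ring, mul_div_mul_left _ _ s0]
    · rw [show -y * (2 * (ε * p) - -y * (-ε * m)) = ε * (-y * (2 * p - y * m)) by ring,
        show (-y - 2) * (2 * (-ε * (y * p - m)) - -y * (ε * p)) =
          ε * ((-y - 2) * -(2 * (y * p - m) - y * p)) by ring, mul_div_mul_left _ _ s0,
        show -ε * m / (ε * p) = -(m / p) by
          rw [neg_mul, neg_div, mul_div_mul_left _ _ s0], sub_neg_eq_add]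
  · rw [r2]; ring
  · rw [r4, mul_assoc]
    congr 2
    · rw [show ε * p - -ε * m = ε * (p + m) by ring,
        show -ε * (y * p - m) - ε * p = ε * (-(y * p - m) - p) by ring, mul_div_mul_left _ _ s0]
    · rw [show -y * (2 * (-ε * (y * p - m)) - -y * (ε * p)) =
          -ε * (-y * (2 * (y * p - m) - y * p)) by ring,
        show (-y - 2) * (2 * (ε * (y * (y * p - m) - p)) - -y * (-ε * (y * p - m))) =
          -ε * ((-y - 2) * -(2 * (y * (y * p - m) - p) - y * (y * p - m))) by ring,
        mul_div_mul_left _ _ (neg_ne_zero.mpr s0),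
        show ε * p / (-ε * (y * p - m)) = -(p / (y * p - m)) by
          rw [neg_mul, div_neg, mul_div_mul_left _ _ s0], sub_neg_eq_add]
  · intro hz
    apply q5
    linear_combination ε * hz

theorem gen_of_even {j : ℕ} (hj : h = 2 * j + 2) :
    G = t ^ 2 *
          (6 * u 1
            + ∑ i ∈ Finset.Icc 1 ((h - 2) / 2), (6 * (i : F) + 8) * u (2 * (i : ℤ) + 1)
            + (3 * (h : F) + 4) * u ((h : ℤ) + 1)
            + ∑ i ∈ Finset.Icc 0 ((h - 2) / 2), (6 * (i : F) + 5) * u (2 * (h : ℤ) + 1 - 2 * (i : ℤ))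
            + u (2 * (h : ℤ) + 3))
        / (u ((h : ℤ) + 1) * u ((h : ℤ) + 2)) := by
  obtain ⟨⟨r1, r2⟩, -, n1, n2, n3, n4, n5, n6⟩ :=
    reachGen_closed ht hφ hψ hu h0 h1 (j + 1) rfl rfl rfl
  subst hj
  have g := two_mul_gen ht hφ hψ hu h0 h1 hG r1 r2
  apply mul_left_cancel₀ (two_ne_zero (α := F))
  rw [g]
  have N := cheb_numerator_even hu j
  -- Since `h = 2 (j + 1)`, one doubling from index `j + 1` reaches the values near `h` and a second
  -- one those near `2 h`.
  obtain ⟨d1, d2⟩ := cheb_double hu h0 h1 (j + 1)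
  obtain ⟨d3, d4⟩ := cheb_double hu h0 h1 (2 * (j + 1))
  have nn := cheb_norm hu h0 h1 (j + 1)
  have k1 : u (2 * j + 3) = t⁻¹ * u (2 * (j + 1 : ℕ)) - u (2 * (j + 1 : ℕ) - 1) := by
    rw [← hu]; congr 1
  have k2 : u (2 * j + 4) = t⁻¹ * u (2 * j + 3) - u (2 * (j + 1 : ℕ)) := by
    have := hu (2 * j + 3)
    rw [show (2 * (j : ℤ) + 3 + 1) = 2 * j + 4 by ring] at this
    rw [this, show 2 * (j : ℤ) + 3 - 1 = 2 * (j + 1 : ℕ) by push_cast; ring]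
  have k3 : u (2 * j + 5) = t⁻¹ * u (2 * j + 4) - u (2 * j + 3) := by
    have := hu (2 * j + 4)
    rwa [show (2 * (j : ℤ) + 4 + 1) = 2 * j + 5 by ring,
      show (2 * (j : ℤ) + 4 - 1) = 2 * j + 3 by ring] at this
  have k4 : u (4 * j + 5) = t⁻¹ * u (4 * j + 4) - u (4 * j + 3) := by
    have := hu (4 * j + 4)
    rwa [show (4 * (j : ℤ) + 4 + 1) = 4 * j + 5 by ring,
      show (4 * (j : ℤ) + 4 - 1) = 4 * j + 3 by ring] at this
  have k5 : u (4 * j + 6) = t⁻¹ * u (4 * j + 5) - u (4 * j + 4) := by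
    have := hu (4 * j + 5)
    rwa [show (4 * (j : ℤ) + 5 + 1) = 4 * j + 6 by ring,
      show (4 * (j : ℤ) + 5 - 1) = 4 * j + 4 by ring] at this
  have k6 : u (4 * j + 7) = t⁻¹ * u (4 * j + 6) - u (4 * j + 5) := by
    have := hu (4 * j + 6)
    rwa [show (4 * (j : ℤ) + 6 + 1) = 4 * j + 7 by ring,
      show (4 * (j : ℤ) + 6 - 1) = 4 * j + 5 by ring] at this
  have k7 : u (4 * j + 8) = t⁻¹ * u (4 * j + 7) - u (4 * j + 6) := by
    have := hu (4 * j + 7)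
    rwa [show (4 * (j : ℤ) + 7 + 1) = 4 * j + 8 by ring,
      show (4 * (j : ℤ) + 7 - 1) = 4 * j + 6 by ring] at this
  have k8 : u (4 * j + 9) = t⁻¹ * u (4 * j + 8) - u (4 * j + 7) := by
    have := hu (4 * j + 8)
    rwa [show (4 * (j : ℤ) + 8 + 1) = 4 * j + 9 by ring,
      show (4 * (j : ℤ) + 8 - 1) = 4 * j + 7 by ring] at this
  have u1 : u 1 = t⁻¹ := by have := hu 0; norm_num [h0, h1] at this; exact this
  have u2 : u 2 = t⁻¹ * t⁻¹ - 1 := by have := hu 1; norm_num [h0, u1] at this; rw [this]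
  have u3 : u 3 = t⁻¹ ^ 3 - 2 * t⁻¹ := by
    have := hu 2; norm_num [u1, u2] at this; rw [this]; ring1
  have l1 : u (2 * j + 1) = u (2 * (j + 1 : ℕ) - 1) := by congr 1; push_cast; ring
  have l2 : u (4 * j + 4) = u (2 * (2 * (j + 1) : ℕ)) := by congr 1; push_cast; ring
  have l3 : u (4 * j + 3) = u (2 * (2 * (j + 1) : ℕ) - 1) := by congr 1; push_cast; ring
  rw [ratio_identity_even n1 n5 n6 n2 n3 n4 nn d1 d2 (v0 := u (4 * j + 4))
    (by rw [l2, d3]; push_cast; ring) (v1 := u (4 * j + 5)) (by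
      rw [k4, l3, d4]; push_cast; ring) k5 k6 k7 k8 (N := _) (by
      refine N.trans ?_
      rw [h1, u1, u3, k3, k2, k1, l1]
      ring)]
  have f1 : (2 * j + 2 - 2) / 2 = j := by omega
  rw [f1, ← k1, ← k2]
  push_cast
  rw [show 2 * (j : ℤ) + 2 + 1 = 2 * j + 3 by ring, show 2 * (j : ℤ) + 2 + 2 = 2 * j + 4 by ring,
    show 2 * (2 * (j : ℤ) + 2) + 1 = 4 * j + 5 by ring,
    show 2 * (2 * (j : ℤ) + 2) + 3 = 4 * j + 7 by ring,
    show 3 * (2 * (j : F) + 2) + 4 = 6 * j + 10 by ring]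
  ring

theorem gen_of_odd {j : ℕ} (hj : h = 2 * j + 3) :
    G = t ^ 2 *
          (6 * u 1
            + ∑ i ∈ Finset.Icc 1 ((h - 3) / 2), (6 * (i : F) + 8) * u (2 * (i : ℤ) + 1)
            + (3 * (h : F) + 4) * u (h : ℤ)
            + ∑ i ∈ Finset.Icc 0 ((h - 1) / 2), (6 * (i : F) + 5) * u (2 * (h : ℤ) + 1 - 2 * (i : ℤ))
            + u (2 * (h : ℤ) + 3))
        / (u ((h : ℤ) + 1) * u ((h : ℤ) + 2)) := by
  have e1 : u ((j + 1 : ℕ) + 1) = t⁻¹ * u (j + 1 : ℕ) - u ((j + 1 : ℕ) - 1) := hu _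
  obtain ⟨-, ⟨r1, r2⟩, -, -, n3, n4, n5, n6⟩ :=
    reachGen_closed ht hφ hψ hu h0 h1 (j + 1) rfl rfl rfl
  -- Used at the next index only for the nonvanishing of the shifted denominators.
  obtain ⟨-, -, n1, n2, -⟩ := reachGen_closed ht hφ hψ hu h0 h1 (j + 1 + 1) (y := t⁻¹) rfl
    (p := t⁻¹ * u (j + 1 : ℕ) - u ((j + 1 : ℕ) - 1)) (m := u (j + 1 : ℕ))
    (by rw [← e1]; congr 1) (by congr 1; push_cast; ring)
  subst hj
  have g := two_mul_gen ht hφ hψ hu h0 h1 hG r1 r2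
  apply mul_left_cancel₀ (two_ne_zero (α := F))
  rw [g]
  have N := cheb_numerator_odd hu j
  obtain ⟨d1, d2⟩ := cheb_double hu h0 h1 (j + 1)
  obtain ⟨d3, d4⟩ := cheb_double hu h0 h1 (2 * (j + 1))
  have nn := cheb_norm hu h0 h1 (j + 1)
  have k1 : u (2 * j + 3) = t⁻¹ * u (2 * (j + 1 : ℕ)) - u (2 * (j + 1 : ℕ) - 1) := by
    rw [← hu]; congr 1
  have k2 : u (2 * j + 4) = t⁻¹ * u (2 * j + 3) - u (2 * (j + 1 : ℕ)) := by
    have := hu (2 * j + 3)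
    rw [show (2 * (j : ℤ) + 3 + 1) = 2 * j + 4 by ring] at this
    rw [this, show 2 * (j : ℤ) + 3 - 1 = 2 * (j + 1 : ℕ) by push_cast; ring]
  have k3 : u (2 * j + 5) = t⁻¹ * u (2 * j + 4) - u (2 * j + 3) := by
    have := hu (2 * j + 4)
    rwa [show (2 * (j : ℤ) + 4 + 1) = 2 * j + 5 by ring,
      show (2 * (j : ℤ) + 4 - 1) = 2 * j + 3 by ring] at this
  have k4 : u (4 * j + 5) = t⁻¹ * u (4 * j + 4) - u (4 * j + 3) := by
    have := hu (4 * j + 4)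
    rwa [show (4 * (j : ℤ) + 4 + 1) = 4 * j + 5 by ring,
      show (4 * (j : ℤ) + 4 - 1) = 4 * j + 3 by ring] at this
  have k5 : u (4 * j + 6) = t⁻¹ * u (4 * j + 5) - u (4 * j + 4) := by
    have := hu (4 * j + 5)
    rwa [show (4 * (j : ℤ) + 5 + 1) = 4 * j + 6 by ring,
      show (4 * (j : ℤ) + 5 - 1) = 4 * j + 4 by ring] at this
  have k6 : u (4 * j + 7) = t⁻¹ * u (4 * j + 6) - u (4 * j + 5) := by
    have := hu (4 * j + 6)
    rwa [show (4 * (j : ℤ) + 6 + 1) = 4 * j + 7 by ring,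
      show (4 * (j : ℤ) + 6 - 1) = 4 * j + 5 by ring] at this
  have k7 : u (4 * j + 8) = t⁻¹ * u (4 * j + 7) - u (4 * j + 6) := by
    have := hu (4 * j + 7)
    rwa [show (4 * (j : ℤ) + 7 + 1) = 4 * j + 8 by ring,
      show (4 * (j : ℤ) + 7 - 1) = 4 * j + 6 by ring] at this
  have k8 : u (4 * j + 9) = t⁻¹ * u (4 * j + 8) - u (4 * j + 7) := by
    have := hu (4 * j + 8)
    rwa [show (4 * (j : ℤ) + 8 + 1) = 4 * j + 9 by ring,
      show (4 * (j : ℤ) + 8 - 1) = 4 * j + 7 by ring] at this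
  have k9 : u (4 * j + 10) = t⁻¹ * u (4 * j + 9) - u (4 * j + 8) := by
    have := hu (4 * j + 9)
    rwa [show (4 * (j : ℤ) + 9 + 1) = 4 * j + 10 by ring,
      show (4 * (j : ℤ) + 9 - 1) = 4 * j + 8 by ring] at this
  have k10 : u (4 * j + 11) = t⁻¹ * u (4 * j + 10) - u (4 * j + 9) := by
    have := hu (4 * j + 10)
    rwa [show (4 * (j : ℤ) + 10 + 1) = 4 * j + 11 by ring,
      show (4 * (j : ℤ) + 10 - 1) = 4 * j + 9 by ring] at this
  have u1 : u 1 = t⁻¹ := by have := hu 0; norm_num [h0, h1] at this; exact this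
  have u2 : u 2 = t⁻¹ * t⁻¹ - 1 := by have := hu 1; norm_num [h0, u1] at this; rw [this]
  have u3 : u 3 = t⁻¹ ^ 3 - 2 * t⁻¹ := by
    have := hu 2; norm_num [u1, u2] at this; rw [this]; ring1
  have l1 : u (2 * j + 1) = u (2 * (j + 1 : ℕ) - 1) := by congr 1; push_cast; ring
  have l2 : u (4 * j + 4) = u (2 * (2 * (j + 1) : ℕ)) := by congr 1; push_cast; ring
  have l3 : u (4 * j + 3) = u (2 * (2 * (j + 1) : ℕ) - 1) := by congr 1; push_cast; ring
  rw [ratio_identity_odd n1 n5 n6 n2 n3 n4 nn d1 d2 (v0 := u (4 * j + 4))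
    (by rw [l2, d3]; push_cast; ring) (v1 := u (4 * j + 5)) (by
      rw [k4, l3, d4]; push_cast; ring) k5 k6 k7 k8 k9 k10 (N := _) (by
      refine N.trans ?_
      rw [h1, u1, u3, k3, k2, k1, l1]
      ring)]
  have f1 : (2 * j + 3 - 3) / 2 = j := by omega
  have f2 : (2 * j + 3 - 1) / 2 = j + 1 := by omega
  rw [f1, f2, ← k1, ← k2, ← k3]
  push_cast
  rw [show 2 * (j : ℤ) + 3 + 1 = 2 * j + 4 by ring, show 2 * (j : ℤ) + 3 + 2 = 2 * j + 5 by ring,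
    show 2 * (2 * (j : ℤ) + 3) + 1 = 4 * j + 7 by ring,
    show 2 * (2 * (j : ℤ) + 3) + 3 = 4 * j + 9 by ring,
    show 3 * (2 * (j : F) + 3) + 4 = 6 * j + 13 by ring]
  ring

theorem gen_of_one (hj : h = 1) : G = t ^ 2 * (1 + 2 * t ^ 2) / (1 - 2 * t ^ 2) := by
  subst hj
  obtain ⟨-, ⟨r1, r2⟩, -, -, n3, n4, n5, n6⟩ :=
    reachGen_closed ht hφ hψ hu h0 h1 0 (y := t⁻¹) rfl h0.symm (by simpa using h1.symm)
  obtain ⟨-, -, n1, n2, -⟩ := reachGen_closed ht hφ hψ hu h0 h1 1 (y := t⁻¹) rfl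
    (p := t⁻¹) (m := 1) (by have := hu 0; norm_num [h0, h1] at this; exact_mod_cast this.symm)
    (by simpa using h0.symm)
  have g := two_mul_gen ht hφ hψ hu h0 h1 hG r1 r2
  apply mul_left_cancel₀ (two_ne_zero (α := F))
  rw [g]
  obtain ⟨y, rfl⟩ : ∃ y, t = y⁻¹ := ⟨t⁻¹, (inv_inv _).symm⟩
  simp only [inv_inv, mul_one, sub_zero, mul_zero, add_zero] at *
  have hy : y ≠ 0 := by rintro rfl; simp at ht
  have n2' : 2 * (y * y - 1) - y * y = y ^ 2 - 2 := by ring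
  rw [n2'] at n2 ⊢
  have e : (1 : F) - 2 * y⁻¹ ^ 2 = (y ^ 2 - 2) / y ^ 2 := by field_simp
  rw [e]
  field_simp
  ring

theorem gen_of_zero (hj : h = 0) : G = t ^ 2 / (1 - t ^ 2) := by
  subst hj
  obtain ⟨⟨r1, r2⟩, -, n1, n2, n3, n4, n5, n6⟩ :=
    reachGen_closed ht hφ hψ hu h0 h1 0 (y := t⁻¹) rfl h0.symm (by simpa using h1.symm)
  have g := two_mul_gen ht hφ hψ hu h0 h1 hG r1 r2
  apply mul_left_cancel₀ (two_ne_zero (α := F))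
  rw [g]
  obtain ⟨y, rfl⟩ : ∃ y, t = y⁻¹ := ⟨t⁻¹, (inv_inv _).symm⟩
  simp only [inv_inv, mul_one, sub_zero, mul_zero, add_zero] at *
  have hy : y ≠ 0 := by rintro rfl; simp at ht
  have e : (1 : F) - y⁻¹ ^ 2 = -((y - 1) * (-y - 1)) / y ^ 2 := by field_simp; ring
  have n2' : 2 * y - y = y := by ring
  rw [n2', e]
  field_simp
  ring

end Field

open AdNilp

/-! ## The generating functions as Laurent series -/

theorem sqrtX_ne_zero : sqrtX ≠ 0 := by
  simp [sqrtX]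

instance : CharZero (LaurentSeries ℚ) := charZero_of_injective_algebraMap
  (algebraMap ℚ (LaurentSeries ℚ)).injective

theorem Utilde_add_one (k : ℤ) : Utilde (k + 1) = sqrtX⁻¹ * Utilde k - Utilde (k - 1) := by
  have := sqrtX_ne_zero
  simp only [Utilde, Polynomial.Chebyshev.U_add_one, map_sub, map_mul, map_ofNat,
    Polynomial.aeval_X]
  field_simp

theorem Utilde_zero : Utilde 0 = 1 := by simp [Utilde]

theorem Utilde_neg_one : Utilde (-1) = 0 := by simp [Utilde]

/-- The inclusion of power series into Laurent series. -/
noncomputable abbrev toLaurent : PowerSeries ℚ →+* LaurentSeries ℚ := HahnSeries.ofPowerSeries ℤ ℚ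

theorem toLaurent_X : toLaurent PowerSeries.X = sqrtX := by
  simp [sqrtX]

theorem toLaurent_neg_X :
    (toLaurent.comp PowerSeries.evalNegHom) PowerSeries.X = -sqrtX := by
  simp [PowerSeries.evalNegHom_X, sqrtX]

/-- If `E` and `O` are the even and odd parts of the series of `linCount h` in `t`, then `∑ δ_n
t^{2n} = 2 E - t O`, while `(E + O) (2 - t) + (E - O) (2 + t) = 4 E - 2 t O`. -/
theorem genFun_eq (δ : ℕ → ℕ) (h : ℕ) (h0 : δ 0 = 0)
    (hδ : ∀ n, 1 ≤ n → (δ n : ℚ) = 2 * linCount h (2 * n) - linCount h (2 * n - 1)) :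
    2 * genFun δ =
      toLaurent (PowerSeries.mk (linCount h)) * (2 - sqrtX) +
      (toLaurent.comp PowerSeries.evalNegHom) (PowerSeries.mk (linCount h)) * (2 + sqrtX) := by
  have key : 2 * PowerSeries.expand 2 two_ne_zero (PowerSeries.mk fun n => (δ n : ℚ)) =
      PowerSeries.mk (linCount h) * (2 - PowerSeries.X) +
      PowerSeries.evalNegHom (PowerSeries.mk (linCount h)) * (2 + PowerSeries.X) := by
    have e2 : (2 : PowerSeries ℚ) = PowerSeries.C 2 := by rw [map_ofNat]
    ext n
    rw [e2, mul_sub, mul_add, map_add, map_sub, map_add, PowerSeries.coeff_C_mul,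
      PowerSeries.coeff_mul_C, PowerSeries.coeff_mul_C, PowerSeries.coeff_expand]
    rcases n with _ | n
    · simp [h0, linCount, PowerSeries.evalNegHom, PowerSeries.coeff_rescale]
    · rw [PowerSeries.coeff_succ_mul_X, PowerSeries.coeff_succ_mul_X]
      simp only [PowerSeries.evalNegHom, PowerSeries.coeff_rescale, PowerSeries.coeff_mk]
      rcases Nat.even_or_odd' n with ⟨m, rfl | rfl⟩
      · rw [if_neg (by omega)]
        have e : (-1 : ℚ) ^ (2 * m) = 1 := by rw [pow_mul]; simp
        rw [pow_succ, e]
        ring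
      · rw [if_pos (by omega), show (2 * m + 1 + 1) / 2 = m + 1 by omega, hδ _ (by omega),
          show 2 * (m + 1) = 2 * m + 1 + 1 by ring, Nat.add_sub_cancel]
        have e : (-1 : ℚ) ^ (2 * m) = 1 := by rw [pow_mul]; simp
        rw [pow_succ, pow_succ, e]
        ring
  have := congrArg toLaurent key
  rw [map_mul, map_add, map_mul, map_mul, map_sub, map_add, map_ofNat, toLaurent_X] at this
  exact this

section

variable {δ : ℕ → ℕ} {h : ℕ} (h0 : δ 0 = 0)
    (hδ : ∀ n, 1 ≤ n → (δ n : ℚ) = 2 * linCount h (2 * n) - linCount h (2 * n - 1))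
include h0 hδ

theorem genFun_of_even {j : ℕ} (hj : h = 2 * j + 2) :
    genFun δ = X *
          (6 * Utilde 1
            + ∑ i ∈ Finset.Icc 1 ((h - 2) / 2),
                (6 * (i : LaurentSeries ℚ) + 8) * Utilde (2 * (i : ℤ) + 1)
            + (3 * (h : LaurentSeries ℚ) + 4) * Utilde ((h : ℤ) + 1)
            + ∑ i ∈ Finset.Icc 0 ((h - 2) / 2),
                (6 * (i : LaurentSeries ℚ) + 5) * Utilde (2 * (h : ℤ) + 1 - 2 * (i : ℤ))
            + Utilde (2 * (h : ℤ) + 3))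
        / (Utilde ((h : ℤ) + 1) * Utilde ((h : ℤ) + 2)) :=
  gen_of_even sqrtX_ne_zero toLaurent_X toLaurent_neg_X Utilde_add_one Utilde_zero Utilde_neg_one
    (genFun_eq δ h h0 hδ) hj

theorem genFun_of_odd {j : ℕ} (hj : h = 2 * j + 3) :
    genFun δ = X *
          (6 * Utilde 1
            + ∑ i ∈ Finset.Icc 1 ((h - 3) / 2),
                (6 * (i : LaurentSeries ℚ) + 8) * Utilde (2 * (i : ℤ) + 1)
            + (3 * (h : LaurentSeries ℚ) + 4) * Utilde (h : ℤ)
            + ∑ i ∈ Finset.Icc 0 ((h - 1) / 2),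
                (6 * (i : LaurentSeries ℚ) + 5) * Utilde (2 * (h : ℤ) + 1 - 2 * (i : ℤ))
            + Utilde (2 * (h : ℤ) + 3))
        / (Utilde ((h : ℤ) + 1) * Utilde ((h : ℤ) + 2)) :=
  gen_of_odd sqrtX_ne_zero toLaurent_X toLaurent_neg_X Utilde_add_one Utilde_zero Utilde_neg_one
    (genFun_eq δ h h0 hδ) hj

theorem genFun_of_one (hj : h = 1) : genFun δ = X * (1 + 2 * X) / (1 - 2 * X) :=
  gen_of_one sqrtX_ne_zero toLaurent_X toLaurent_neg_X Utilde_add_one Utilde_zero Utilde_neg_one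
    (genFun_eq δ h h0 hδ) hj

theorem genFun_of_zero (hj : h = 0) : genFun δ = X / (1 - X) :=
  gen_of_zero sqrtX_ne_zero toLaurent_X toLaurent_neg_X Utilde_add_one Utilde_zero Utilde_neg_one
    (genFun_eq δ h h0 hδ) hj

end

end IdealCount

/-! ### Combinatorics of row sequences and symmetric filters. -/

namespace IdealCount

/-! ## Counting the sequences that fit into a staircase -/

/-- The rows `s` fit into the staircase of symmetric position pairs on `K` vertices. -/
def Fits (K : ℕ) (s : ℕ → ℕ) : Prop := ∀ i, s i = 0 ∨ s i + 2 * i + 2 ≤ K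

/-- A strict sequence that leaves the staircase satisfies `Reach h` for every `h`. Bounded
reachability therefore implies the staircase condition, which the counts can ignore. -/
theorem le_of_not_reach {h c d : ℕ} {s : ℕ → ℕ} (hs : IsStrict s) (hr : ¬ Reach h c d s) (i : ℕ) :
    s i = 0 ∨ s i + 2 * i + 2 ≤ 1 + c + d + s 0 := by
  have hi := hs.add_le i
  induction h generalizing c d s i with
  | zero =>
    simp only [Reach] at hr
    omega
  | succ h ih =>
    by_cases hc : s 0 < c
    · omega
    by_cases hic : i < c
    · omega
    have h1 := hs.add_le c
    have h2 := ih (hs.shift c) hr (i - c) ((hs.shift c).add_le _)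
    simp only [zero_add, show i - c + c = i by omega] at h2
    omega

theorem isStrict_zero : IsStrict fun _ => 0 := fun _ => Or.inr rfl

theorem IsStrict.eq_const_zero {s : ℕ → ℕ} (hs : IsStrict s) (h : s 0 = 0) : s = fun _ => 0 := by
  funext i
  exact hs.eq_zero (by omega)

theorem reach_one_of_reach {k d : ℕ} {s : ℕ → ℕ} (hs : IsStrict s) (h : Reach (k + 1) 1 d s) :
    Reach 1 1 1 s := by
  have := Reach.one_le (hs.shift 1) h
  exact ⟨this, this⟩

theorem consSeq_injective (m : ℕ) : Function.Injective (consSeq m) := by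
  intro s s' h
  funext i
  exact congrFun h (i + 1)

/-- The sequences that fit into the staircase of size `K` and have bounded reachability. -/
def boundedFits (h K : ℕ) : Set (ℕ → ℕ) :=
  {s | IsStrict s ∧ Fits K s ∧ ¬ Reach h 1 (K - 2 - s 0) s}

/-- A prepended row of length `m = K - 1` replaces the parameter `K - 2 - s 0`, which depends on
`s`, by the constants `c = d = 1` at the cost of one more step. The condition `Reach 1 1 1` says
that the original sequence is not zero. -/
theorem image_consSeq_boundedFits (h m : ℕ) :
    consSeq m '' (boundedFits h (m + 1) \ {fun _ => 0}) =
      {s | IsStrict s ∧ s 0 = m ∧ Reach 1 1 1 s} \ {s | IsStrict s ∧ s 0 = m ∧ Reach (h + 1) 1 1 s}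
      := by
  ext s
  constructor
  · rintro ⟨s, ⟨⟨hs, hf, hr⟩, hn⟩, rfl⟩
    have h0 : s 0 ≠ 0 := fun h => hn (hs.eq_const_zero h)
    have h1 := hf 0
    refine ⟨⟨?_, rfl, ?_⟩, ?_⟩
    · rintro (_ | i)
      · left; simp only [consSeq]; omega
      · exact hs i
    · constructor <;> · simp only [consSeq]; omega
    · rintro ⟨-, -, hr'⟩
      apply hr
      rwa [show m + 1 - 2 - s 0 = m - 1 - s 0 by omega]
  · rintro ⟨⟨hs, h0, hr⟩, hr'⟩
    have h1 : 1 ≤ s 1 := hr.1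
    have h2 := hs.add_le 1
    have hr'' : ¬ Reach h 1 (m + 1 - 2 - s 1) fun i => s (i + 1) := by
      intro hh
      refine hr' ⟨hs, h0, ?_⟩
      rw [Reach, show s 0 - 1 - s 1 = m + 1 - 2 - s 1 by omega]
      exact hh
    refine ⟨fun i => s (i + 1), ⟨⟨hs.shift 1, fun i => ?_, hr''⟩, ?_⟩, h0 ▸ consSeq_shift s⟩
    · have := le_of_not_reach (hs.shift 1) hr'' i
      simp only [zero_add] at this ⊢
      omega
    · intro he
      have := congrFun he 0
      simp only [zero_add] at this
      omega

theorem finite_boundedFits (h K : ℕ) (hK : 1 ≤ K) : (boundedFits h K).Finite := by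
  obtain ⟨m, rfl⟩ : ∃ m, K = m + 1 := ⟨K - 1, by omega⟩
  have := image_consSeq_boundedFits h m
  have hf : (boundedFits h (m + 1) \ {fun _ => 0}).Finite := by
    rw [← Set.finite_image_iff (consSeq_injective m).injOn, this]
    exact (finite_isStrict m _).sdiff
  exact Set.Finite.of_sdiff hf (Set.finite_singleton _)

theorem ncard_boundedFits (h K : ℕ) (hK : 1 ≤ K) :
    ((boundedFits h K).ncard : ℚ) = linCount h K := by
  have hfin := finite_boundedFits h K hK
  obtain ⟨m, rfl⟩ : ∃ m, K = m + 1 := ⟨K - 1, by omega⟩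
  have h1 := congrArg Set.ncard (image_consSeq_boundedFits h m)
  have hsub : {s | IsStrict s ∧ s 0 = m ∧ Reach (h + 1) 1 1 s} ⊆
      {s | IsStrict s ∧ s 0 = m ∧ Reach 1 1 1 s} :=
    fun s hs => ⟨hs.1, hs.2.1, reach_one_of_reach hs.1 hs.2.2⟩
  rw [Set.ncard_image_of_injective _ (consSeq_injective m),
    Set.ncard_sdiff hsub (finite_isStrict m _)] at h1
  have h2 := Set.ncard_le_ncard hsub (finite_isStrict m _)
  have h0 : (fun _ => 0) ∈ boundedFits h (m + 1) :=
    ⟨isStrict_zero, fun _ => Or.inl rfl, fun hr => by simpa using hr.one_le isStrict_zero⟩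
  rw [← Set.ncard_sdiff_singleton_add_one h0 hfin, h1, linCount, if_neg (by omega),
    Nat.add_sub_cancel, reachCount, reachCount]
  push_cast [h2]
  ring

/-- On one or two vertices only the zero sequence fits, so the general formula agrees with the
convention for `D_1`. -/
theorem two_mul_linCount_two_sub (h : ℕ) : 2 * linCount h 2 - linCount h 1 = 1 := by
  have e : ∀ K ≤ 2, 1 ≤ K → boundedFits h K = {fun _ => 0} := by
    intro K hK _
    ext s
    constructor
    · rintro ⟨hs, hf, -⟩
      refine hs.eq_const_zero ?_
      have := hf 0
      omega
    · rintro rfl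
      exact ⟨isStrict_zero, fun _ => Or.inl rfl, fun hr => by simpa using hr.one_le isStrict_zero⟩
  rw [← ncard_boundedFits h 2 (by norm_num), ← ncard_boundedFits h 1 le_rfl, e 2 le_rfl (by norm_num),
    e 1 (by norm_num) le_rfl, Set.ncard_singleton]
  norm_num

end IdealCount

namespace IdealCount

/-! ## Chains of edges in a symmetric filter -/

/-- `Chain R k a b`: one gets from `a` to `b` in `k + 1` steps of `R`. -/
def Chain (R : ℕ → ℕ → Prop) : ℕ → ℕ → ℕ → Prop
  | 0, a, b => R a b
  | k + 1, a, c => ∃ b, R a b ∧ Chain R k b c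

section Chain

variable {R R' : ℕ → ℕ → Prop}

theorem chain_snoc {k a b c : ℕ} (h : Chain R k a b) (h' : R b c) : Chain R (k + 1) a c := by
  induction k generalizing a with
  | zero => exact ⟨b, h, h'⟩
  | succ k ih =>
    obtain ⟨v, hv, hr⟩ := h
    exact ⟨v, hv, ih hr⟩

theorem chain_succ_iff_snoc {k a c : ℕ} :
    Chain R (k + 1) a c ↔ ∃ b, Chain R k a b ∧ R b c := by
  refine ⟨fun h => ?_, fun ⟨b, h, h'⟩ => chain_snoc h h'⟩
  induction k generalizing a with
  | zero => exact h
  | succ k ih =>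
    obtain ⟨v, hv, hr⟩ := h
    obtain ⟨b, hb, hr⟩ := ih hr
    exact ⟨b, ⟨v, hv, hb⟩, hr⟩

theorem Chain.mono (hR : ∀ a b, R a b → R' a b) {k a b : ℕ} (h : Chain R k a b) :
    Chain R' k a b := by
  induction k generalizing a with
  | zero => exact hR _ _ h
  | succ k ih => obtain ⟨v, hv, hr⟩ := h; exact ⟨v, hR _ _ hv, ih hr⟩

theorem Chain.head {k a a' b : ℕ} (h : Chain R k a b) (hR : ∀ w, R a w → R a' w) :
    Chain R k a' b := by
  cases k with
  | zero => exact hR _ h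
  | succ k => obtain ⟨v, hv, hr⟩ := h; exact ⟨v, hR _ hv, hr⟩

theorem Chain.last {k a b b' : ℕ} (h : Chain R k a b) (hR : ∀ w, R w b → R w b') :
    Chain R k a b' := by
  cases k with
  | zero => exact hR _ h
  | succ k =>
    rw [chain_succ_iff_snoc] at h ⊢
    obtain ⟨v, hv, hr⟩ := h
    exact ⟨v, hv, hR _ hr⟩

theorem Chain.lt (hR : ∀ a b, R a b → a < b) {k a b : ℕ} (h : Chain R k a b) : a < b := by
  induction k generalizing a with
  | zero => exact hR _ _ h
  | succ k ih => obtain ⟨v, hv, hr⟩ := h; exact (hR _ _ hv).trans (ih hr)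

theorem Chain.mirror {M : ℕ} (hR : ∀ a b, R a b → R (M - b) (M - a)) {k a b : ℕ}
    (h : Chain R k a b) : Chain R k (M - b) (M - a) := by
  induction k generalizing a with
  | zero => exact hR _ _ h
  | succ k ih =>
    obtain ⟨v, hv, hr⟩ := h
    exact chain_snoc (ih hr) (hR _ _ hv)

end Chain

/-- The edge relation with row lengths `s` on the vertices `0, …, M`, including the symmetric
edges. -/
def Edge (M : ℕ) (s : ℕ → ℕ) (a b : ℕ) : Prop :=
  a < b ∧ b ≤ M ∧ ((1 ≤ s a ∧ a + b ≤ M ∧ M ≤ a + b + s a) ∨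
    (1 ≤ s (M - b) ∧ M ≤ a + b ∧ a + b ≤ M + s (M - b)))

/-- The pairs of vertices that represent positive roots. -/
def Ext (M a b : ℕ) : Prop := a < b ∧ b ≤ M ∧ a + b ≠ M

/-- The edge relation without symmetric edges. -/
def RootEdge (M : ℕ) (s : ℕ → ℕ) (a b : ℕ) : Prop := Edge M s a b ∧ a + b ≠ M

section Edge

variable {M : ℕ} {s : ℕ → ℕ}

theorem Edge.mirror {a b : ℕ} (h : Edge M s a b) : Edge M s (M - b) (M - a) := by
  obtain ⟨h1, h2, h3⟩ := h
  refine ⟨by omega, by omega, ?_⟩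
  rw [show M - (M - a) = a by omega]
  omega

theorem Edge.succ_right (hs : IsStrict s) {a b : ℕ} (h : Edge M s a b) (hb : b < M) :
    Edge M s a (b + 1) := by
  obtain ⟨h1, h2, h3⟩ := h
  refine ⟨by omega, by omega, ?_⟩
  have h4 := hs (M - (b + 1))
  rw [show M - (b + 1) + 1 = M - b by omega] at h4
  by_cases h5 : a + b = M
  · rw [show M - b = a by omega] at *
    omega
  · omega

theorem Edge.mono_right (hs : IsStrict s) {a b b' : ℕ} (h : Edge M s a b) (hb : b ≤ b')
    (hb' : b' ≤ M) : Edge M s a b' := by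
  induction b', hb using Nat.le_induction with
  | base => exact h
  | succ c _ ih => exact (ih (by omega)).succ_right hs (by omega)

theorem Edge.mono_left (hs : IsStrict s) {a a' b : ℕ} (h : Edge M s a b) (ha : a' ≤ a) :
    Edge M s a' b := by
  have h1 := h.1
  have h2 := h.2.1
  have := (h.mirror.mono_right hs (b' := M - a') (by omega) (by omega)).mirror
  rwa [show M - (M - a') = a' by omega, show M - (M - b) = b by omega] at this

theorem chain_edge_mirror {k a b : ℕ} (h : Chain (Edge M s) k a b) :
    Chain (Edge M s) k (M - b) (M - a) := h.mirror fun _ _ h => h.mirror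

theorem edge_shift {c a b : ℕ} (hb : b + c + c ≤ M) :
    Edge M s (a + c) (b + c) ↔ Edge (M - 2 * c) (fun i => s (i + c)) a b := by
  unfold Edge
  beta_reduce
  rw [show M - 2 * c - b + c = M - (b + c) by omega]
  omega

theorem chain_edge_shift {k c a b : ℕ} (hb : b + c + c ≤ M) :
    Chain (Edge M s) k (a + c) (b + c) ↔ Chain (Edge (M - 2 * c) fun i => s (i + c)) k a b := by
  induction k generalizing a with
  | zero => exact edge_shift hb
  | succ k ih =>
    constructor
    · rintro ⟨v, hv, hr⟩
      have h1 := hr.lt fun _ _ h => h.1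
      obtain ⟨w, rfl⟩ : ∃ w, v = w + c := ⟨v - c, by have := hv.1; omega⟩
      exact ⟨w, (edge_shift (by omega)).mp hv, ih.mp hr⟩
    · rintro ⟨w, hw, hr⟩
      have h1 := hr.lt fun _ _ h => h.1
      exact ⟨w + c, (edge_shift (by omega)).mpr hw, ih.mpr hr⟩

/-- The edges from `0` start at vertex `M - s 0 = c + d`, and going there first is optimal by
monotonicity. The rest of the path, from `c + d` to `M - c`, is mirrored to one from `c` to `s 0`.
It avoids the outer `c` vertices on both sides, so they can be deleted; the new target has distance
`d` from the end. -/
theorem reach_iff_chain (hs : IsStrict s) (hf : Fits (M + 1) s) {k c d : ℕ}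
    (hM : M = c + d + s 0) : Reach k c d s ↔ Chain (Edge M s) k 0 (M - c) := by
  by_cases h0 : s 0 = 0
  · constructor
    · intro h; have := h.one_le hs; omega
    · intro h
      exfalso
      have key : ∀ v, ¬ Edge M s 0 v := by
        rintro v ⟨h1, h2, h3⟩
        rcases h3 with h3 | h3
        · omega
        · rw [show M - v = 0 by omega] at h3; omega
      cases k with
      | zero => exact key _ h
      | succ k => obtain ⟨v, hv, -⟩ := h; exact key _ hv
  have hf0 := hf 0
  induction k generalizing M s c d with
  | zero =>
    change 1 ≤ s 0 ∧ c ≤ s 0 ↔ Edge M s 0 (M - c)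
    unfold Edge
    constructor
    · rintro ⟨h1, h2⟩
      exact ⟨by omega, by omega, Or.inl (by omega)⟩
    · rintro ⟨h1, h2, h3⟩
      refine ⟨by omega, ?_⟩
      rcases h3 with h3 | ⟨h3, h4, h5⟩
      · omega
      · rw [show M - (M - c) = 0 by omega] at h5; omega
  | succ k ih =>
    have step : Chain (Edge M s) (k + 1) 0 (M - c) ↔ Chain (Edge M s) k c (s 0) := by
      constructor
      · rintro ⟨v, hv, hr⟩
        have h1 : c + d ≤ v := by
          obtain ⟨-, h2, h3⟩ := hv
          rcases h3 with h3 | h3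
          · omega
          · rw [show M - v = 0 by omega] at h3; omega
        have := chain_edge_mirror hr
        have hl := this.lt fun _ _ h => h.1
        by_cases hcM : c ≤ M
        · rw [show M - (M - c) = c by omega] at this
          refine this.last fun w hw => hw.mono_right hs (by omega) (by omega)
        · omega
      · intro h
        have hl := h.lt fun _ _ h => h.1
        refine ⟨c + d, ⟨by omega, by omega, Or.inl (by omega)⟩, ?_⟩
        have := chain_edge_mirror h
        rwa [show M - s 0 = c + d by omega] at this
    rw [step]
    by_cases hc : s c = 0
    · constructor
      · intro h; have := Reach.one_le (hs.shift c) h; simp only [zero_add] at this; omega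
      · intro h
        exfalso
        have key : ∀ v ≤ s 0, ¬ Edge M s c v := by
          rintro v hv ⟨h1, h2, h3⟩
          rcases h3 with h3 | h3
          · omega
          · rw [show M - v = c by omega] at h3; omega
        cases k with
        | zero => exact key _ le_rfl h
        | succ k =>
          obtain ⟨v, hv, hr⟩ := h
          exact key _ (hr.lt fun _ _ h => h.1).le hv
    · have h1 := hs.add_le c
      have h2 := chain_edge_shift (M := M) (s := s) (k := k) (c := c) (a := 0) (b := s 0 - c)
        (by omega)
      rw [zero_add, show s 0 - c + c = s 0 by omega] at h2
      have hf' : Fits (M - 2 * c + 1) fun i => s (i + c) := by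
        intro i
        have := hf (i + c)
        simp only
        omega
      rw [h2, show s 0 - c = M - 2 * c - d by omega]
      exact ih (hs.shift c) hf' (by simp only [zero_add]; omega) (by simpa using hc) (hf' 0)

theorem Edge.pred_of_symm (hf : Fits (M + 1) s) {a b : ℕ} (h : Edge M s a b)
    (hab : a + b = M) : RootEdge M s a (b - 1) ∧ a + 1 < b := by
  obtain ⟨h1, h2, h3⟩ := h
  have h4 := hf a
  rw [show M - b = a by omega] at h3
  exact ⟨⟨⟨by omega, by omega, Or.inl (by omega)⟩, by omega⟩, by omega⟩

/-- A symmetric edge is no root, but with at least two steps it can be shortened by one vertex and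
the neighbouring edge lengthened to compensate. -/
theorem chain_rootEdge (hs : IsStrict s) (hf : Fits (M + 1) s) {k a b : ℕ}
    (h : Chain (Edge M s) (k + 1) a b) : Chain (RootEdge M s) (k + 1) a b := by
  have left : ∀ a v w, Edge M s a v → a + v = M → Edge M s v w → RootEdge M s (v - 1) w := by
    intro a v w h h' hw
    have := h.1
    have := hw.1
    exact ⟨hw.mono_left hs (by omega), by omega⟩
  induction k generalizing a with
  | zero =>
    obtain ⟨v, hv, hr⟩ := h
    by_cases h1 : a + v = M
    · exact ⟨v - 1, (hv.pred_of_symm hf h1).1, left _ _ _ hv h1 hr⟩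
    by_cases h2 : v + b = M
    · have h3 := (hr.pred_of_symm hf h2)
      have h4 := h3.1.1.mirror
      have := hv.1
      rw [show M - (b - 1) = v + 1 by omega, show M - v = b by omega] at h4
      exact ⟨v + 1, ⟨hv.mono_right hs (by omega) (by omega), by omega⟩, ⟨h4, by omega⟩⟩
    · exact ⟨v, ⟨hv, h1⟩, ⟨hr, h2⟩⟩
  | succ k ih =>
    obtain ⟨v, hv, hr⟩ := h
    by_cases h1 : a + v = M
    · exact ⟨v - 1, (hv.pred_of_symm hf h1).1,
        (ih hr).head fun w hw => left _ _ _ hv h1 hw.1⟩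
    · exact ⟨v, ⟨hv, h1⟩, ih hr⟩

end Edge

/-! ## Iterated sums -/

/-- The `k`-th term of the lower central series, at the level of pairs. -/
def iterSum (M : ℕ) (R : ℕ → ℕ → Prop) : ℕ → ℕ → ℕ → Prop
  | 0, a, b => R a b
  | k + 1, a, c => Ext M a c ∧ ∃ b, (R a b ∧ iterSum M R k b c) ∨ (iterSum M R k a b ∧ R b c)

theorem iterSum_chain {M : ℕ} {R : ℕ → ℕ → Prop} {k a b : ℕ} (h : iterSum M R k a b) :
    Chain R k a b := by
  induction k generalizing a b with
  | zero => exact h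
  | succ k ih =>
    obtain ⟨-, v, ⟨h1, h2⟩ | ⟨h1, h2⟩⟩ := h
    · exact ⟨v, h1, ih h2⟩
    · exact chain_snoc (ih h1) h2

/-- Partial sums must be roots too. If removing the first step leaves a symmetric pair `(v, b)`,
remove the last one instead: `a < v` and `w < b` give `a + w < M`. -/
theorem iterSum_of_chain {M : ℕ} {R : ℕ → ℕ → Prop} (hR : ∀ a b, R a b → Ext M a b) {k a b : ℕ}
    (h : Chain R k a b) (hab : a + b ≠ M) : iterSum M R k a b := by
  have hlt : ∀ a b, R a b → a < b := fun a b h => (hR a b h).1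
  induction k generalizing a b with
  | zero => exact h
  | succ k ih =>
    have hl := h.lt hlt
    obtain ⟨v, hv, hr⟩ := h
    obtain ⟨w, hw, hr'⟩ := chain_succ_iff_snoc.mp (⟨v, hv, hr⟩ : Chain R (k + 1) a b)
    have hbM := (hR _ _ hr').2.1
    refine ⟨⟨hl, hbM, hab⟩, ?_⟩
    by_cases h1 : v + b = M
    · have := hlt _ _ hv
      have := hlt _ _ hr'
      exact ⟨w, Or.inr ⟨ih hw (by omega), hr'⟩⟩
    · exact ⟨v, Or.inl ⟨hv, ih hr h1⟩⟩

theorem rootEdge_ext {M : ℕ} {s : ℕ → ℕ} {a b : ℕ} (h : RootEdge M s a b) : Ext M a b :=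
  ⟨h.1.1, h.1.2.1, h.2⟩

/-- Testing the pair `(0, M - 1)` suffices: endpoints of chains may be moved outward, and a chain
ending in `M` starts after `0`, so its mirror image ends by `M - 1`. The pair `(0, M)` itself is not
a root. -/
theorem exists_iterSum_iff {M : ℕ} {s : ℕ → ℕ} (hM : 2 ≤ M) (hs : IsStrict s)
    (hf : Fits (M + 1) s) (k : ℕ) :
    (∃ a b, iterSum M (RootEdge M s) k a b) ↔ Reach k 1 (M - 1 - s 0) s := by
  have hf0 := hf 0
  rw [reach_iff_chain (M := M) hs hf (by omega)]
  constructor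
  · rintro ⟨a, b, h⟩
    have hext : Ext M a b := by
      cases k with
      | zero => exact rootEdge_ext h
      | succ k => exact h.1
    obtain ⟨h1, h2, h3⟩ := hext
    have hc : Chain (Edge M s) k a b := (iterSum_chain h).mono fun _ _ h => h.1
    have wlog : ∀ a b, Chain (Edge M s) k a b → b ≤ M - 1 → Chain (Edge M s) k 0 (M - 1) := by
      intro a b h hb
      exact (h.head fun w hw => hw.mono_left hs (Nat.zero_le _)).last
        fun w hw => hw.mono_right hs hb (by omega)
    by_cases hb : b ≤ M - 1
    · exact wlog _ _ hc hb
    · exact wlog _ _ (chain_edge_mirror hc) (by omega)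
  · intro h
    refine ⟨0, M - 1, iterSum_of_chain (fun _ _ => rootEdge_ext) ?_ (by omega)⟩
    cases k with
    | zero => exact ⟨h, by omega⟩
    | succ k => exact chain_rootEdge hs hf h

end IdealCount

namespace IdealCount

/-! ## Symmetric filters of pairs -/

/-- The sets of positive roots that are closed under adding positive roots, in terms of pairs. -/
structure IsSymFilter (M : ℕ) (F : ℕ → ℕ → Prop) : Prop where
  ext : ∀ {a b}, F a b → Ext M a b
  mirror : ∀ {a b}, F a b → F (M - b) (M - a)
  closed : ∀ {a b c}, F a b → Ext M b c → Ext M a c → F a c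

theorem Ext.mirror {M a b : ℕ} (h : Ext M a b) : Ext M (M - b) (M - a) := by
  obtain ⟨h1, h2, h3⟩ := h
  exact ⟨by omega, by omega, by omega⟩

theorem IsSymFilter.mirror_iff {M : ℕ} {F : ℕ → ℕ → Prop} (hF : IsSymFilter M F) {a b : ℕ}
    (ha : a ≤ M) (hb : b ≤ M) : F a b ↔ F (M - b) (M - a) := by
  refine ⟨hF.mirror, fun h => ?_⟩
  have := hF.mirror h
  rwa [show M - (M - a) = a by omega, show M - (M - b) = b by omega] at this

theorem IsSymFilter.closed_left {M : ℕ} {F : ℕ → ℕ → Prop} (hF : IsSymFilter M F) {a b c : ℕ}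
    (h : F b c) (hab : Ext M a b) (hac : Ext M a c) : F a c := by
  rw [hF.mirror_iff (by have := hac.1; have := hac.2.1; omega) hac.2.1]
  exact hF.closed (hF.mirror h) hab.mirror hac.mirror

theorem rootEdge_isSymFilter {M : ℕ} {s : ℕ → ℕ} (hs : IsStrict s) :
    IsSymFilter M (RootEdge M s) where
  ext := rootEdge_ext
  mirror := by
    rintro a b ⟨h, h'⟩
    exact ⟨h.mirror, (rootEdge_ext ⟨h, h'⟩).mirror.2.2⟩
  closed := by
    rintro a b c ⟨h, -⟩ h' h''
    exact ⟨h.mono_right hs h'.1.le h'.2.1, h''.2.2⟩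

theorem rootEdge_iff {M : ℕ} {s : ℕ → ℕ} {a b : ℕ} (h : a + b < M) :
    RootEdge M s a b ↔ a < b ∧ 1 ≤ s a ∧ M ≤ a + b + s a := by
  unfold RootEdge Edge
  omega

theorem rootEdge_injOn (M : ℕ) : Set.InjOn (RootEdge M) {s | Fits (M + 1) s} := by
  have key : ∀ s s', Fits (M + 1) s → RootEdge M s = RootEdge M s' → ∀ i, s i ≤ s' i := by
    intro s s' hf he i
    by_contra! hlt
    have h1 := hf i
    have h2 := rootEdge_iff (M := M) (s := s) (a := i) (b := M - i - s i) (by omega)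
    rw [he, rootEdge_iff (by omega)] at h2
    omega
  intro s hs s' hs' h
  funext i
  exact le_antisymm (key s s' hs h i) (key s' s hs' h.symm i)

/-- The filters that contain `e_i + e_{n-1}` whenever they contain `e_i - e_{n-1}`. -/
def IsUpper (n : ℕ) (F : ℕ → ℕ → Prop) : Prop := ∀ i, F i (n - 1) → F i n

/-- The filters that contain `e_i - e_{n-1}` whenever they contain `e_i + e_{n-1}`. -/
def IsLower (n : ℕ) (F : ℕ → ℕ → Prop) : Prop := ∀ i, F i n → F i (n - 1)

theorem rootEdge_isUpper {n : ℕ} {s : ℕ → ℕ} (hs : IsStrict s) :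
    IsUpper n (RootEdge (2 * n - 1) s) := by
  rintro i ⟨h, h'⟩
  have h1 := h.1
  exact ⟨h.mono_right hs (by omega) (by omega), by omega⟩

theorem IsSymFilter.exists_rootEdge {n : ℕ} {F : ℕ → ℕ → Prop}
    (hF : IsSymFilter (2 * n - 1) F) (hU : IsUpper n F) :
    ∃ s, IsStrict s ∧ Fits (2 * n - 1 + 1) s ∧ F = RootEdge (2 * n - 1) s := by
  generalize hM : 2 * n - 1 = M at *
  have up : ∀ a b c, F a b → b ≤ c → a + c < M → F a c := by
    intro a b c h hbc
    induction c, hbc using Nat.le_induction with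
    | base => exact fun _ => h
    | succ c hbc ih =>
      intro hc
      have h1 := ih (by omega)
      have h2 := hF.ext h1
      have h3 := h2.1
      have h4 := h2.2.1
      -- Adding the root `(c, c + 1)` moves one column to the right, except across the middle, where
      -- this pair is not a root and `IsUpper` takes over.
      by_cases h5 : c + (c + 1) = M
      · rw [show c = n - 1 by omega] at h1
        have := hU _ h1
        rwa [show n = c + 1 by omega] at this
      · exact hF.closed h1 ⟨by omega, by omega, h5⟩ ⟨by omega, by omega, by omega⟩
  have ex : ∀ a, ∃ m, (m = 0 ∨ m + 2 * a + 2 ≤ M + 1) ∧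
      ∀ b, a + b < M → (F a b ↔ a < b ∧ 1 ≤ m ∧ M ≤ a + b + m) := by
    intro a
    classical
    by_cases h : ∃ b, F a b ∧ a + b < M
    · have h1 := Nat.find_spec h
      have h2 := (hF.ext h1.1).1
      refine ⟨M - a - Nat.find h, Or.inr (by omega), fun b hb => ⟨fun hFb => ?_, fun hb' => ?_⟩⟩
      · have h3 := Nat.find_min' h ⟨hFb, hb⟩
        have h4 := (hF.ext hFb).1
        omega
      · exact up _ _ _ h1.1 (by omega) hb
    · refine ⟨0, Or.inl rfl, fun b hb => ⟨fun hFb => (h ⟨b, hFb, hb⟩).elim, fun h => by omega⟩⟩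
  choose s hfit hs using ex
  have hst : IsStrict s := by
    intro a
    by_contra! hlt
    have h1 := hfit (a + 1)
    have h2 := (hs (a + 1) (M - (a + 1) - s (a + 1)) (by omega)).mpr (by omega)
    have h3 := hF.closed_left h2 (a := a) ⟨by omega, by omega, by omega⟩
      ⟨by omega, by omega, by omega⟩
    have h4 := (hs a _ (by omega)).mp h3
    omega
  refine ⟨s, hst, hfit, ?_⟩
  · have low : ∀ a b, a + b < M → (F a b ↔ RootEdge M s a b) := by
      intro a b h
      rw [hs a b h, rootEdge_iff h]
    funext a b
    apply propext
    rcases lt_trichotomy (a + b) M with h | h | h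
    · exact low a b h
    · exact ⟨fun h' => ((hF.ext h').2.2 h).elim, fun h' => (h'.2 h).elim⟩
    · have st : ∀ F, IsSymFilter M F → ∀ h' : ¬ (a < b ∧ b ≤ M), ¬ F a b :=
        fun F hF h' h'' => h' ⟨(hF.ext h'').1, (hF.ext h'').2.1⟩
      have hR : IsSymFilter M (RootEdge M s) := rootEdge_isSymFilter hst
      by_cases h' : a < b ∧ b ≤ M
      · rw [hF.mirror_iff (by omega) (by omega), hR.mirror_iff (by omega) (by omega)]
        exact low _ _ (by omega)
      · exact iff_of_false (st _ hF h') (st _ hR h')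

/-- The filters whose iterated sums vanish after `h` steps. -/
def boundedFilters (M h : ℕ) : Set (ℕ → ℕ → Prop) :=
  {F | IsSymFilter M F ∧ ∀ a b, ¬ iterSum M F h a b}

theorem upper_boundedFilters {n : ℕ} (hn : 2 ≤ n) (h : ℕ) :
    {F ∈ boundedFilters (2 * n - 1) h | IsUpper n F} =
      RootEdge (2 * n - 1) '' boundedFits h (2 * n) := by
  have e : 2 * n - 1 + 1 = 2 * n := by omega
  have key : ∀ s, IsStrict s → Fits (2 * n) s →
      ((∀ a b, ¬ iterSum (2 * n - 1) (RootEdge (2 * n - 1) s) h a b) ↔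
        ¬ Reach h 1 (2 * n - 2 - s 0) s) := by
    intro s hs hf
    rw [show 2 * n - 2 - s 0 = 2 * n - 1 - 1 - s 0 by omega,
      ← exists_iterSum_iff (M := 2 * n - 1) (by omega) hs (e.symm ▸ hf)]
    push Not
    rfl
  ext F
  constructor
  · rintro ⟨⟨hF, hh⟩, hU⟩
    obtain ⟨s, hs, hf, rfl⟩ := hF.exists_rootEdge hU
    rw [e] at hf
    exact ⟨s, ⟨hs, hf, (key s hs hf).mp hh⟩, rfl⟩
  · rintro ⟨s, ⟨hs, hf, hr⟩, rfl⟩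
    exact ⟨⟨rootEdge_isSymFilter hs, (key s hs hf).mpr hr⟩, rootEdge_isUpper hs⟩

/-! ### The diagram automorphism -/

/-- The exchange of the two middle vertices. -/
def flip (n v : ℕ) : ℕ := if v = n - 1 then n else if v = n then n - 1 else v

theorem flip_flip {n : ℕ} (hn : 1 ≤ n) (v : ℕ) : flip n (flip n v) = v := by
  unfold flip
  split_ifs <;> omega

theorem ext_flip {n a b : ℕ} : Ext (2 * n - 1) (flip n a) (flip n b) ↔ Ext (2 * n - 1) a b := by
  unfold flip Ext
  split_ifs <;> omega

theorem flip_mirror {n v : ℕ} (hn : 1 ≤ n) (hv : v ≤ 2 * n - 1) :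
    flip n (2 * n - 1 - v) = 2 * n - 1 - flip n v := by
  unfold flip
  split_ifs <;> omega

/-- The action of the diagram automorphism on filters. -/
def flipFilter (n : ℕ) (F : ℕ → ℕ → Prop) : ℕ → ℕ → Prop := fun a b => F (flip n a) (flip n b)

theorem flipFilter_flipFilter {n : ℕ} (hn : 1 ≤ n) (F : ℕ → ℕ → Prop) :
    flipFilter n (flipFilter n F) = F := by
  funext a b
  simp only [flipFilter, flip_flip hn]

theorem IsSymFilter.flipFilter {n : ℕ} (hn : 1 ≤ n) {F : ℕ → ℕ → Prop}
    (hF : IsSymFilter (2 * n - 1) F) : IsSymFilter (2 * n - 1) (flipFilter n F) where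
  ext h := ext_flip.mp (hF.ext h)
  mirror := by
    intro a b h
    have h1 := ext_flip.mp (hF.ext h)
    have h2 := h1.1
    have h3 := h1.2.1
    have := hF.mirror h
    rwa [← flip_mirror hn (by omega), ← flip_mirror hn (by omega)] at this
  closed h h' h'' := hF.closed h (ext_flip.mpr h') (ext_flip.mpr h'')

theorem iterSum_flipFilter {n : ℕ} (hn : 1 ≤ n) (F : ℕ → ℕ → Prop) (k a b : ℕ) :
    iterSum (2 * n - 1) (flipFilter n F) k a b ↔ iterSum (2 * n - 1) F k (flip n a) (flip n b) := by
  induction k generalizing a b with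
  | zero => rfl
  | succ k ih =>
    simp only [iterSum, ext_flip, ih]
    refine and_congr_right fun _ => ⟨?_, ?_⟩
    · rintro ⟨v, hv⟩
      exact ⟨flip n v, hv⟩
    · rintro ⟨v, hv⟩
      refine ⟨flip n v, ?_⟩
      simpa only [flipFilter, flip_flip hn] using hv

theorem flipFilter_mem {n h : ℕ} (hn : 1 ≤ n) {F : ℕ → ℕ → Prop}
    (hF : F ∈ boundedFilters (2 * n - 1) h) : flipFilter n F ∈ boundedFilters (2 * n - 1) h :=
  ⟨hF.1.flipFilter hn, fun a b hab => hF.2 _ _ ((iterSum_flipFilter hn F h a b).mp hab)⟩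

theorem flip_pred (n : ℕ) : flip n (n - 1) = n := by simp [flip]

theorem flip_self (n : ℕ) : flip n n = n - 1 := by
  unfold flip
  split_ifs <;> omega

theorem isUpper_flipFilter {n : ℕ} (hn : 1 ≤ n) (F : ℕ → ℕ → Prop) :
    IsUpper n (flipFilter n F) ↔ IsLower n F := by
  unfold IsUpper IsLower flipFilter
  rw [flip_pred, flip_self]
  exact ⟨fun h i hi => by simpa only [flip_flip hn] using h (flip n i) (by rwa [flip_flip hn]),
    fun h i => h _⟩

theorem isLower_flipFilter {n : ℕ} (hn : 1 ≤ n) (F : ℕ → ℕ → Prop) :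
    IsLower n (flipFilter n F) ↔ IsUpper n F := by
  rw [← isUpper_flipFilter hn, flipFilter_flipFilter hn]

/-- If `i` violates one condition and `j` the other, adding `e_i - e_j` or `e_j - e_i` gives the
smaller index the pair it lacks. -/
theorem IsSymFilter.isUpper_or_isLower {n : ℕ} {F : ℕ → ℕ → Prop}
    (hF : IsSymFilter (2 * n - 1) F) : IsUpper n F ∨ IsLower n F := by
  by_contra! hc
  simp only [IsUpper, IsLower, not_forall] at hc
  obtain ⟨⟨i, hi, hi'⟩, j, hj, hj'⟩ := hc
  obtain ⟨h1, h2, h3⟩ := hF.ext hi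
  obtain ⟨h4, h5, h6⟩ := hF.ext hj
  rcases lt_trichotomy i j with h | rfl | h
  · exact hi' (hF.closed_left hj ⟨h, by omega, by omega⟩ ⟨by omega, by omega, by omega⟩)
  · exact hi' hj
  · exact hj' (hF.closed_left hi ⟨h, by omega, by omega⟩ ⟨by omega, by omega, by omega⟩)

theorem lower_boundedFilters {n : ℕ} (hn : 1 ≤ n) (h : ℕ) :
    {F ∈ boundedFilters (2 * n - 1) h | IsLower n F} =
      flipFilter n '' {F ∈ boundedFilters (2 * n - 1) h | IsUpper n F} := by
  ext F
  constructor
  · rintro ⟨hF, hL⟩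
    exact ⟨flipFilter n F, ⟨flipFilter_mem hn hF, (isUpper_flipFilter hn F).mpr hL⟩,
      flipFilter_flipFilter hn F⟩
  · rintro ⟨F, ⟨hF, hU⟩, rfl⟩
    exact ⟨flipFilter_mem hn hF, (isLower_flipFilter hn F).mpr hU⟩

/-! ### Filters invariant under the diagram automorphism -/

/-- Removal of one of the two middle columns. -/
def squash (N : ℕ) (s : ℕ → ℕ) (i : ℕ) : ℕ := if N ≤ s i + i then s i - 1 else s i

theorem squash_spec (N : ℕ) (s : ℕ → ℕ) (i : ℕ) :
    (N ≤ s i + i ∧ squash N s i = s i - 1) ∨ (s i + i < N ∧ squash N s i = s i) := by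
  unfold squash
  split_ifs <;> omega

theorem isStrict_squash {N : ℕ} {s : ℕ → ℕ} (hs : IsStrict s) : IsStrict (squash N s) := by
  intro i
  have h1 := hs i
  have h2 := squash_spec N s i
  have h3 := squash_spec N s (i + 1)
  omega

theorem fits_squash {N : ℕ} {s : ℕ → ℕ} (hf : Fits (2 * N) s) : Fits (2 * N - 1) (squash N s) := by
  intro i
  have h1 := hf i
  have h2 := squash_spec N s i
  omega

theorem squash_shift {N c : ℕ} (hc : c ≤ N) (s : ℕ → ℕ) :
    squash (N - c) (fun i => s (i + c)) = fun i => squash N s (i + c) := by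
  funext i
  have h2 := squash_spec N s (i + c)
  have h3 := squash_spec (N - c) (fun i => s (i + c)) i
  omega

/-- By `hN` no row begins at column `N`, so the columns `N - 1` and `N` occur together and one can
be dropped. It also keeps the path from landing on the dropped vertex, so later positions just shift
by one. -/
theorem reach_squash {N : ℕ} {s : ℕ → ℕ} (hs : IsStrict s) (hf : Fits (2 * N) s)
    (hN : ∀ i, i + 1 < N → s i + i + 1 ≠ N) {k c d c' d' : ℕ} (hK : 1 + c + d + s 0 = 2 * N)
    (hc : c < N ∧ c' = c ∨ N < c ∧ c' = c - 1) (hK' : 1 + c' + d' + squash N s 0 = 2 * N - 1) :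
    Reach k c d s ↔ Reach k c' d' (squash N s) := by
  induction k generalizing N s c d c' d' with
  | zero =>
    have h0 := hN 0
    have h1 := squash_spec N s 0
    have h2 := hf 0
    simp only [Reach]
    omega
  | succ k ih =>
    have hs' := isStrict_squash (N := N) hs
    have hf' := fits_squash hf
    have f1 := hf c
    have f2 := hf' c'
    have h0 := hN 0
    have h1 := squash_spec N s 0
    have f3 := hf 0
    by_cases hsc : s c = 0
    · have hsc' : squash N s c' = 0 := by
        rcases hc with ⟨-, rfl⟩ | hc
        · have := squash_spec N s c'
          omega
        · omega
      constructor
      · intro h; have := Reach.one_le (hs.shift c) h; simp only [zero_add] at this; omega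
      · intro h; have := Reach.one_le (hs'.shift c') h; simp only [zero_add] at this; omega
    · obtain ⟨hc, rfl⟩ : c < N ∧ c' = c := by omega
      have h4 := squash_spec N s c'
      have h5 := hN c'
      have h6 := hs.add_le c'
      have h7 := hs'.add_le c'
      rw [Reach, Reach, ← squash_shift hc.le]
      refine ih (hs.shift c') (fun i => ?_) (fun i hi => ?_) ?_ ?_ ?_
      · have := hf (i + c')
        change s (i + c') = 0 ∨ s (i + c') + 2 * i + 2 ≤ _
        omega
      · have := hN (i + c') (by omega)
        change s (i + c') + i + 1 ≠ N - c'
        omega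
      · simp only [zero_add]
        omega
      · omega
      · rw [squash_shift hc.le]
        simp only [zero_add]
        omega

theorem squash_boundedFits {n : ℕ} (hn : 2 ≤ n) (h : ℕ) :
    squash n '' {s ∈ boundedFits h (2 * n) | ∀ i, i + 1 < n → s i + i + 1 ≠ n} =
      boundedFits h (2 * n - 1) := by
  have key : ∀ s, IsStrict s → Fits (2 * n) s → (∀ i, i + 1 < n → s i + i + 1 ≠ n) →
      (Reach h 1 (2 * n - 2 - s 0) s ↔ Reach h 1 (2 * n - 1 - 2 - squash n s 0) (squash n s)) := by
    intro s hs hf hN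
    have h1 := hf 0
    have h2 := squash_spec n s 0
    exact reach_squash hs hf hN (by omega) (by omega) (by omega)
  ext s
  constructor
  · rintro ⟨s, ⟨⟨hs, hf, hr⟩, hN⟩, rfl⟩
    exact ⟨isStrict_squash hs, fits_squash hf, fun h => hr ((key s hs hf hN).mpr h)⟩
  · rintro ⟨hs, hf, hr⟩
    -- The inverse of `squash`: every nonempty row that meets the merged middle column gets the
    -- missing column back.
    set s' : ℕ → ℕ := fun i => if n ≤ s i + i + 1 ∧ s i ≠ 0 then s i + 1 else s i with hs'
    have spec : ∀ i, (n ≤ s i + i + 1 ∧ s i ≠ 0 ∧ s' i = s i + 1) ∨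
        ((s i + i + 1 < n ∨ s i = 0) ∧ s' i = s i) := by
      intro i
      simp only [hs']
      split_ifs <;> omega
    have e : squash n s' = s := by
      funext i
      have h1 := spec i
      have h2 := squash_spec n s' i
      have h3 := hf i
      omega
    have hst : IsStrict s' := by
      intro i
      have h1 := spec i
      have h2 := spec (i + 1)
      have h3 := hs i
      omega
    have hft : Fits (2 * n) s' := by
      intro i
      have h1 := spec i
      have h3 := hf i
      omega
    have hN : ∀ i, i + 1 < n → s' i + i + 1 ≠ n := by
      intro i hi
      have h1 := spec i
      omega
    refine ⟨s', ⟨⟨hst, hft, fun h => hr ?_⟩, hN⟩, e⟩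
    have := (key s' hst hft hN).mp h
    rwa [e] at this

theorem squash_injOn (n : ℕ) :
    Set.InjOn (squash n) {s | Fits (2 * n) s ∧ ∀ i, i + 1 < n → s i + i + 1 ≠ n} := by
  rintro s ⟨hf, hN⟩ s' ⟨hf', hN'⟩ h
  funext i
  have h1 := hf i
  have h2 := hf' i
  have h3 := hN i
  have h4 := hN' i
  have h5 := squash_spec n s i
  have h6 := squash_spec n s' i
  rw [h] at h5
  omega

theorem isLower_rootEdge_iff {n : ℕ} {s : ℕ → ℕ} (hn : 1 ≤ n) :
    IsLower n (RootEdge (2 * n - 1) s) ↔ ∀ i, i + 1 < n → s i + i + 1 ≠ n := by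
  constructor
  · intro h i hi hs
    have := h i ((rootEdge_iff (by omega)).mpr ⟨by omega, by omega, by omega⟩)
    rw [rootEdge_iff (by omega)] at this
    omega
  · intro h i hi
    have h1 := rootEdge_ext hi
    have h2 := h1.1
    have h3 := h1.2.2
    rw [rootEdge_iff (by omega)] at hi ⊢
    have := h i (by omega)
    omega

theorem ncard_boundedFilters {n : ℕ} (hn : 2 ≤ n) (h : ℕ) :
    ((boundedFilters (2 * n - 1) h).ncard : ℚ) =
      2 * linCount h (2 * n) - linCount h (2 * n - 1) := by
  have hinj : Set.InjOn (RootEdge (2 * n - 1)) (boundedFits h (2 * n)) := by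
    refine (rootEdge_injOn (2 * n - 1)).mono ?_
    rintro s ⟨-, hf, -⟩
    rwa [show 2 * n = 2 * n - 1 + 1 by omega] at hf
  have hfinj : Function.Injective (flipFilter n) :=
    Function.LeftInverse.injective (flipFilter_flipFilter (by omega))
  set U := {F ∈ boundedFilters (2 * n - 1) h | IsUpper n F} with hU
  set V := {F ∈ boundedFilters (2 * n - 1) h | IsLower n F} with hV
  have eU : U = RootEdge (2 * n - 1) '' boundedFits h (2 * n) := upper_boundedFilters hn h
  have eV : V = flipFilter n '' U := lower_boundedFilters (by omega) h
  have fU : U.Finite := eU ▸ (finite_boundedFits h (2 * n) (by omega)).image _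
  have fV : V.Finite := eV ▸ fU.image _
  have cU : (U.ncard : ℚ) = linCount h (2 * n) := by
    rw [eU, hinj.ncard_image, ncard_boundedFits h _ (by omega)]
  have cV : V.ncard = U.ncard := by rw [eV, Set.ncard_image_of_injective _ hfinj]
  have hUV : U ∪ V = boundedFilters (2 * n - 1) h := by
    ext F
    constructor
    · rintro (hF | hF) <;> exact hF.1
    · intro hF
      exact hF.1.isUpper_or_isLower.imp (fun h => ⟨hF, h⟩) fun h => ⟨hF, h⟩
  have eI : U ∩ V = RootEdge (2 * n - 1) ''
      {s ∈ boundedFits h (2 * n) | ∀ i, i + 1 < n → s i + i + 1 ≠ n} := by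
    ext F
    constructor
    · rintro ⟨hF, hF'⟩
      rw [eU] at hF
      obtain ⟨s, hs, rfl⟩ := hF
      exact ⟨s, ⟨hs, (isLower_rootEdge_iff (by omega)).mp hF'.2⟩, rfl⟩
    · rintro ⟨s, ⟨hs, hN⟩, rfl⟩
      have : RootEdge (2 * n - 1) s ∈ U := by rw [eU]; exact ⟨s, hs, rfl⟩
      exact ⟨this, this.1, (isLower_rootEdge_iff (by omega)).mpr hN⟩
  have cI : ((U ∩ V).ncard : ℚ) = linCount h (2 * n - 1) := by
    rw [eI, (hinj.mono fun s hs => hs.1).ncard_image, ← ncard_boundedFits h _ (by omega),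
      ← squash_boundedFits hn, Set.InjOn.ncard_image]
    refine (squash_injOn n).mono ?_
    rintro s ⟨⟨-, hf, -⟩, hN⟩
    exact ⟨hf, hN⟩
  have := Set.ncard_union_add_ncard_inter U V fU fV
  rw [hUV, cV] at this
  rw [← cU, ← cI]
  have := congrArg (Nat.cast : ℕ → ℚ) this
  push_cast at this
  linarith

end IdealCount

/-! ### Reduction from ideals to sets of positive roots. -/

namespace IdealCount

open LieAlgebra LieAlgebra.IsKilling LieModule AdNilp

section Killing

variable {L : Type*} [LieRing L] [LieAlgebra ℂ L] [FiniteDimensional ℂ L]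
  {H : LieSubalgebra ℂ L} [H.IsCartanSubalgebra]

/-! ## Sums of root spaces -/

/-- The sum of the root spaces of a set of roots. -/
noncomputable def rootSum (Φ : Set H.root) : Submodule ℂ L :=
  ⨆ α ∈ Φ, (rootSpace H (α.1 : H → ℂ)).toSubmodule

theorem rootSpace_le_rootSum {Φ : Set H.root} {α : H.root} (hα : α ∈ Φ) :
    (rootSpace H (α.1 : H → ℂ)).toSubmodule ≤ rootSum Φ :=
  le_iSup₂_of_le α hα le_rfl

theorem rootSum_mono {Φ Ψ : Set H.root} (h : Φ ⊆ Ψ) : rootSum Φ ≤ rootSum Ψ :=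
  iSup₂_le fun _ hα => rootSpace_le_rootSum (h hα)

theorem exists_mem_rootSpace_ne_zero (α : H.root) :
    ∃ x ∈ rootSpace H (α.1 : H → ℂ), x ≠ 0 := α.1.exists_ne_zero

theorem rootSum_empty : rootSum (∅ : Set H.root) = ⊥ := by simp [rootSum]

theorem disjoint_rootSpace_rootSum {Φ : Set H.root} {α : H.root} (hα : α ∉ Φ) :
    Disjoint (rootSpace H (α.1 : H → ℂ)).toSubmodule (rootSum Φ ⊔ H.toSubmodule) := by
  have hind := (LieSubmodule.iSupIndep_toSubmodule.mpr (iSupIndep_genWeightSpace ℂ H L)) α.1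
  refine hind.mono_right (sup_le (iSup₂_le fun β hβ => ?_) ?_)
  · refine le_iSup₂_of_le (β.1 : H → ℂ) ?_ le_rfl
    intro h
    have : β = α := Subtype.ext (DFunLike.coe_injective h)
    exact hα (this ▸ hβ)
  · refine le_iSup₂_of_le (0 : H → ℂ) ?_ ?_
    · intro h
      exact H.isNonZero_coe_root α h.symm
    · exact (rootSpace_zero_eq ℂ L H).ge

theorem rootSpace_le_rootSum_iff {Φ : Set H.root} {α : H.root} :
    (rootSpace H (α.1 : H → ℂ)).toSubmodule ≤ rootSum Φ ↔ α ∈ Φ := by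
  refine ⟨fun h => ?_, rootSpace_le_rootSum⟩
  by_contra hα
  obtain ⟨x, hx, hx0⟩ := exists_mem_rootSpace_ne_zero α
  have := (disjoint_rootSpace_rootSum hα).le_bot ⟨hx, le_sup_left (a := rootSum Φ) (h hx)⟩
  exact hx0 (by simpa using this)

theorem rootSum_injective : Function.Injective (rootSum : Set H.root → Submodule ℂ L) := by
  intro Φ Ψ h
  ext α
  rw [← rootSpace_le_rootSum_iff, h, rootSpace_le_rootSum_iff]

theorem rootSum_eq_bot_iff {Φ : Set H.root} : rootSum Φ = ⊥ ↔ Φ = ∅ := by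
  rw [← rootSum_empty (H := H)]
  exact rootSum_injective.eq_iff

theorem lie_mem_rootSum_of_mem_cartan (Φ : Set H.root) {x y : L} (hx : x ∈ H)
    (hy : y ∈ rootSum Φ) : ⁅x, y⁆ ∈ rootSum Φ := by
  unfold rootSum at hy
  induction hy using Submodule.iSup_induction' with
  | zero => simp
  | add y z _ _ h₁ h₂ => rw [lie_add]; exact add_mem h₁ h₂
  | mem α y hy =>
    by_cases hα : α ∈ Φ
    · simp only [hα, iSup_pos] at hy
      exact rootSpace_le_rootSum hα ((rootSpace H (α.1 : H → ℂ)).lie_mem (x := (⟨x, hx⟩ : H)) hy)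
    · simp [hα] at hy; simp [hy]

variable [LieAlgebra.IsKilling ℂ L]

theorem posPart_eq_rootSum (b : (rootSystem H).Base) :
    posPart b = rootSum {α : H.root | b.IsPos α} :=
  iSup_subtype

theorem exists_smul_eq {α : H.root} {x y : L} (hx : x ∈ rootSpace H (α.1 : H → ℂ)) (hx0 : x ≠ 0)
    (hy : y ∈ rootSpace H (α.1 : H → ℂ)) : ∃ c : ℂ, c • x = y := by
  simpa using (finrank_eq_one_iff_of_nonzero' ⟨x, hx⟩ (by simpa using hx0)).mp
      (finrank_rootSpace_eq_one _ (H.isNonZero_coe_root α)) ⟨y, hy⟩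

/-- The product of two root spaces whose roots add up to a root does not vanish. -/
theorem lie_ne_zero {α β γ : H.root} (h : (γ.1 : H → ℂ) = α.1 + β.1) {x y : L}
    (hx : x ∈ rootSpace H (α.1 : H → ℂ)) (hx0 : x ≠ 0) (hy : y ∈ rootSpace H (β.1 : H → ℂ))
    (hy0 : y ≠ 0) : ⁅x, y⁆ ≠ 0 := by
  have hα := H.isNonZero_coe_root α
  obtain ⟨h', e, f, isSl2, he, hf⟩ := exists_isSl2Triple_of_weight_isNonZero hα
  obtain rfl := isSl2.h_eq_coroot hα he hf
  -- Take `v` at the top of the `α`-string through `β`. Since `α + β` is a root, `y` is a multiple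
  -- of `f ^ (q + 1) v`, and `e` maps this to `(q + 1) (chainLength - q) f ^ q v`, which is nonzero
  -- for `q < chainLength`.
  obtain ⟨v, hv, hv0⟩ := (chainTop (α.1 : H → ℂ) β.1).exists_ne_zero
  have prim : isSl2.HasPrimitiveVectorWith v (chainLength α.1 β.1 : ℂ) :=
    have := lie_mem_genWeightSpace_of_mem_genWeightSpace he hv
    ⟨hv0, (chainLength_smul _ _ hv).symm, by rwa [genWeightSpace_add_chainTop _ _ hα] at this⟩
  have hq : 1 ≤ chainTopCoeff (α.1 : H → ℂ) β.1 := by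
    have := (rootSpace_zsmul_add_ne_bot_iff α.1 β.1 hα 1).mp (by
      rw [one_smul, ← h]
      exact γ.1.genWeightSpace_ne_bot)
    exact_mod_cast this.1
  have hle := chainTopCoeff_le_chainLength α.1 β.1
  obtain ⟨q, hq'⟩ : ∃ q, chainTopCoeff (α.1 : H → ℂ) β.1 = q + 1 :=
    ⟨chainTopCoeff (α.1 : H → ℂ) β.1 - 1, by omega⟩
  rw [hq'] at hle
  have hw := toEnd_pow_apply_mem hf hv (q + 1)
  have e1 : (q + 1) • (-(α.1 : H → ℂ)) + (chainTop (α.1 : H → ℂ) β.1 : H → ℂ) = β.1 := by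
    rw [coe_chainTop', hq', smul_neg, neg_add_cancel_left]
  rw [e1] at hw
  have hw0 := prim.pow_toEnd_f_ne_zero_of_eq_nat rfl hle
  obtain ⟨c, rfl⟩ := exists_smul_eq he isSl2.e_ne_zero hx
  obtain ⟨d, rfl⟩ := exists_smul_eq hw hw0 hy
  have hlie := prim.lie_e_pow_succ_toEnd_f q
  have hlow := prim.pow_toEnd_f_ne_zero_of_eq_nat rfl (i := q) (by omega)
  intro h0
  rw [smul_lie, lie_smul, smul_eq_zero, smul_eq_zero] at h0
  rcases h0 with h0 | h0 | h0
  · simp [h0] at hx0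
  · simp [h0] at hy0
  · erw [hlie] at h0
    rw [smul_eq_zero] at h0
    rcases h0 with h0 | h0
    · rcases mul_eq_zero.mp h0 with h0 | h0
      · exact Nat.cast_add_one_ne_zero q h0
      · rw [sub_eq_zero] at h0
        have := Nat.cast_injective h0
        omega
    · exact hlow h0

/-! ## Sums of sets of positive roots -/

/-- All roots that are sums of a root in `Φ` and a root in `Ψ`. -/
def addRoots (Φ Ψ : Set H.root) : Set H.root :=
  {γ | ∃ α ∈ Φ, ∃ β ∈ Ψ, (γ.1 : H → ℂ) = α.1 + β.1}

theorem root_eq_add_iff {α β γ : H.root} : (rootSystem H).root γ =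
    (rootSystem H).root α + (rootSystem H).root β ↔ (γ.1 : H → ℂ) = α.1 + β.1 := by
  rw [LinearMap.ext_iff, funext_iff]
  simp

theorem add_ne_zero_of_isPos {b : (rootSystem H).Base} {α β : H.root} (hα : b.IsPos α)
    (hβ : b.IsPos β) : (α.1 : H → ℂ) + β.1 ≠ 0 := by
  intro hsum
  have hroot : (rootSystem H).root α = -(rootSystem H).root β := by
    ext t
    have := congrFun hsum t
    simp only [Pi.add_apply, Pi.zero_apply] at this
    simpa using eq_neg_of_add_eq_zero_left this
  let _ := (rootSystem H).indexNeg
  have h1 : α = -β := by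
    apply (rootSystem H).root.injective
    rw [hroot]
    change _ = (rootSystem H).root ((rootSystem H).reflectionPerm β β)
    rw [RootPairing.root_reflectionPerm, RootPairing.reflection_apply_self]
  rw [h1, RootPairing.Base.IsPos.neg_iff_not] at hα
  exact hα hβ

/-- Positivity excludes `α + β = 0`, where the bracket could fall into the Cartan subalgebra. -/
theorem lie_mem_rootSum {b : (rootSystem H).Base} {Φ Ψ : Set H.root} (hΦ : ∀ α ∈ Φ, b.IsPos α)
    (hΨ : ∀ α ∈ Ψ, b.IsPos α) {x y : L} (hx : x ∈ rootSum Φ) (hy : y ∈ rootSum Ψ) :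
    ⁅x, y⁆ ∈ rootSum (addRoots Φ Ψ) := by
  unfold rootSum at hx hy
  induction hx using Submodule.iSup_induction' with
  | zero => simp
  | add x z _ _ h₁ h₂ => rw [add_lie]; exact add_mem h₁ h₂
  | mem α x hx =>
    by_cases hα : α ∈ Φ
    swap
    · simp [hα] at hx; simp [hx]
    simp only [hα, iSup_pos] at hx
    induction hy using Submodule.iSup_induction' with
    | zero => simp
    | add y z _ _ h₁ h₂ => rw [lie_add]; exact add_mem h₁ h₂
    | mem β y hy =>
      by_cases hβ : β ∈ Ψ
      swap
      · simp [hβ] at hy; simp [hy]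
      simp only [hβ, iSup_pos] at hy
      have hxy : ⁅x, y⁆ ∈ rootSpace H ((α.1 : H → ℂ) + (β.1 : H → ℂ)) :=
        lie_mem_genWeightSpace_of_mem_genWeightSpace hx hy
      by_cases hbot : rootSpace H ((α.1 : H → ℂ) + (β.1 : H → ℂ)) = ⊥
      · rw [hbot, LieSubmodule.mem_bot] at hxy
        rw [hxy]; exact zero_mem _
      · let γ : LieModule.Weight ℂ H L := ⟨(α.1 : H → ℂ) + (β.1 : H → ℂ), hbot⟩
        have hγ : γ.IsNonZero := add_ne_zero_of_isPos (hΦ α hα) (hΨ β hβ)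
        let g : H.root := ⟨γ, by simpa using hγ⟩
        have hg : g ∈ addRoots Φ Ψ := ⟨α, hα, β, hβ, rfl⟩
        exact rootSpace_le_rootSum hg hxy

theorem span_lie_rootSum {b : (rootSystem H).Base} {Φ Ψ : Set H.root} (hΦ : ∀ α ∈ Φ, b.IsPos α)
    (hΨ : ∀ α ∈ Ψ, b.IsPos α) :
    Submodule.span ℂ {z : L | ∃ x ∈ rootSum Φ, ∃ y ∈ rootSum Ψ, ⁅x, y⁆ = z} =
      rootSum (addRoots Φ Ψ) := by
  apply le_antisymm
  · rw [Submodule.span_le]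
    rintro _ ⟨x, hx, y, hy, rfl⟩
    exact lie_mem_rootSum hΦ hΨ hx hy
  · refine iSup₂_le ?_
    rintro γ ⟨α, hα, β, hβ, h⟩ z hz
    obtain ⟨x, hx, hx0⟩ := exists_mem_rootSpace_ne_zero α
    obtain ⟨y, hy, hy0⟩ := exists_mem_rootSpace_ne_zero β
    have hxy := lie_mem_genWeightSpace_of_mem_genWeightSpace hx hy
    rw [← h] at hxy
    obtain ⟨c, rfl⟩ := exists_smul_eq hxy (lie_ne_zero h hx hx0 hy hy0) hz
    exact Submodule.smul_mem _ _ (Submodule.subset_span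
      ⟨x, rootSpace_le_rootSum hα hx, y, rootSpace_le_rootSum hβ hy, rfl⟩)

theorem isPos_addRoots {b : (rootSystem H).Base} {Φ Ψ : Set H.root} (hΦ : ∀ α ∈ Φ, b.IsPos α)
    (hΨ : ∀ α ∈ Ψ, b.IsPos α) : ∀ α ∈ addRoots Φ Ψ, b.IsPos α := by
  rintro γ ⟨α, hα, β, hβ, h⟩
  exact (hΦ α hα).add (hΨ β hβ) (root_eq_add_iff.mpr h)

/-- The lower central series at the level of roots. -/
def rootSeries (Φ : Set H.root) : ℕ → Set H.root
  | 0 => Φ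
  | k + 1 => addRoots Φ (rootSeries Φ k)

theorem lt_height_of_mem_rootSeries {b : (rootSystem H).Base} {Φ : Set H.root}
    (hΦ : ∀ α ∈ Φ, b.IsPos α) (k : ℕ) : ∀ α ∈ rootSeries Φ k, (k : ℤ) < b.height α := by
  induction k with
  | zero => exact hΦ
  | succ k ih =>
    rintro γ ⟨α, hα, β, hβ, h⟩
    have h1 := ih β hβ
    have h2 : 0 < b.height α := hΦ α hα
    rw [b.height_add (root_eq_add_iff.mpr h)]
    push_cast
    omega

theorem exists_rootSeries_eq_empty {b : (rootSystem H).Base} {Φ : Set H.root}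
    (hΦ : ∀ α ∈ Φ, b.IsPos α) : ∃ k, rootSeries Φ k = ∅ := by
  obtain ⟨N, hN⟩ := (Set.finite_range b.height).bddAbove
  refine ⟨N.toNat, Set.eq_empty_of_forall_notMem fun α hα => ?_⟩
  have h1 := lt_height_of_mem_rootSeries hΦ _ α hα
  have h2 := hN ⟨α, rfl⟩
  omega

end Killing

end IdealCount

namespace IdealCount

open LieAlgebra LieAlgebra.IsKilling LieModule AdNilp

section Killing

variable {L : Type*} [LieRing L] [LieAlgebra ℂ L] [FiniteDimensional ℂ L]
  [LieAlgebra.IsKilling ℂ L] {H : LieSubalgebra ℂ L} [H.IsCartanSubalgebra]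

/-! ## The height grading -/

theorem apply_root_eq_height {b : (rootSystem H).Base} {ρ : Module.Dual ℂ H →ₗ[ℂ] ℂ}
    (hρ : ∀ j : b.support, ρ ((rootSystem H).root j) = 1) (α : H.root) :
    ρ ((rootSystem H).root α) = b.height α := by
  obtain ⟨f, -, -, h⟩ := b.exists_root_eq_sum_int α
  rw [b.height_eq_sum h, h, map_sum]
  push_cast
  refine Finset.sum_congr rfl fun j hj => ?_
  rw [map_zsmul, hρ ⟨j, hj⟩]
  simp

theorem exists_height_functional (b : (rootSystem H).Base) :
    ∃ ρ : Module.Dual ℂ H →ₗ[ℂ] ℂ, ∀ α : H.root, ρ α.1.toLinear = b.height α := by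
  refine ⟨b.toWeightBasis.constr ℂ fun _ => 1, apply_root_eq_height fun j => ?_⟩
  have := b.toWeightBasis.constr_basis ℂ (fun _ => (1 : ℂ)) j
  rwa [RootPairing.Base.toWeightBasis_apply] at this

/-- The terms of the filtration by height. -/
noncomputable def heightFiltration (ρ : Module.Dual ℂ H →ₗ[ℂ] ℂ) (n : ℤ) : Submodule ℂ L :=
  ⨆ χ : Weight ℂ H L, ⨆ _ : ∃ k : ℤ, n ≤ k ∧ ρ χ.toLinear = k,
    (genWeightSpace L (χ : H → ℂ)).toSubmodule

theorem lie_mem_heightFiltration {b : (rootSystem H).Base} {ρ : Module.Dual ℂ H →ₗ[ℂ] ℂ}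
    (hρ : ∀ α : H.root, ρ α.1.toLinear = b.height α) {x : L} (hx : x ∈ posPart b) {n : ℤ} {y : L}
    (hy : y ∈ heightFiltration ρ n) : ⁅x, y⁆ ∈ heightFiltration ρ (n + 1) := by
  unfold AdNilp.posPart at hx
  induction hx using Submodule.iSup_induction' with
  | zero => simp
  | add x z _ _ h₁ h₂ => rw [add_lie]; exact add_mem h₁ h₂
  | mem α x hx =>
    unfold heightFiltration at hy
    induction hy using Submodule.iSup_induction' with
    | zero => simp
    | add y z _ _ h₁ h₂ => rw [lie_add]; exact add_mem h₁ h₂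
    | mem χ y hy =>
      by_cases hχ : ∃ k : ℤ, n ≤ k ∧ ρ χ.toLinear = k
      swap
      · simp [hχ] at hy; simp [hy]
      simp only [hχ, iSup_pos] at hy
      obtain ⟨k, hk, hk'⟩ := hχ
      have hxy : ⁅x, y⁆ ∈ rootSpace H ((α.1.1 : H → ℂ) + (χ : H → ℂ)) :=
        lie_mem_genWeightSpace_of_mem_genWeightSpace hx hy
      by_cases hbot : rootSpace H ((α.1.1 : H → ℂ) + (χ : H → ℂ)) = ⊥
      · rw [hbot, LieSubmodule.mem_bot] at hxy
        rw [hxy]; exact zero_mem _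
      · let γ : Weight ℂ H L := ⟨(α.1.1 : H → ℂ) + (χ : H → ℂ), hbot⟩
        have hγ : γ.toLinear = α.1.1.toLinear + χ.toLinear := by ext t; rfl
        refine Submodule.mem_iSup_of_mem γ (Submodule.mem_iSup_of_mem
          ⟨b.height α.1 + k, ?_, ?_⟩ hxy)
        · have : 0 < b.height α.1 := α.2
          omega
        · rw [hγ, map_add, hρ, hk']
          push_cast
          rfl

/-- `ad x` raises the height filtration by at least one, and only finitely many heights occur. -/
theorem isNilpotent_ad_of_mem_posPart {b : (rootSystem H).Base} {x : L} (hx : x ∈ posPart b) :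
    IsNilpotent (LieAlgebra.ad ℂ L x) := by
  obtain ⟨ρ, hρ⟩ := exists_height_functional b
  have hint : ∀ χ : Weight ℂ H L, ∃ k : ℤ, ρ χ.toLinear = k := by
    intro χ
    by_cases hχ : χ.IsZero
    · refine ⟨0, ?_⟩
      have : χ.toLinear = 0 := by ext t; exact congrFun hχ t
      rw [this]; simp
    · exact ⟨_, hρ ⟨χ, by simpa using hχ⟩⟩
  choose ht hht using hint
  obtain ⟨N, hN⟩ := (Set.finite_range ht).bddAbove
  obtain ⟨N', hN'⟩ := (Set.finite_range ht).bddBelow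
  have htop : heightFiltration (L := L) ρ N' = ⊤ := by
    rw [eq_top_iff, ← LieSubmodule.top_toSubmodule (R := ℂ) (L := H),
      ← iSup_genWeightSpace_eq_top' ℂ H L, LieSubmodule.iSup_toSubmodule]
    exact iSup_le fun χ => le_iSup₂_of_le χ ⟨ht χ, hN' ⟨χ, rfl⟩, hht χ⟩ le_rfl
  have hbot : ∀ n, N < n → heightFiltration (L := L) ρ n = ⊥ := by
    intro n hn
    rw [eq_bot_iff]
    refine iSup₂_le fun χ ⟨k, hk, hk'⟩ => ?_
    rw [hht] at hk'
    have h1 : ht χ = k := by exact_mod_cast hk'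
    have h2 := hN ⟨χ, rfl⟩
    omega
  have step : ∀ (m : ℕ) (y : L), ((LieAlgebra.ad ℂ L x) ^ m) y ∈ heightFiltration ρ (N' + m) := by
    intro m y
    induction m with
    | zero => simp [htop]
    | succ m ih =>
      rw [pow_succ', Module.End.mul_apply, LieAlgebra.ad_apply]
      have := lie_mem_heightFiltration hρ hx ih
      rwa [add_assoc] at this
  refine ⟨(N - N' + 1).toNat, LinearMap.ext fun y => ?_⟩
  have := step (N - N' + 1).toNat y
  rw [hbot _ (by omega), Submodule.mem_bot] at this
  simpa using this

/-! ## Ad-nilpotent ideals and sets of positive roots -/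

/-- A set of positive roots closed under the addition of positive roots. -/
structure IsRootFilter (b : (rootSystem H).Base) (Φ : Set H.root) : Prop where
  isPos : ∀ α ∈ Φ, b.IsPos α
  closed : addRoots {α | b.IsPos α} Φ ⊆ Φ

/-- An ideal of the Borel subalgebra, as a subspace of the whole Lie algebra. -/
noncomputable def idealImage (b : (rootSystem H).Base) (I : LieIdeal ℂ (borel b)) : Submodule ℂ L :=
  I.toSubmodule.map (borel b).toSubmodule.subtype

theorem mem_idealImage {b : (rootSystem H).Base} {I : LieIdeal ℂ (borel b)} {x : L} :
    x ∈ idealImage b I ↔ ∃ y ∈ I, (y : L) = x := Iff.rfl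

theorem idealImage_injective (b : (rootSystem H).Base) : Function.Injective (idealImage b) := by
  intro I J h
  have := Submodule.map_injective_of_injective (Submodule.injective_subtype _) h
  exact LieSubmodule.toSubmodule_injective this

theorem mem_borel_of_mem_posPart {b : (rootSystem H).Base} {x : L} (hx : x ∈ posPart b) :
    x ∈ borel b := Submodule.mem_sup_right hx

theorem mem_borel_of_mem_cartan {b : (rootSystem H).Base} {x : L} (hx : x ∈ H) :
    x ∈ borel b := Submodule.mem_sup_left hx

theorem lie_mem_idealImage {b : (rootSystem H).Base} {I : LieIdeal ℂ (borel b)} {x y : L}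
    (hx : x ∈ borel b) (hy : y ∈ idealImage b I) : ⁅x, y⁆ ∈ idealImage b I := by
  obtain ⟨z, hz, rfl⟩ := mem_idealImage.mp hy
  exact mem_idealImage.mpr ⟨⁅(⟨x, hx⟩ : borel b), z⁆, I.lie_mem hz, rfl⟩

/-- An ideal of the Borel subalgebra, as a module over the Cartan subalgebra. -/
noncomputable def idealModule (b : (rootSystem H).Base) (I : LieIdeal ℂ (borel b)) : LieSubmodule ℂ H L where
  toSubmodule := idealImage b I
  lie_mem {h _} hy := lie_mem_idealImage (mem_borel_of_mem_cartan h.2) hy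

/-- The roots whose root spaces are contained in an ideal of the Borel subalgebra. -/
def rootsOf (b : (rootSystem H).Base) (I : LieIdeal ℂ (borel b)) : Set H.root :=
  {α | (rootSpace H (α.1 : H → ℂ)).toSubmodule ≤ idealImage b I}

theorem rootSum_rootsOf_le (b : (rootSystem H).Base) (I : LieIdeal ℂ (borel b)) :
    rootSum (rootsOf b I) ≤ idealImage b I := iSup₂_le fun _ h => h

/-- Stability under the Cartan subalgebra splits the ideal into weight components. The zero
component vanishes because an ad-nilpotent element of the Cartan subalgebra is zero; each other
component is all or nothing because root spaces are lines. -/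
theorem idealImage_eq_rootSum {b : (rootSystem H).Base} {I : LieIdeal ℂ (borel b)}
    (hI : IsAdNilpotentIdeal b I) : idealImage b I = rootSum (rootsOf b I) := by
  refine le_antisymm ?_ (rootSum_rootsOf_le b I)
  have h := congrArg LieSubmodule.toSubmodule (eq_iSup_inf_genWeightSpace (N := idealModule b I))
  rw [LieSubmodule.iSup_toSubmodule] at h
  change idealImage b I = _ at h
  rw [h]
  refine iSup_le fun χ => ?_
  rw [LieSubmodule.inf_toSubmodule]
  change idealImage b I ⊓ _ ≤ _
  by_cases hχ : χ.IsZero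
  · rintro x ⟨hx, hx'⟩
    obtain ⟨y, hy, rfl⟩ := mem_idealImage.mp hx
    have hxH : (y : L) ∈ H := by
      have h0 : (χ : H → ℂ) = 0 := hχ
      rw [h0] at hx'
      exact (rootSpace_zero_eq ℂ L H).le hx'
    rw [eq_zero_of_isNilpotent_ad_of_mem_isCartanSubalgebra ℂ L H hxH (hI y hy)]
    exact zero_mem _
  · obtain ⟨α, rfl⟩ : ∃ α : H.root, α.1 = χ := ⟨⟨χ, by simpa using hχ⟩, rfl⟩
    by_cases hα : α ∈ rootsOf b I
    · rintro x ⟨-, hx'⟩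
      exact rootSpace_le_rootSum hα hx'
    · rintro x ⟨hx, hx'⟩
      by_cases hx0 : x = 0
      · rw [hx0]; exact zero_mem _
      · refine (hα fun y hy => ?_).elim
        obtain ⟨c, rfl⟩ := exists_smul_eq (α := α) hx' hx0 hy
        exact Submodule.smul_mem _ _ hx

theorem isRootFilter_rootsOf (b : (rootSystem H).Base) (I : LieIdeal ℂ (borel b)) :
    IsRootFilter b (rootsOf b I) := by
  have hpos : ∀ α ∈ rootsOf b I, b.IsPos α := by
    intro α hα
    by_contra hn
    obtain ⟨x, hx, hx0⟩ := exists_mem_rootSpace_ne_zero α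
    obtain ⟨y, -, rfl⟩ := mem_idealImage.mp (hα hx)
    have hb : (y : L) ∈ rootSum {α : H.root | b.IsPos α} ⊔ H.toSubmodule := by
      rw [sup_comm, ← posPart_eq_rootSum]
      exact y.2
    have := (disjoint_rootSpace_rootSum (Φ := {α : H.root | b.IsPos α}) hn).le_bot ⟨hx, hb⟩
    exact hx0 (by simpa using this)
  refine ⟨hpos, fun γ hγ => ?_⟩
  refine (rootSpace_le_rootSum hγ).trans ?_
  rw [← span_lie_rootSum (b := b) (Φ := {α | b.IsPos α}) (fun _ h => h) hpos, Submodule.span_le]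
  rintro _ ⟨x, hx, y, hy, rfl⟩
  rw [← posPart_eq_rootSum] at hx
  exact lie_mem_idealImage (mem_borel_of_mem_posPart hx) (rootSum_rootsOf_le b I hy)

/-- The ideal of the Borel subalgebra that belongs to a set of positive roots. -/
noncomputable def idealOf {b : (rootSystem H).Base} {Φ : Set H.root} (hΦ : IsRootFilter b Φ) :
    LieIdeal ℂ (borel b) where
  toSubmodule := (rootSum Φ).comap (borel b).toSubmodule.subtype
  lie_mem := by
    rintro ⟨x, hx⟩ ⟨y, hy'⟩ hy
    change y ∈ rootSum Φ at hy
    change ⁅x, y⁆ ∈ rootSum Φ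
    obtain ⟨h, hh, n, hn, rfl⟩ := Submodule.mem_sup.mp hx
    rw [add_lie]
    refine add_mem (lie_mem_rootSum_of_mem_cartan Φ hh hy) (rootSum_mono hΦ.closed ?_)
    rw [posPart_eq_rootSum] at hn
    exact lie_mem_rootSum (b := b) (fun _ h => h) hΦ.isPos hn hy

theorem rootSum_le_posPart {b : (rootSystem H).Base} {Φ : Set H.root} (hΦ : ∀ α ∈ Φ, b.IsPos α) :
    rootSum Φ ≤ posPart b := by
  rw [posPart_eq_rootSum]
  exact rootSum_mono hΦ

theorem idealImage_idealOf {b : (rootSystem H).Base} {Φ : Set H.root} (hΦ : IsRootFilter b Φ) :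
    idealImage b (idealOf hΦ) = rootSum Φ := by
  ext x
  rw [mem_idealImage]
  constructor
  · rintro ⟨y, hy, rfl⟩
    exact hy
  · intro hx
    exact ⟨⟨x, mem_borel_of_mem_posPart (rootSum_le_posPart hΦ.isPos hx)⟩, hx, rfl⟩

theorem rootsOf_eq {b : (rootSystem H).Base} {I : LieIdeal ℂ (borel b)} {Φ : Set H.root}
    (h : idealImage b I = rootSum Φ) : rootsOf b I = Φ := by
  ext α
  rw [rootsOf, Set.mem_ofPred_eq, h, rootSpace_le_rootSum_iff]

theorem isAdNilpotentIdeal_idealOf {b : (rootSystem H).Base} {Φ : Set H.root}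
    (hΦ : IsRootFilter b Φ) : IsAdNilpotentIdeal b (idealOf hΦ) :=
  fun _ hx => isNilpotent_ad_of_mem_posPart (rootSum_le_posPart hΦ.isPos hx)

theorem isPos_rootSeries {b : (rootSystem H).Base} {Φ : Set H.root} (hΦ : ∀ α ∈ Φ, b.IsPos α)
    (k : ℕ) : ∀ α ∈ rootSeries Φ k, b.IsPos α := by
  induction k with
  | zero => exact hΦ
  | succ k ih => exact isPos_addRoots hΦ ih

theorem map_lowerCentralSeries {b : (rootSystem H).Base} {I : LieIdeal ℂ (borel b)}
    {Φ : Set H.root} (hΦ : ∀ α ∈ Φ, b.IsPos α) (hI : idealImage b I = rootSum Φ) (k : ℕ) :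
    (lowerCentralSeries ℂ I I k).toSubmodule.map
      ((borel b).toSubmodule.subtype ∘ₗ I.toSubmodule.subtype) = rootSum (rootSeries Φ k) := by
  induction k with
  | zero =>
    rw [lowerCentralSeries_zero, LieSubmodule.top_toSubmodule, Submodule.map_comp,
      Submodule.map_subtype_top]
    exact hI
  | succ k ih =>
    rw [lowerCentralSeries_succ, LieSubmodule.lieIdeal_oper_eq_linear_span', Submodule.map_span,
      rootSeries, ← span_lie_rootSum hΦ (isPos_rootSeries hΦ k), ← ih, ← hI]
    congr 1
    ext z
    constructor
    · rintro ⟨_, ⟨x, -, y, hy, rfl⟩, rfl⟩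
      exact ⟨x, ⟨x, x.2, rfl⟩, y, ⟨y, hy, rfl⟩, rfl⟩
    · rintro ⟨_, ⟨x, hx, rfl⟩, _, ⟨y, hy, rfl⟩, rfl⟩
      exact ⟨⁅(⟨x, hx⟩ : I), y⁆, ⟨⟨x, hx⟩, LieSubmodule.mem_top _, y, hy, rfl⟩, rfl⟩

theorem lowerCentralSeries_eq_bot_iff {b : (rootSystem H).Base} {I : LieIdeal ℂ (borel b)}
    {Φ : Set H.root} (hΦ : ∀ α ∈ Φ, b.IsPos α) (hI : idealImage b I = rootSum Φ) (k : ℕ) :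
    lowerCentralSeries ℤ I I k = ⊥ ↔ rootSeries Φ k = ∅ := by
  -- The nilpotency length refers to the series over `ℤ`, which has the same underlying sets.
  have aux : lowerCentralSeries ℤ I I k = ⊥ ↔ lowerCentralSeries ℂ I I k = ⊥ := by
    simp [SetLike.ext'_iff, coe_lowerCentralSeries_eq_int ℂ I I]
  rw [aux, ← rootSum_eq_bot_iff, ← map_lowerCentralSeries hΦ hI, ← LieSubmodule.toSubmodule_eq_bot]
  have hinj : Function.Injective ((borel b).toSubmodule.subtype ∘ₗ I.toSubmodule.subtype) :=
    (Submodule.injective_subtype _).comp (Submodule.injective_subtype _)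
  exact ((Submodule.map_injective_of_injective hinj).eq_iff' (Submodule.map_bot _)).symm

theorem nilpotenceClass_le_iff {b : (rootSystem H).Base} {I : LieIdeal ℂ (borel b)}
    {Φ : Set H.root} (hΦ : ∀ α ∈ Φ, b.IsPos α) (hI : idealImage b I = rootSum Φ) (h : ℕ) :
    nilpotenceClass b I ≤ h ↔ rootSeries Φ h = ∅ := by
  rw [← lowerCentralSeries_eq_bot_iff hΦ hI]
  constructor
  · intro hle
    obtain ⟨k, hk⟩ := exists_rootSeries_eq_empty hΦ
    -- The infimum of an empty set of naturals would be 0, so nilpotence is needed for the infimum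
    -- to be attained.
    have hne : {k | lowerCentralSeries ℤ I I k = ⊥}.Nonempty :=
      ⟨k, (lowerCentralSeries_eq_bot_iff hΦ hI k).mpr hk⟩
    have hmem : lowerCentralSeries ℤ I I (nilpotenceClass b I) = ⊥ := Nat.sInf_mem hne
    exact eq_bot_iff.mpr (hmem ▸ antitone_lowerCentralSeries ℤ I I hle)
  · intro hh
    exact Nat.sInf_le hh

/-- Ad-nilpotent ideals of bounded class of nilpotence correspond to sets of positive roots. -/
theorem idealCount_eq (b : (rootSystem H).Base) (h : ℕ) :
    idealCount b h = {Φ : Set H.root | IsRootFilter b Φ ∧ rootSeries Φ h = ∅}.ncard := by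
  have himg : rootsOf b '' {I | IsAdNilpotentIdeal b I ∧ nilpotenceClass b I ≤ h} =
      {Φ : Set H.root | IsRootFilter b Φ ∧ rootSeries Φ h = ∅} := by
    ext Φ
    constructor
    · rintro ⟨I, ⟨hI, hc⟩, rfl⟩
      have hf := isRootFilter_rootsOf b I
      exact ⟨hf, (nilpotenceClass_le_iff hf.isPos (idealImage_eq_rootSum hI) h).mp hc⟩
    · rintro ⟨hΦ, hh⟩
      exact ⟨idealOf hΦ, ⟨isAdNilpotentIdeal_idealOf hΦ,
        (nilpotenceClass_le_iff hΦ.isPos (idealImage_idealOf hΦ) h).mpr hh⟩,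
        rootsOf_eq (idealImage_idealOf hΦ)⟩
  rw [← himg, idealCount, Set.InjOn.ncard_image]
  rintro I ⟨hI, -⟩ J ⟨hJ, -⟩ hIJ
  apply idealImage_injective b
  rw [idealImage_eq_rootSum hI, idealImage_eq_rootSum hJ, hIJ]

end Killing

end IdealCount

/-! ### Type `D_n` in coordinates. -/

namespace IdealCount

open Matrix

/-! ## The vectors of a root system of type `D_n` -/

/-- The unit vectors and their negatives, numbered so that `v` and `2 n - 1 - v` are opposite. -/
def nu (n v : ℕ) : Fin n → ℂ := fun i =>
  (((if v = i then 1 else 0) - (if v + i = 2 * n - 1 then 1 else 0) : ℤ) : ℂ)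

/-- The inner product of two of the vectors `nu`. -/
def nuInner (n v w : ℕ) : ℤ := (if v = w then 1 else 0) - (if v + w = 2 * n - 1 then 1 else 0)

theorem nu_mirror {n v : ℕ} (hv : v ≤ 2 * n - 1) : nu n (2 * n - 1 - v) = -nu n v := by
  funext i
  have hi := i.2
  simp only [nu, Pi.neg_apply, ← Int.cast_neg]
  congr 1
  split_ifs <;> omega

theorem nu_eq_single {n v : ℕ} (hv : v < n) : nu n v = Pi.single ⟨v, hv⟩ 1 := by
  funext i
  have hi := i.2
  by_cases h : v = i
  · subst h
    simp [nu]
    omega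
  · rw [Pi.single_eq_of_ne (by intro h'; exact h (congrArg Fin.val h').symm)]
    simp only [nu, if_neg h]
    rw [if_neg (by omega)]
    simp

theorem dot_nu {n v w : ℕ} (hv : v ≤ 2 * n - 1) (hw : w ≤ 2 * n - 1) :
    nu n v ⬝ᵥ nu n w = (nuInner n v w : ℂ) := by
  rcases Nat.eq_zero_or_pos n with rfl | hn
  · obtain rfl : v = 0 := by omega
    obtain rfl : w = 0 := by omega
    simp [nuInner]
  have key : ∀ v, v < n → nu n v ⬝ᵥ nu n w = (nuInner n v w : ℂ) := by
    intro v hv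
    rw [nu_eq_single hv, single_one_dotProduct]
    refine congrArg Int.cast ?_
    change (if w = v then 1 else 0) - (if w + v = 2 * n - 1 then 1 else 0) = nuInner n v w
    unfold nuInner
    split_ifs <;> omega
  by_cases h : v < n
  · exact key v h
  · have h1 := nu_mirror hv
    rw [show nu n v = -nu n (2 * n - 1 - v) by rw [h1, neg_neg], neg_dotProduct,
      key (2 * n - 1 - v) (by omega), ← Int.cast_neg]
    refine congrArg Int.cast ?_
    unfold nuInner
    split_ifs <;> omega

/-- The differences of the vectors `nu`. -/
def vec (n a b : ℕ) : Fin n → ℂ := nu n a - nu n b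

theorem vec_mirror {n a b : ℕ} (ha : a ≤ 2 * n - 1) (hb : b ≤ 2 * n - 1) :
    vec n (2 * n - 1 - b) (2 * n - 1 - a) = vec n a b := by
  rw [vec, vec, nu_mirror ha, nu_mirror hb]
  abel

theorem vec_add (n a b c : ℕ) : vec n a b + vec n b c = vec n a c := by
  unfold vec
  abel

/-- The inner product of two of the vectors `vec`. -/
def vecInner (n a b c d : ℕ) : ℤ :=
  nuInner n a c - nuInner n a d - nuInner n b c + nuInner n b d

theorem dot_vec {n a b c d : ℕ} (ha : a ≤ 2 * n - 1) (hb : b ≤ 2 * n - 1) (hc : c ≤ 2 * n - 1)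
    (hd : d ≤ 2 * n - 1) : vec n a b ⬝ᵥ vec n c d = (vecInner n a b c d : ℂ) := by
  simp only [vec, vecInner, sub_dotProduct, dotProduct_sub, dot_nu ha hc, dot_nu ha hd,
    dot_nu hb hc, dot_nu hb hd]
  push_cast
  ring

theorem nuInner_spec (n v w : ℕ) :
    (v = w ∧ v + w ≠ 2 * n - 1 ∧ nuInner n v w = 1) ∨
    (v = w ∧ v + w = 2 * n - 1 ∧ nuInner n v w = 0) ∨
    (v ≠ w ∧ v + w = 2 * n - 1 ∧ nuInner n v w = -1) ∨
    (v ≠ w ∧ v + w ≠ 2 * n - 1 ∧ nuInner n v w = 0) := by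
  unfold nuInner
  split_ifs <;> omega

theorem nuInner_of_lt {n v w : ℕ} (h : v + w < 2 * n - 1) :
    nuInner n v w = if v = w then 1 else 0 := by
  rw [nuInner, if_neg (show ¬ v + w = 2 * n - 1 by omega), sub_zero]

theorem vecInner_self {n a b : ℕ} (h : a ≠ b) (hab : a + b ≠ 2 * n - 1) (hn : 1 ≤ n) :
    vecInner n a b a b = 2 := by
  unfold vecInner nuInner
  split_ifs <;> omega

/-- All these vectors have square length 2, so equality forces inner product 2, which occurs only
for the same pair or its mirror image. -/
theorem vec_eq_iff {n a b c d : ℕ} (hn : 1 ≤ n) (hab : Ext (2 * n - 1) a b)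
    (hcd : Ext (2 * n - 1) c d) :
    vec n a b = vec n c d ↔ (c = a ∧ d = b) ∨ (c = 2 * n - 1 - b ∧ d = 2 * n - 1 - a) := by
  obtain ⟨h1, h2, h3⟩ := hab
  obtain ⟨h4, h5, h6⟩ := hcd
  constructor
  · intro h
    have e := dot_vec (n := n) (a := a) (b := b) (c := c) (d := d) (by omega) h2 (by omega) h5
    rw [← h, dot_vec (by omega) h2 (by omega) h2, vecInner_self h1.ne h3 hn] at e
    have e' : 2 = vecInner n a b c d := by exact_mod_cast e
    unfold vecInner at e'
    have s1 : nuInner n a c ≤ 0 ∨ a = c ∧ nuInner n a c ≤ 1 := by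
      have := nuInner_spec n a c; omega
    have s2 : 0 ≤ nuInner n a d ∨ a + d = 2 * n - 1 ∧ -1 ≤ nuInner n a d := by
      have := nuInner_spec n a d; omega
    have s3 : 0 ≤ nuInner n b c ∨ b + c = 2 * n - 1 ∧ -1 ≤ nuInner n b c := by
      have := nuInner_spec n b c; omega
    have s4 : nuInner n b d ≤ 0 ∨ b = d ∧ nuInner n b d ≤ 1 := by
      have := nuInner_spec n b d; omega
    omega
  · rintro (⟨rfl, rfl⟩ | ⟨rfl, rfl⟩)
    · rfl
    · rw [vec_mirror (by omega) (by omega)]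

/-- Square lengths 2 force the summands to have inner product `-1`, so up to mirroring the pairs
share a vertex. Then `x + z = 2 n - 1` is impossible, since the sum would have square length 4. -/
theorem vec_add_eq {n a b c d e f : ℕ} (hn : 1 ≤ n) (hab : Ext (2 * n - 1) a b)
    (hcd : Ext (2 * n - 1) c d) (hef : Ext (2 * n - 1) e f)
    (h : vec n e f = vec n a b + vec n c d) :
    ∃ x y z, Ext (2 * n - 1) x y ∧ Ext (2 * n - 1) y z ∧ Ext (2 * n - 1) x z ∧
      vec n a b = vec n x y ∧ vec n c d = vec n y z ∧ vec n e f = vec n x z := by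
  have key : ∀ x y z, Ext (2 * n - 1) x y → Ext (2 * n - 1) y z → vec n a b = vec n x y →
      vec n c d = vec n y z → ∃ x y z, Ext (2 * n - 1) x y ∧ Ext (2 * n - 1) y z ∧
      Ext (2 * n - 1) x z ∧ vec n a b = vec n x y ∧ vec n c d = vec n y z ∧
      vec n e f = vec n x z := by
    intro x y z hxy hyz e1 e2
    have e3 : vec n e f = vec n x z := by rw [h, e1, e2, vec_add]
    refine ⟨x, y, z, hxy, hyz, ⟨hxy.1.trans hyz.1, hyz.2.1, fun hs => ?_⟩, e1, e2, e3⟩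
    obtain ⟨h1, h2, -⟩ := hxy
    obtain ⟨h4, h5, -⟩ := hyz
    obtain ⟨h7, h8, h9⟩ := hef
    have e := dot_vec (n := n) (a := x) (b := z) (c := x) (d := z) (by omega) h5 (by omega) h5
    rw [← e3, dot_vec (by omega) h8 (by omega) h8, vecInner_self h7.ne h9 hn] at e
    have e' : 2 = vecInner n x z x z := by exact_mod_cast e
    unfold vecInner at e'
    have s1 := nuInner_spec n x x
    have s2 := nuInner_spec n x z
    have s3 := nuInner_spec n z x
    have s4 := nuInner_spec n z z
    omega
  have hab' := hab
  have hcd' := hcd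
  obtain ⟨h1, h2, h3⟩ := hab'
  obtain ⟨h4, h5, h6⟩ := hcd'
  obtain ⟨h7, h8, h9⟩ := hef
  have e' : 2 = 4 + 2 * vecInner n a b c d := by
    have e1 := dot_vec (n := n) (a := e) (b := f) (c := e) (d := f) (by omega) h8 (by omega) h8
    rw [h, add_dotProduct, dotProduct_add, dotProduct_add, vecInner_self h7.ne h9 hn,
      dotProduct_comm (vec n c d) (vec n a b),
      dot_vec (by omega) h2 (by omega) h2, dot_vec (by omega) h5 (by omega) h5,
      dot_vec (by omega) h2 (by omega) h5, vecInner_self h1.ne h3 hn,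
      vecInner_self h4.ne h6 hn] at e1
    have : (2 : ℤ) + vecInner n a b c d + (vecInner n a b c d + 2) = 2 := by exact_mod_cast e1
    omega
  have cases4 : b = c ∨ a = d ∨ a + c = 2 * n - 1 ∨ b + d = 2 * n - 1 := by
    unfold vecInner at e'
    by_contra! hc
    have s1 : 0 ≤ nuInner n a c := by have := nuInner_spec n a c; omega
    have s2 : nuInner n a d ≤ 0 := by have := nuInner_spec n a d; omega
    have s3 : nuInner n b c ≤ 0 := by have := nuInner_spec n b c; omega
    have s4 : 0 ≤ nuInner n b d := by have := nuInner_spec n b d; omega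
    omega
  have m1 := vec_mirror (n := n) (a := a) (b := b) (by omega) (by omega)
  have m2 := vec_mirror (n := n) (a := c) (b := d) (by omega) (by omega)
  rcases cases4 with rfl | rfl | h' | h'
  · exact key a b d hab hcd rfl rfl
  · exact key _ _ _ hab.mirror hcd.mirror m1.symm m2.symm
  · have h'' : c = 2 * n - 1 - a := by omega
    subst h''
    exact key _ _ _ hab.mirror hcd m1.symm rfl
  · have h'' : b = 2 * n - 1 - d := by omega
    subst h''
    exact key _ _ _ hab hcd.mirror rfl m2.symm

/-- The action on positions of the reflection in `vec n p q`. -/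
def swapPos (n p q v : ℕ) : ℕ :=
  if v = p then q else if v = q then p else if v = 2 * n - 1 - p then 2 * n - 1 - q
  else if v = 2 * n - 1 - q then 2 * n - 1 - p else v

theorem swapPos_le {n p q v : ℕ} (hp : p ≤ 2 * n - 1) (hq : q ≤ 2 * n - 1)
    (hv : v ≤ 2 * n - 1) : swapPos n p q v ≤ 2 * n - 1 := by
  unfold swapPos
  split_ifs <;> omega

theorem swapPos_swapPos {n p q v : ℕ} (hp : p ≤ 2 * n - 1) (hq : q ≤ 2 * n - 1)
    (hpq : p + q ≠ 2 * n - 1) : swapPos n p q (swapPos n p q v) = v := by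
  unfold swapPos
  split_ifs <;> omega

theorem swapPos_mirror {n p q v : ℕ} (hn : 1 ≤ n) (hp : p ≤ 2 * n - 1) (hq : q ≤ 2 * n - 1)
    (hpq : p + q ≠ 2 * n - 1) (hv : v ≤ 2 * n - 1) :
    swapPos n p q (2 * n - 1 - v) = 2 * n - 1 - swapPos n p q v := by
  unfold swapPos
  split_ifs <;> omega

theorem nu_reflect {n p q v : ℕ} (hn : 1 ≤ n) (hp : p ≤ 2 * n - 1) (hq : q ≤ 2 * n - 1)
    (hpq : p ≠ q) (hpq' : p + q ≠ 2 * n - 1) :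
    nu n v - (nuInner n v p - nuInner n v q : ℤ) • vec n p q = nu n (swapPos n p q v) := by
  have s1 := nuInner_spec n v p
  have s2 := nuInner_spec n v q
  unfold swapPos
  split_ifs with c1 c2 c3 c4
  · rw [show nuInner n v p - nuInner n v q = 1 by omega, c1, vec]
    simp
  · rw [show nuInner n v p - nuInner n v q = -1 by omega, c2, vec]
    simp
  · rw [show nuInner n v p - nuInner n v q = -1 by omega, c3, vec, nu_mirror hp, nu_mirror hq]
    simp only [one_smul, neg_smul]
    abel
  · rw [show nuInner n v p - nuInner n v q = 1 by omega, c4, vec, nu_mirror hp, nu_mirror hq]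
    simp only [one_smul]
    abel
  · rw [show nuInner n v p - nuInner n v q = 0 by omega]
    simp

theorem vec_reflect {n a b p q : ℕ} (hn : 1 ≤ n) (ha : a ≤ 2 * n - 1) (hb : b ≤ 2 * n - 1)
    (hp : p ≤ 2 * n - 1) (hq : q ≤ 2 * n - 1) (hpq : p ≠ q) (hpq' : p + q ≠ 2 * n - 1) :
    vec n a b - (vec n a b ⬝ᵥ vec n p q) • vec n p q =
      vec n (swapPos n p q a) (swapPos n p q b) := by
  rw [dot_vec ha hb hp hq, Int.cast_smul_eq_zsmul, vec.eq_1 n (swapPos n p q a),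
    ← nu_reflect hn hp hq hpq hpq', ← nu_reflect hn hp hq hpq hpq']
  have : vecInner n a b p q =
      (nuInner n a p - nuInner n a q) - (nuInner n b p - nuInner n b q) := by
    unfold vecInner; ring
  rw [this, sub_smul, vec.eq_1 n a b]
  abel

/-- The positions of the simple roots. -/
def simpleFst (n k : ℕ) : ℕ := if k + 1 < n then k else n - 2

/-- See `simpleFst`. -/
def simpleSnd (n k : ℕ) : ℕ := if k + 1 < n then k + 1 else n

theorem simple_spec (n k : ℕ) :
    (k + 1 < n ∧ simpleFst n k = k ∧ simpleSnd n k = k + 1) ∨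
    (n ≤ k + 1 ∧ simpleFst n k = n - 2 ∧ simpleSnd n k = n) := by
  unfold simpleFst simpleSnd
  split_ifs <;> omega

theorem dot_simple {n : ℕ} (hn : 2 ≤ n) (i j : Fin n) :
    vec n (simpleFst n i) (simpleSnd n i) ⬝ᵥ vec n (simpleFst n j) (simpleSnd n j) =
      (CartanMatrix.D n i j : ℂ) := by
  have h1 := simple_spec n i
  have h2 := simple_spec n j
  have hi := i.2
  have hj := j.2
  rw [dot_vec (by omega) (by omega) (by omega) (by omega)]
  refine congrArg Int.cast ?_
  rcases h1 with ⟨h1, e1, e2⟩ | ⟨h1, e1, e2⟩ <;> rcases h2 with ⟨h2, e3, e4⟩ | ⟨h2, e3, e4⟩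
  · have D : CartanMatrix.D n i j = if i.val = j then 2 else
        if i.val + 1 = j ∨ j.val + 1 = i then -1 else 0 := by
      simp only [CartanMatrix.D, Matrix.of_apply, Fin.ext_iff]
      split_ifs <;> omega
    rw [D, vecInner, e1, e2, e3, e4, nuInner_of_lt (by omega), nuInner_of_lt (by omega),
      nuInner_of_lt (by omega), nuInner_of_lt (by omega)]
    split_ifs <;> omega
  · have D : CartanMatrix.D n i j = if i.val + 3 = n then -1 else 0 := by
      simp only [CartanMatrix.D, Matrix.of_apply, Fin.ext_iff]
      split_ifs <;> omega
    rw [D, vecInner, e1, e2, e3, e4, nuInner_of_lt (by omega), nuInner_of_lt (by omega),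
      nuInner_of_lt (by omega), nuInner]
    split_ifs <;> omega
  · have D : CartanMatrix.D n i j = if j.val + 3 = n then -1 else 0 := by
      simp only [CartanMatrix.D, Matrix.of_apply, Fin.ext_iff]
      split_ifs <;> omega
    rw [D, vecInner, e1, e2, e3, e4, nuInner_of_lt (by omega), nuInner_of_lt (by omega),
      nuInner_of_lt (by omega), nuInner]
    split_ifs <;> omega
  · have D : CartanMatrix.D n i j = 2 := by
      simp only [CartanMatrix.D, Matrix.of_apply, Fin.ext_iff]
      split_ifs <;> omega
    rw [D, e1, e2, e3, e4]
    exact vecInner_self (by omega) (by omega) (by omega)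

/-- The weights of the coordinates in the height. -/
def heightVec (n : ℕ) : Fin n → ℂ := fun i => ((n - 1 - i : ℤ) : ℂ)

theorem nu_dot_heightVec {n v : ℕ} (hv : v ≤ 2 * n - 1) (hn : 1 ≤ n) :
    nu n v ⬝ᵥ heightVec n = ((if v < n then n - 1 - v else n - v : ℤ) : ℂ) := by
  by_cases h : v < n
  · rw [nu_eq_single h, single_one_dotProduct, if_pos h, heightVec]
  · have h1 := nu_mirror hv
    rw [show nu n v = -nu n (2 * n - 1 - v) by rw [h1, neg_neg], neg_dotProduct,
      nu_eq_single (show 2 * n - 1 - v < n by omega), single_one_dotProduct, if_neg h, heightVec,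
      ← Int.cast_neg]
    congr 1
    simp only
    omega

theorem simple_dot_heightVec {n : ℕ} (hn : 2 ≤ n) (i : Fin n) :
    vec n (simpleFst n i) (simpleSnd n i) ⬝ᵥ heightVec n = 1 := by
  have h1 := simple_spec n i
  have hi := i.2
  rw [vec, sub_dotProduct, nu_dot_heightVec (by omega) (by omega),
    nu_dot_heightVec (by omega) (by omega), ← Int.cast_sub, ← Int.cast_one (R := ℂ)]
  refine congrArg (Int.cast (R := ℂ)) ?_
  split_ifs <;> omega

end IdealCount

namespace IdealCount

open LieAlgebra LieAlgebra.IsKilling LieModule AdNilp Matrix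

section TypeD

variable {L : Type*} [LieRing L] [LieAlgebra ℂ L] [FiniteDimensional ℂ L]
  [LieAlgebra.IsKilling ℂ L] {H : LieSubalgebra ℂ L} [H.IsCartanSubalgebra] {n : ℕ}

/-! ## Coordinates for root systems of type `D_n` -/

/-- The simple roots in coordinates. -/
def simpleVec (n k : ℕ) : Fin n → ℂ := vec n (simpleFst n k) (simpleSnd n k)

/-- The pairing of a vector with a fixed vector, as a linear functional. -/
def dotFunctional (w : Fin n → ℂ) : (Fin n → ℂ) →ₗ[ℂ] ℂ where
  toFun x := x ⬝ᵥ w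
  map_add' x y := add_dotProduct x y w
  map_smul' c x := smul_dotProduct c x w

/-- The coordinates in which the simple roots take their standard form. -/
noncomputable def coord {b : (rootSystem H).Base} (e : b.support ≃ Fin n) :
    Module.Dual ℂ H →ₗ[ℂ] (Fin n → ℂ) :=
  b.toWeightBasis.constr ℂ fun i => simpleVec n (e i)

theorem coord_simple {b : (rootSystem H).Base} (e : b.support ≃ Fin n) (i : b.support) :
    coord e ((rootSystem H).root i) = simpleVec n (e i) := by
  have := b.toWeightBasis.constr_basis ℂ (fun i => simpleVec n (e i)) i
  rwa [RootPairing.Base.toWeightBasis_apply] at this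

variable {b : (rootSystem H).Base} {e : b.support ≃ Fin n} (hn : 2 ≤ n)
  (he : ∀ i j, b.cartanMatrix i j = CartanMatrix.D n (e i) (e j))

include hn he

/-- The Gram matrix of the simple vectors is the Cartan matrix, so a root and its coroot share
coordinates; it suffices to check the basis of simple roots. -/
theorem coord_dot_simple (x : Module.Dual ℂ H) (j : b.support) :
    coord e x ⬝ᵥ simpleVec n (e j) = x ((rootSystem H).coroot j) := by
  have key : dotFunctional (simpleVec n (e j)) ∘ₗ coord e =
      Module.Dual.eval ℂ H ((rootSystem H).coroot j) := by
    refine b.toWeightBasis.ext fun i => ?_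
    rw [RootPairing.Base.toWeightBasis_apply]
    change coord e ((rootSystem H).root i) ⬝ᵥ simpleVec n (e j) =
      (rootSystem H).root i ((rootSystem H).coroot j)
    rw [coord_simple]
    refine (dot_simple hn (e i) (e j)).trans ?_
    rw [← he i j]
    have := b.algebraMap_cartanMatrixIn_apply ℤ i j
    exact this
  exact LinearMap.congr_fun key x

theorem coord_injective : Function.Injective (coord e) := by
  rw [injective_iff_map_eq_zero]
  intro x hx
  refine b.toCoweightBasis.ext fun j => ?_
  rw [RootPairing.Base.toCoweightBasis_apply, ← coord_dot_simple hn he, hx]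
  simp

theorem coord_reflectionPerm (j : b.support) (i : H.root) :
    coord e ((rootSystem H).root ((rootSystem H).reflectionPerm j i)) =
      coord e ((rootSystem H).root i) -
        (coord e ((rootSystem H).root i) ⬝ᵥ simpleVec n (e j)) • simpleVec n (e j) := by
  rw [RootPairing.root_reflectionPerm, RootPairing.reflection_apply_root, map_sub, map_smul,
    coord_simple, coord_dot_simple hn he]
  rfl

theorem coord_reflectionPerm_vec (j : b.support) {i : H.root} {v w : ℕ} (hv : v ≤ 2 * n - 1)
    (hw : w ≤ 2 * n - 1) (h : coord e ((rootSystem H).root i) = vec n v w) :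
    coord e ((rootSystem H).root ((rootSystem H).reflectionPerm j i)) =
      vec n (swapPos n (simpleFst n (e j)) (simpleSnd n (e j)) v)
        (swapPos n (simpleFst n (e j)) (simpleSnd n (e j)) w) := by
  have h1 := simple_spec n (e j)
  have h2 := (e j).2
  rw [coord_reflectionPerm hn he, h]
  exact vec_reflect (by omega) hv hw (by omega) (by omega) (by omega) (by omega)

/-- Simple reflections generate all roots from the simple ones, and in coordinates they permute the
vertices compatibly with the mirror. -/
theorem exists_coord_eq_vec (α : H.root) : ∃ v w, v ≤ 2 * n - 1 ∧ w ≤ 2 * n - 1 ∧ v ≠ w ∧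
    v + w ≠ 2 * n - 1 ∧ coord e ((rootSystem H).root α) = vec n v w := by
  refine b.induction_reflect α (p := fun α => ∃ v w, v ≤ 2 * n - 1 ∧ w ≤ 2 * n - 1 ∧ v ≠ w ∧
    v + w ≠ 2 * n - 1 ∧ coord e ((rootSystem H).root α) = vec n v w) ?_ ?_ ?_
  · rintro i ⟨v, w, h1, h2, h3, h4, h5⟩
    refine ⟨w, v, h2, h1, h3.symm, by omega, ?_⟩
    rw [RootPairing.root_reflectionPerm, RootPairing.reflection_apply_self, map_neg, h5, vec, vec]
    abel
  · intro i hi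
    have h1 := simple_spec n (e ⟨i, hi⟩)
    have h2 := (e ⟨i, hi⟩).2
    exact ⟨_, _, by omega, by omega, by omega, by omega, coord_simple e ⟨i, hi⟩⟩
  · rintro i j ⟨v, w, h1, h2, h3, h4, h5⟩ hj
    have h6 := simple_spec n (e ⟨j, hj⟩)
    have h7 := (e ⟨j, hj⟩).2
    have h8 := coord_reflectionPerm_vec hn he ⟨j, hj⟩ h1 h2 h5
    have hp : simpleFst n (e ⟨j, hj⟩) ≤ 2 * n - 1 := by omega
    have hq : simpleSnd n (e ⟨j, hj⟩) ≤ 2 * n - 1 := by omega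
    have hpq : simpleFst n (e ⟨j, hj⟩) + simpleSnd n (e ⟨j, hj⟩) ≠ 2 * n - 1 := by omega
    refine ⟨_, _, swapPos_le hp hq h1, swapPos_le hp hq h2, fun h => h3 ?_, fun h => h4 ?_, h8⟩
    · rw [← swapPos_swapPos (v := v) hp hq hpq, h, swapPos_swapPos hp hq hpq]
    · have h9 := swapPos_le hp hq h2
      have h10 : swapPos n (simpleFst n (e ⟨j, hj⟩)) (simpleSnd n (e ⟨j, hj⟩)) v =
          2 * n - 1 - swapPos n (simpleFst n (e ⟨j, hj⟩)) (simpleSnd n (e ⟨j, hj⟩)) w := by omega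
      rw [← swapPos_mirror (by omega) hp hq hpq h2] at h10
      have h11 := congrArg (swapPos n (simpleFst n (e ⟨j, hj⟩)) (simpleSnd n (e ⟨j, hj⟩))) h10
      rw [swapPos_swapPos hp hq hpq, swapPos_swapPos hp hq hpq] at h11
      omega

omit he in
theorem coord_dot_heightVec (α : H.root) :
    coord e ((rootSystem H).root α) ⬝ᵥ heightVec n = b.height α := by
  refine apply_root_eq_height (ρ := dotFunctional (heightVec n) ∘ₗ coord e) (fun j => ?_) α
  change coord e ((rootSystem H).root j) ⬝ᵥ heightVec n = 1
  rw [coord_simple]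
  exact simple_dot_heightVec hn _

omit he in
-- The height is a difference of vertex values that decrease along the order. Only `n - 1` and `n`
-- have equal values, and that pair is excluded.
theorem isPos_iff_of_coord {α : H.root} {v w : ℕ} (hv : v ≤ 2 * n - 1) (hw : w ≤ 2 * n - 1)
    (hvw : v ≠ w) (hvw' : v + w ≠ 2 * n - 1) (h : coord e ((rootSystem H).root α) = vec n v w) :
    b.IsPos α ↔ v < w := by
  have h1 := coord_dot_heightVec hn (e := e) α
  rw [h, vec, sub_dotProduct, nu_dot_heightVec hv (by omega), nu_dot_heightVec hw (by omega),
    ← Int.cast_sub] at h1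
  have h2 : _ = b.height α := Int.cast_injective h1
  rw [RootPairing.Base.isPos_iff, ← h2]
  split_ifs <;> omega

theorem exists_ext_of_isPos {α : H.root} (hα : b.IsPos α) :
    ∃ v w, Ext (2 * n - 1) v w ∧ coord e ((rootSystem H).root α) = vec n v w := by
  obtain ⟨v, w, h1, h2, h3, h4, h5⟩ := exists_coord_eq_vec hn he α
  exact ⟨v, w, ⟨(isPos_iff_of_coord hn h1 h2 h3 h4 h5).mp hα, h2, h4⟩, h5⟩

theorem exists_root_swapPos (k : ℕ) (hk : k < n) {v w v' w' : ℕ} (hv : v ≤ 2 * n - 1)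
    (hw : w ≤ 2 * n - 1) (hv' : v' = swapPos n (simpleFst n k) (simpleSnd n k) v)
    (hw' : w' = swapPos n (simpleFst n k) (simpleSnd n k) w)
    (h : ∃ α, coord e ((rootSystem H).root α) = vec n v w) :
    ∃ α, coord e ((rootSystem H).root α) = vec n v' w' := by
  obtain ⟨α, hα⟩ := h
  have := coord_reflectionPerm_vec hn he (e.symm ⟨k, hk⟩) hv hw hα
  rw [e.apply_symm_apply] at this
  exact ⟨_, by rw [this, hv', hw']⟩

omit hn he in
theorem exists_root_simple (k : ℕ) (hk : k < n) :
    ∃ α, coord e ((rootSystem H).root α) = vec n (simpleFst n k) (simpleSnd n k) := by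
  have := coord_simple e (e.symm ⟨k, hk⟩)
  rw [e.apply_symm_apply] at this
  exact ⟨_, this⟩

theorem exists_root_of_lt {v w : ℕ} (hvw : v < w) (hw : w ≤ n) (hvn : v + 1 < n) :
    ∃ α, coord e ((rootSystem H).root α) = vec n v w := by
  obtain ⟨d, hd⟩ : ∃ d, w = v + 1 + d := ⟨w - v - 1, by omega⟩
  by_cases hwn : w = n
  · subst hwn
    have : ∀ d v, v + 2 + d = w → ∃ α, coord e ((rootSystem H).root α) = vec w v w := by
      intro d
      induction d with
      | zero =>
        intro v hv
        have := exists_root_simple (e := e) (w - 1) (by omega)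
        have h1 := simple_spec w (w - 1)
        rwa [show simpleFst w (w - 1) = v by omega, show simpleSnd w (w - 1) = w by omega] at this
      | succ d ih =>
        intro v hv
        have h1 := simple_spec w v
        refine exists_root_swapPos hn he v (by omega) (v := v + 1) (w := w) (by omega) (by omega)
          ?_ ?_ (ih (v + 1) (by omega))
        · unfold swapPos; split_ifs <;> omega
        · unfold swapPos; split_ifs <;> omega
    exact this (w - v - 2) v (by omega)
  · clear hvw
    induction d generalizing v with
    | zero =>
      have := exists_root_simple (e := e) v (by omega)
      have h1 := simple_spec n v
      rwa [show simpleFst n v = v by omega, show simpleSnd n v = w by omega] at this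
    | succ d ih =>
      have h1 := simple_spec n v
      refine exists_root_swapPos hn he v (by omega) (v := v + 1) (w := w) (by omega) (by omega)
        ?_ ?_ (ih (by omega) (by omega))
      · unfold swapPos; split_ifs <;> omega
      · unfold swapPos; split_ifs <;> omega

theorem exists_root_of_add_lt {v w : ℕ} (hvw : v < w) (hs : v + w < 2 * n - 1) :
    ∃ α, coord e ((rootSystem H).root α) = vec n v w := by
  by_cases hw : w ≤ n
  · exact exists_root_of_lt hn he hvw hw (by omega)
  · obtain ⟨d, rfl⟩ : ∃ d, w = n + d := ⟨w - n, by omega⟩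
    clear hw hvw
    induction d with
    | zero => exact exists_root_of_lt hn he (by omega) le_rfl (by omega)
    | succ d ih =>
      -- This simple reflection exchanges `n - d - 2` with `n - d - 1` and, mirrored, `n + d` with
      -- `n + d + 1`.
      have h1 := simple_spec n (n - 1 - d - 1)
      refine exists_root_swapPos hn he (n - 1 - d - 1) (by omega) (v := v) (w := n + d) (by omega)
        (by omega) ?_ ?_ (ih (by omega))
      · unfold swapPos; split_ifs <;> omega
      · unfold swapPos; split_ifs <;> omega

theorem exists_isPos_of_ext {v w : ℕ} (h : Ext (2 * n - 1) v w) :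
    ∃ α, b.IsPos α ∧ coord e ((rootSystem H).root α) = vec n v w := by
  obtain ⟨h1, h2, h3⟩ := h
  have : ∃ α, coord e ((rootSystem H).root α) = vec n v w := by
    by_cases hs : v + w < 2 * n - 1
    · exact exists_root_of_add_lt hn he h1 hs
    · rw [← vec_mirror (by omega) h2]
      exact exists_root_of_add_lt hn he (by omega) (by omega)
  obtain ⟨α, hα⟩ := this
  exact ⟨α, (isPos_iff_of_coord hn (by omega) h2 h1.ne h3 hα).mpr h1, hα⟩

end TypeD

end IdealCount

namespace IdealCount

open LieAlgebra LieAlgebra.IsKilling LieModule AdNilp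

section TypeD

variable {L : Type*} [LieRing L] [LieAlgebra ℂ L] [FiniteDimensional ℂ L]
  [LieAlgebra.IsKilling ℂ L] {H : LieSubalgebra ℂ L} [H.IsCartanSubalgebra] {n : ℕ}
  {b : (rootSystem H).Base} {e : b.support ≃ Fin n}

/-! ## Ideals as symmetric filters -/

/-- The pairs of vertices whose vectors are coordinates of elements of a set of roots. -/
def pairsOf (e : b.support ≃ Fin n) (Φ : Set H.root) (v w : ℕ) : Prop :=
  Ext (2 * n - 1) v w ∧ ∃ α ∈ Φ, coord e ((rootSystem H).root α) = vec n v w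

theorem pairsOf_mirror {Φ : Set H.root} {v w : ℕ} (h : pairsOf e Φ v w) :
    pairsOf e Φ (2 * n - 1 - w) (2 * n - 1 - v) := by
  obtain ⟨hx, α, hα, hc⟩ := h
  refine ⟨hx.mirror, α, hα, ?_⟩
  rw [hc, vec_mirror (by have := hx.1; have := hx.2.1; omega) hx.2.1]

theorem root_eq_add_of_coord (hn : 2 ≤ n)
    (he : ∀ i j, b.cartanMatrix i j = CartanMatrix.D n (e i) (e j)) {α β γ : H.root} :
    (γ.1 : H → ℂ) = α.1 + β.1 ↔ coord e ((rootSystem H).root γ) =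
      coord e ((rootSystem H).root α) + coord e ((rootSystem H).root β) := by
  rw [← root_eq_add_iff, ← map_add (coord e)]
  exact (coord_injective hn he).eq_iff.symm

theorem eq_of_coord_eq (hn : 2 ≤ n)
    (he : ∀ i j, b.cartanMatrix i j = CartanMatrix.D n (e i) (e j)) {α β : H.root}
    (h : coord e ((rootSystem H).root α) = coord e ((rootSystem H).root β)) : α = β :=
  (rootSystem H).root.injective (coord_injective hn he h)

theorem isSymFilter_pairsOf (hn : 2 ≤ n)
    (he : ∀ i j, b.cartanMatrix i j = CartanMatrix.D n (e i) (e j)) {Φ : Set H.root}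
    (hΦ : IsRootFilter b Φ) : IsSymFilter (2 * n - 1) (pairsOf e Φ) where
  ext h := h.1
  mirror h := pairsOf_mirror h
  closed := by
    rintro u v w ⟨-, α, hα, hc⟩ hvw huw
    obtain ⟨β, hβ, hβc⟩ := exists_isPos_of_ext hn he hvw
    obtain ⟨γ, -, hγc⟩ := exists_isPos_of_ext hn he huw
    refine ⟨huw, γ, hΦ.closed ⟨β, hβ, α, hα, ?_⟩, hγc⟩
    rw [root_eq_add_of_coord hn he, hγc, hβc, hc, add_comm, vec_add]

theorem iterSum_pairsOf (hn : 2 ≤ n)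
    (he : ∀ i j, b.cartanMatrix i j = CartanMatrix.D n (e i) (e j)) {Φ : Set H.root}
    (hΦ : ∀ α ∈ Φ, b.IsPos α) {k u w : ℕ} :
    iterSum (2 * n - 1) (pairsOf e Φ) k u w ↔ pairsOf e (rootSeries Φ k) u w := by
  induction k generalizing u w with
  | zero => rfl
  | succ k ih =>
    simp only [iterSum, ih]
    constructor
    · rintro ⟨huw, v, h⟩
      obtain ⟨γ, -, hγc⟩ := exists_isPos_of_ext hn he huw
      refine ⟨huw, γ, ?_, hγc⟩
      rcases h with ⟨⟨-, α, hα, hαc⟩, -, β, hβ, hβc⟩ | ⟨⟨-, β, hβ, hβc⟩, -, α, hα, hαc⟩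
      · refine ⟨α, hα, β, hβ, ?_⟩
        rw [root_eq_add_of_coord hn he, hγc, hαc, hβc, vec_add]
      · refine ⟨α, hα, β, hβ, ?_⟩
        rw [root_eq_add_of_coord hn he, hγc, hαc, hβc, add_comm, vec_add]
    · rintro ⟨huw, γ, ⟨α, hα, β, hβ, hγ⟩, hγc⟩
      obtain ⟨a₁, a₂, ha, hac⟩ := exists_ext_of_isPos hn he (hΦ α hα)
      obtain ⟨b₁, b₂, hb, hbc⟩ := exists_ext_of_isPos hn he (isPos_rootSeries hΦ k β hβ)
      rw [root_eq_add_of_coord hn he, hγc, hac, hbc] at hγ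
      obtain ⟨x, y, z, hxy, hyz, hxz, h₁, h₂, h₃⟩ := vec_add_eq (by omega) ha hb huw hγ
      have hA : pairsOf e Φ x y := ⟨hxy, α, hα, hac.trans h₁⟩
      have hB : pairsOf e (rootSeries Φ k) y z := ⟨hyz, β, hβ, hbc.trans h₂⟩
      refine ⟨huw, ?_⟩
      rcases (vec_eq_iff (by omega) huw hxz).mp h₃ with ⟨rfl, rfl⟩ | ⟨rfl, rfl⟩
      · exact ⟨y, .inl ⟨hA, hB⟩⟩
      -- The mirror image reverses the order of the two summands; hence the second alternative in
      -- `iterSum`.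
      · refine ⟨2 * n - 1 - y, .inr ⟨?_, ?_⟩⟩
        · have := pairsOf_mirror hB
          rwa [Nat.sub_sub_self (by have := huw.1; have := huw.2.1; omega)] at this
        · have := pairsOf_mirror hA
          rwa [Nat.sub_sub_self huw.2.1] at this

theorem eq_empty_iff_pairsOf (hn : 2 ≤ n)
    (he : ∀ i j, b.cartanMatrix i j = CartanMatrix.D n (e i) (e j)) {Φ : Set H.root}
    (hΦ : ∀ α ∈ Φ, b.IsPos α) : Φ = ∅ ↔ ∀ u v, ¬ pairsOf e Φ u v := by
  rw [Set.eq_empty_iff_forall_notMem]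
  refine ⟨fun h u v ⟨_, α, hα, _⟩ => h α hα, fun h α hα => ?_⟩
  obtain ⟨u, v, huv, hc⟩ := exists_ext_of_isPos hn he (hΦ α hα)
  exact h u v ⟨huv, α, hα, hc⟩

theorem subset_of_pairsOf (hn : 2 ≤ n)
    (he : ∀ i j, b.cartanMatrix i j = CartanMatrix.D n (e i) (e j)) {Φ Ψ : Set H.root}
    (hΦ : ∀ α ∈ Φ, b.IsPos α) (h : pairsOf e Φ = pairsOf e Ψ) : Φ ⊆ Ψ := by
  intro α hα
  obtain ⟨u, v, huv, hc⟩ := exists_ext_of_isPos hn he (hΦ α hα)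
  obtain ⟨-, β, hβ, hβc⟩ : pairsOf e Ψ u v := h ▸ ⟨huv, α, hα, hc⟩
  rwa [eq_of_coord_eq hn he (hc.trans hβc.symm)]

/-- The positive roots given by a relation on vertices. -/
def rootsOfPairs (e : b.support ≃ Fin n) (F : ℕ → ℕ → Prop) : Set H.root :=
  {α | b.IsPos α ∧ ∃ u v, F u v ∧ coord e ((rootSystem H).root α) = vec n u v}

theorem pairsOf_rootsOfPairs (hn : 2 ≤ n)
    (he : ∀ i j, b.cartanMatrix i j = CartanMatrix.D n (e i) (e j)) {F : ℕ → ℕ → Prop}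
    (hF : IsSymFilter (2 * n - 1) F) : pairsOf e (rootsOfPairs e F) = F := by
  ext u v
  constructor
  · rintro ⟨huv, α, ⟨-, x, y, hxy, hc⟩, hc'⟩
    rcases (vec_eq_iff (by omega) (hF.ext hxy) huv).mp (hc.symm.trans hc') with
      ⟨rfl, rfl⟩ | ⟨rfl, rfl⟩
    · exact hxy
    · exact hF.mirror hxy
  · intro huv
    obtain ⟨α, hα, hc⟩ := exists_isPos_of_ext hn he (hF.ext huv)
    exact ⟨hF.ext huv, α, ⟨hα, u, v, huv, hc⟩, hc⟩

theorem isRootFilter_rootsOfPairs (hn : 2 ≤ n)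
    (he : ∀ i j, b.cartanMatrix i j = CartanMatrix.D n (e i) (e j)) {F : ℕ → ℕ → Prop}
    (hF : IsSymFilter (2 * n - 1) F) : IsRootFilter b (rootsOfPairs e F) where
  isPos α hα := hα.1
  closed := by
    rintro γ ⟨β, hβ, α, hα, hγ⟩
    have hγpos : b.IsPos γ := hβ.add hα.1 (root_eq_add_iff.mpr hγ)
    refine ⟨hγpos, ?_⟩
    obtain ⟨-, u, v, huv, hc⟩ := hα
    obtain ⟨b₁, b₂, hb, hbc⟩ := exists_ext_of_isPos hn he hβ
    obtain ⟨c₁, c₂, hcx, hcc⟩ := exists_ext_of_isPos hn he hγpos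
    rw [add_comm, root_eq_add_of_coord hn he, hcc, hbc, hc] at hγ
    obtain ⟨x, y, z, hxy, hyz, hxz, h₁, h₂, h₃⟩ := vec_add_eq (by omega) (hF.ext huv) hb hcx hγ
    refine ⟨x, z, hF.closed ?_ hyz hxz, hcc.trans h₃⟩
    rcases (vec_eq_iff (by omega) (hF.ext huv) hxy).mp h₁ with ⟨rfl, rfl⟩ | ⟨rfl, rfl⟩
    · exact huv
    · exact hF.mirror huv

theorem idealCount_eq_ncard_boundedFilters (hn : 2 ≤ n) (hD : IsTypeD n b) (h : ℕ) :
    idealCount b h = (boundedFilters (2 * n - 1) h).ncard := by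
  obtain ⟨e, he⟩ := hD
  rw [idealCount_eq]
  refine Set.ncard_congr (fun Φ _ => pairsOf e Φ) ?_ ?_ ?_
  · rintro Φ ⟨hΦ, hh⟩
    refine ⟨isSymFilter_pairsOf hn he hΦ, fun u v huv => ?_⟩
    rw [iterSum_pairsOf hn he hΦ.isPos, hh] at huv
    obtain ⟨-, α, hα, -⟩ := huv
    exact hα
  · rintro Φ Ψ ⟨hΦ, -⟩ ⟨hΨ, -⟩ h
    exact (subset_of_pairsOf hn he hΦ.isPos h).antisymm
      (subset_of_pairsOf hn he hΨ.isPos h.symm)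
  · rintro F ⟨hF, hh⟩
    have hr := isRootFilter_rootsOfPairs hn he hF
    refine ⟨rootsOfPairs e F, ⟨hr, ?_⟩, pairsOf_rootsOfPairs hn he hF⟩
    rw [eq_empty_iff_pairsOf (e := e) hn he (isPos_rootSeries hr.isPos h)]
    intro u v huv
    rw [← iterSum_pairsOf hn he hr.isPos, pairsOf_rootsOfPairs hn he hF] at huv
    exact hh u v huv

end TypeD

theorem deltaLE_eq {L : ℕ → Type*} [∀ n, LieRing (L n)] [∀ n, LieAlgebra ℂ (L n)]
    [∀ n, FiniteDimensional ℂ (L n)] [∀ n, LieAlgebra.IsKilling ℂ (L n)]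
    {H : ∀ n, LieSubalgebra ℂ (L n)} [∀ n, (H n).IsCartanSubalgebra]
    (b : ∀ n, (rootSystem (H n)).Base) (hD : ∀ n, 2 ≤ n → IsTypeD n (b n)) (h n : ℕ)
    (hn : 1 ≤ n) :
    (deltaLE b h n : ℚ) = 2 * linCount h (2 * n) - linCount h (2 * n - 1) := by
  obtain rfl | hn' := hn.eq_or_lt
  · simpa [deltaLE] using (two_mul_linCount_two_sub h).symm
  · have h2 : 2 ≤ n := hn'
    rw [deltaLE, if_neg (by omega), if_neg (by omega),
      idealCount_eq_ncard_boundedFilters h2 (hD n h2), ncard_boundedFilters h2]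

end IdealCount

theorem corollaryD2 {L : ℕ → Type*} [∀ n, LieRing (L n)] [∀ n, LieAlgebra ℂ (L n)]
    [∀ n, FiniteDimensional ℂ (L n)] [∀ n, LieAlgebra.IsKilling ℂ (L n)]
    {H : ∀ n, LieSubalgebra ℂ (L n)} [∀ n, (H n).IsCartanSubalgebra]
    (b : ∀ n, (LieAlgebra.IsKilling.rootSystem (H n)).Base)
    (hD : ∀ n, 2 ≤ n → AdNilp.IsTypeD n (b n)) :
    AdNilp.genFun (AdNilp.deltaLE b 0) = AdNilp.X / (1 - AdNilp.X) ∧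
    AdNilp.genFun (AdNilp.deltaLE b 1) =
      AdNilp.X * (1 + 2 * AdNilp.X) / (1 - 2 * AdNilp.X) ∧
    (∀ h : ℕ, 2 ≤ h → Even h →
      AdNilp.genFun (AdNilp.deltaLE b h) =
        AdNilp.X *
          (6 * AdNilp.Utilde 1
            + ∑ i ∈ Finset.Icc 1 ((h - 2) / 2),
                (6 * (i : LaurentSeries ℚ) + 8) * AdNilp.Utilde (2 * (i : ℤ) + 1)
            + (3 * (h : LaurentSeries ℚ) + 4) * AdNilp.Utilde ((h : ℤ) + 1)
            + ∑ i ∈ Finset.Icc 0 ((h - 2) / 2),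
                (6 * (i : LaurentSeries ℚ) + 5) * AdNilp.Utilde (2 * (h : ℤ) + 1 - 2 * (i : ℤ))
            + AdNilp.Utilde (2 * (h : ℤ) + 3))
        / (AdNilp.Utilde ((h : ℤ) + 1) * AdNilp.Utilde ((h : ℤ) + 2))) ∧
    (∀ h : ℕ, 2 ≤ h → Odd h →
      AdNilp.genFun (AdNilp.deltaLE b h) =
        AdNilp.X *
          (6 * AdNilp.Utilde 1
            + ∑ i ∈ Finset.Icc 1 ((h - 3) / 2),
                (6 * (i : LaurentSeries ℚ) + 8) * AdNilp.Utilde (2 * (i : ℤ) + 1)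
            + (3 * (h : LaurentSeries ℚ) + 4) * AdNilp.Utilde (h : ℤ)
            + ∑ i ∈ Finset.Icc 0 ((h - 1) / 2),
                (6 * (i : LaurentSeries ℚ) + 5) * AdNilp.Utilde (2 * (h : ℤ) + 1 - 2 * (i : ℤ))
            + AdNilp.Utilde (2 * (h : ℤ) + 3))
        / (AdNilp.Utilde ((h : ℤ) + 1) * AdNilp.Utilde ((h : ℤ) + 2))) := by
  have h0 (h : ℕ) : AdNilp.deltaLE b h 0 = 0 := if_pos rfl
  have hδ := IdealCount.deltaLE_eq b hD
  refine ⟨IdealCount.genFun_of_zero (h0 0) (hδ 0) rfl, IdealCount.genFun_of_one (h0 1) (hδ 1) rfl,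
    fun h h2 he => ?_, fun h h2 ho => ?_⟩
  · obtain ⟨k, hk⟩ := he
    exact IdealCount.genFun_of_even (h0 h) (hδ h) (j := k - 1) (by omega)
  · obtain ⟨k, hk⟩ := ho
    exact IdealCount.genFun_of_odd (h0 h) (hδ h) (j := k - 1) (by omega)
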